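/- **Problem (min-sum barrier coverage).** An instance consists of $n$ sensors with coordinates $x_1,\dots,x_n\in\mathbb R$ (arbitrary, not necessarily sorted), a common covering range $z>0$, and a barrier $B=[0,\beta]$ with $2z<\beta\le 2zn$. A sensor at location $y$ covers $[y-z,y+z]$. The task is to find new locations $y_1,\dots,y_n$ of the sensors such that every point of $B$ is covered by at least one sensor and $\sum_{i=1}^n|x_i-y_i|$ is minimum among all locations that cover $B$. The sensors may lie everywhere on the line, so this includes the general case, in which there are sensors on both sides of $B$ whose covering intervals do not meet $B$; the *containing case* is the one in which the covering interval $[x_i-z,x_i+z]$ of every sensor meets $B$. **Theorem.** (1) The problem is solvable in $O(n\log n)$ time: there are a program and a constant $C$ such that on every instance, for every $n$, the program outputs the locations $y_1,\dots,y_n$ of an optimal solution after at most $C\,n\log n$ steps. Here a program is a fixed first-order recursive program on real numbers and linked cells; a step is one exact arithmetic operation ($+,-,\times,/$) or comparison on two reals, the loading of a rational constant, one access to a variable, the creation or inspection of one cell, the passing of one argument, or one jump. Such a program runs in the same time, up to a constant factor, on a real RAM. (2) This is optimal: there is a constant $c>0$ such that for every $n\ge 2$, every algebraic decision tree (with tests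 of the sign of real polynomials of arbitrary degree in $x_1,\dots,x_n,z,\beta$, and leaves that output a quotient of two such polynomials for each of $y_1,\dots,y_n$) that returns an optimal solution for all instances with $n$ sensors of the containing case has height at least $c\,n\log n$. -/

import Mathlib

namespace BarrierCoverage

/-! ### The min-sum barrier coverage problem

`n` sensors on the real line at `x i`, all with covering range `z`; the barrier is `[0, β]`. -/

/-- When the sensors are at the locations `y i`, every point of the barrier `[0, β]` is covered
by the interval `[y i - z, y i + z]` of at least one sensor. -/
def Covers {n : ℕ} (z β : ℝ) (y : Fin n → ℝ) : Prop :=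
  ∀ p ∈ Set.Icc 0 β, ∃ i, p ∈ Set.Icc (y i - z) (y i + z)

/-- Sum of the moving distances of all sensors, from the locations `x` to the locations `y`. -/
def totalMove {n : ℕ} (x y : Fin n → ℝ) : ℝ :=
  ∑ i, |x i - y i|

/-- `y` is an optimal solution of the instance `(x, z, β)`: it covers the barrier, and no
configuration that covers the barrier has a smaller sum of moving distances. -/
def IsOptimal {n : ℕ} (x : Fin n → ℝ) (z β : ℝ) (y : Fin n → ℝ) : Prop :=
  Covers z β y ∧ ∀ y' : Fin n → ℝ, Covers z β y' → totalMove x y ≤ totalMove x y'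

/-- The standing assumptions on an instance: positive range, a barrier longer than one covering
interval, and enough sensors to cover it. The coordinates are arbitrary and not sorted. -/
structure IsInstance (n : ℕ) (z β : ℝ) : Prop where
  range_pos : 0 < z
  not_trivial : 2 * z < β
  feasible : β ≤ 2 * z * n

/-- The containing case: each covering interval meets the barrier in the input. -/
def Containing {n : ℕ} (x : Fin n → ℝ) (z β : ℝ) : Prop :=
  ∀ i, (Set.Icc (x i - z) (x i + z) ∩ Set.Icc 0 β).Nonempty

/-! ### Programs over the reals with a step count

A uniform machine model with unit-cost exact real arithmetic: first-order recursive programs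
whose data are real numbers and linked cells. Every counted step (a variable access, an
arithmetic operation on two reals, a comparison of two reals, the creation or the inspection of
one cell, the passing of one argument, a jump) is a constant number of steps of a real RAM, so
a running time in this model is, up to a constant depending on the program, a running time
on the real RAM (without rounding). There is no random access by computed addresses. -/

/-- Data: the empty pointer, a real number, or a pointer to a cell with two fields. -/
inductive Val : Type
  | nil : Val
  | num (r : ℝ) : Val
  | cons (a b : Val) : Val

/-- The linked list of the given real numbers. -/
def Val.ofList : List ℝ → Val
  | [] => .nil
  | r :: l => .cons (.num r) (Val.ofList l)

/-- The four arithmetic operations. -/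
inductive Op : Type
  | add | sub | mul | div

/-- `op.Result r s t`: the operation `op` on `r`, `s` yields `t`. Division by zero has no
result, so a program that divides by zero does not terminate properly. -/
def Op.Result : Op → ℝ → ℝ → ℝ → Prop
  | .add, r, s, t => t = r + s
  | .sub, r, s, t => t = r - s
  | .mul, r, s, t => t = r * s
  | .div, r, s, t => s ≠ 0 ∧ t = r / s

/-- Expressions. Variables are indices into the environment (the most recent binding is `0`).
* `const q`: a rational constant;
* `letIn e₁ e₂`: evaluate `e₁`, bind its value as variable `0`, continue with `e₂`;
* `ifLt a b e₁ e₂`: continue with `e₁` if the real `a` is less than the real `b`, else with `e₂`;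
* `split e e₁ e₂`: if `e` is the empty pointer continue with `e₁`; if it points to a cell, bind
  the first field as variable `0` and the second as variable `1`, and continue with `e₂`;
* `call f args`: call the function number `f` on the values of the variables `args`. -/
inductive Expr : Type
  | var (i : ℕ) : Expr
  | const (q : ℚ) : Expr
  | nil : Expr
  | cons (e₁ e₂ : Expr) : Expr
  | arith (op : Op) (e₁ e₂ : Expr) : Expr
  | letIn (e₁ e₂ : Expr) : Expr
  | ifLt (a b e₁ e₂ : Expr) : Expr
  | split (e e₁ e₂ : Expr) : Expr
  | call (f : ℕ) (args : List ℕ) : Expr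

/-- A program: finitely many, possibly mutually recursive, function bodies. In the body of a
function the arguments of the call are the variables `0, 1, …`. -/
abbrev Program : Type := List Expr

/-- `Eval P env e v t`: in the program `P` and the environment `env`, the expression `e`
evaluates to `v` in exactly `t` steps (call by value). An ill-formed computation (undefined
variable or function, operation on data of the wrong kind, division by zero) or an infinite one
has no value. -/
inductive Eval (P : Program) : List Val → Expr → Val → ℕ → Prop
  | var {env : List Val} {i : ℕ} {v : Val} (h : env[i]? = some v) :
      Eval P env (.var i) v 1
  | const {env : List Val} (q : ℚ) :
      Eval P env (.const q) (.num (q : ℝ)) 1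
  | nil {env : List Val} :
      Eval P env .nil .nil 1
  | cons {env : List Val} {e₁ e₂ : Expr} {v₁ v₂ : Val} {t₁ t₂ : ℕ}
      (h₁ : Eval P env e₁ v₁ t₁) (h₂ : Eval P env e₂ v₂ t₂) :
      Eval P env (.cons e₁ e₂) (.cons v₁ v₂) (t₁ + t₂ + 1)
  | arith {env : List Val} {op : Op} {e₁ e₂ : Expr} {r s t : ℝ} {t₁ t₂ : ℕ}
      (h₁ : Eval P env e₁ (.num r) t₁) (h₂ : Eval P env e₂ (.num s) t₂)
      (h : op.Result r s t) :
      Eval P env (.arith op e₁ e₂) (.num t) (t₁ + t₂ + 1)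
  | letIn {env : List Val} {e₁ e₂ : Expr} {v₁ v : Val} {t₁ t₂ : ℕ}
      (h₁ : Eval P env e₁ v₁ t₁) (h₂ : Eval P (v₁ :: env) e₂ v t₂) :
      Eval P env (.letIn e₁ e₂) v (t₁ + t₂ + 1)
  | ifLt_true {env : List Val} {a b e₁ e₂ : Expr} {r s : ℝ} {v : Val} {t₁ t₂ t₃ : ℕ}
      (ha : Eval P env a (.num r) t₁) (hb : Eval P env b (.num s) t₂)
      (h : r < s) (he : Eval P env e₁ v t₃) :
      Eval P env (.ifLt a b e₁ e₂) v (t₁ + t₂ + t₃ + 1)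
  | ifLt_false {env : List Val} {a b e₁ e₂ : Expr} {r s : ℝ} {v : Val} {t₁ t₂ t₃ : ℕ}
      (ha : Eval P env a (.num r) t₁) (hb : Eval P env b (.num s) t₂)
      (h : s ≤ r) (he : Eval P env e₂ v t₃) :
      Eval P env (.ifLt a b e₁ e₂) v (t₁ + t₂ + t₃ + 1)
  | split_nil {env : List Val} {e e₁ e₂ : Expr} {v : Val} {t₁ t₂ : ℕ}
      (h : Eval P env e .nil t₁) (h₁ : Eval P env e₁ v t₂) :
      Eval P env (.split e e₁ e₂) v (t₁ + t₂ + 1)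
  | split_cons {env : List Val} {e e₁ e₂ : Expr} {a b v : Val} {t₁ t₂ : ℕ}
      (h : Eval P env e (.cons a b) t₁) (h₂ : Eval P (a :: b :: env) e₂ v t₂) :
      Eval P env (.split e e₁ e₂) v (t₁ + t₂ + 1)
  | call {env : List Val} {f : ℕ} {args : List ℕ} {vs : List Val} {body : Expr} {v : Val} {t : ℕ}
      (hargs : List.Forall₂ (fun i w => env[i]? = some w) args vs)
      (hf : P[f]? = some body) (h : Eval P vs body v t) :
      Eval P env (.call f args) v (t + args.length + 1)

/-- Evaluation is deterministic: value and number of steps are determined by the input. -/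
theorem Eval.unique {P : Program} {env : List Val} {e : Expr} {v v' : Val} {t t' : ℕ}
    (h : Eval P env e v t) (h' : Eval P env e v' t') : v = v' ∧ t = t' := by
  induction h generalizing v' t' with
  | var h => cases h' with | var h2 => simp_all
  | const q => cases h'; simp
  | nil => cases h'; simp
  | cons _ _ ih₁ ih₂ =>
    cases h' with
    | cons a b => obtain ⟨rfl, rfl⟩ := ih₁ a; obtain ⟨rfl, rfl⟩ := ih₂ b; simp
  | @arith env op _ _ _ _ _ _ _ _ _ h ih₁ ih₂ =>
    cases h' with
    | arith a b h2 =>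
      obtain ⟨h3, rfl⟩ := ih₁ a
      obtain ⟨h4, rfl⟩ := ih₂ b
      cases h3; cases h4
      cases op <;> simp_all [Op.Result]
  | letIn _ _ ih₁ ih₂ =>
    cases h' with
    | letIn a b => obtain ⟨rfl, rfl⟩ := ih₁ a; obtain ⟨rfl, rfl⟩ := ih₂ b; simp
  | ifLt_true _ _ h _ ih₁ ih₂ ih₃ =>
    cases h' with
    | ifLt_true a b h2 c =>
      obtain ⟨_, rfl⟩ := ih₁ a; obtain ⟨_, rfl⟩ := ih₂ b; obtain ⟨rfl, rfl⟩ := ih₃ c; simp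
    | ifLt_false a b h2 c =>
      obtain ⟨h3, rfl⟩ := ih₁ a; obtain ⟨h4, rfl⟩ := ih₂ b; cases h3; cases h4
      exact absurd h (not_lt.mpr h2)
  | ifLt_false _ _ h _ ih₁ ih₂ ih₃ =>
    cases h' with
    | ifLt_true a b h2 c =>
      obtain ⟨h3, rfl⟩ := ih₁ a; obtain ⟨h4, rfl⟩ := ih₂ b; cases h3; cases h4
      exact absurd h2 (not_lt.mpr h)
    | ifLt_false a b h2 c =>
      obtain ⟨_, rfl⟩ := ih₁ a; obtain ⟨_, rfl⟩ := ih₂ b; obtain ⟨rfl, rfl⟩ := ih₃ c; simp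
  | split_nil _ _ ih₁ ih₂ =>
    cases h' with
    | split_nil a b => obtain ⟨_, rfl⟩ := ih₁ a; obtain ⟨rfl, rfl⟩ := ih₂ b; simp
    | split_cons a b => obtain ⟨h3, _⟩ := ih₁ a; cases h3
  | split_cons _ _ ih₁ ih₂ =>
    cases h' with
    | split_nil a b => obtain ⟨h3, _⟩ := ih₁ a; cases h3
    | split_cons a b =>
      obtain ⟨h3, rfl⟩ := ih₁ a; cases h3; obtain ⟨rfl, rfl⟩ := ih₂ b; simp
  | @call env _ _ _ _ _ _ hargs hf _ ih =>
    cases h' with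
    | call hargs2 hf2 c =>
      have hr : Relator.RightUnique fun (i : ℕ) (w : Val) => env[i]? = some w :=
        fun _ _ _ h1 h2 => Option.some.inj (h1.symm.trans h2)
      have := List.right_unique_forall₂' hr hargs hargs2
      subst this
      rw [hf] at hf2
      cases hf2
      obtain ⟨rfl, rfl⟩ := ih c
      simp

/-- `P.Run inputs v t`: the main function (number `0`) of `P`, started on `inputs`, returns `v`
after exactly `t` steps. -/
def Program.Run (P : Program) (inputs : List Val) (v : Val) (t : ℕ) : Prop :=
  ∃ body, P[0]? = some body ∧ Eval P inputs body v t

/-- The input of an instance: the list of the sensor coordinates, in the given order, the range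
`z`, and the length `β` of the barrier. -/
noncomputable def encodeInput {n : ℕ} (x : Fin n → ℝ) (z β : ℝ) : List Val :=
  [Val.ofList (List.ofFn x), .num z, .num β]

/-- The output: the list of the new locations, the `i`-th entry for the `i`-th sensor of the
input. -/
noncomputable def encodeOutput {n : ℕ} (y : Fin n → ℝ) : Val :=
  Val.ofList (List.ofFn y)

/-! ### Algebraic decision trees -/

/-- Algebraic decision trees with input variables `σ` and output entries `ι`: a branching node
tests the sign of a real polynomial of arbitrary degree in the input; a leaf returns, for
every output entry, a quotient of two real polynomials in the input. -/
inductive DecisionTree (σ ι : Type) : Type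
  | leaf (num den : ι → MvPolynomial σ ℝ) : DecisionTree σ ι
  | branch (p : MvPolynomial σ ℝ) (neg zero pos : DecisionTree σ ι) : DecisionTree σ ι

namespace DecisionTree

variable {σ ι : Type}

/-- The output of the tree on an input. (A zero denominator gives `0`, which only makes the
model more permissive.) -/
noncomputable def eval : DecisionTree σ ι → (σ → ℝ) → ι → ℝ
  | leaf num den, a => fun i => MvPolynomial.eval a (num i) / MvPolynomial.eval a (den i)
  | branch p neg zero pos, a =>
    if MvPolynomial.eval a p < 0 then neg.eval a
    else if MvPolynomial.eval a p = 0 then zero.eval a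
    else pos.eval a

/-- The number of tests in the worst case; arithmetic is not charged. -/
def height : DecisionTree σ ι → ℕ
  | leaf _ _ => 0
  | branch _ neg zero pos => max neg.height (max zero.height pos.height) + 1

end DecisionTree

/-- The input of a decision tree: the coordinates `x i`, then `z` and `β`. -/
def treeInput {n : ℕ} (x : Fin n → ℝ) (z β : ℝ) : Fin n ⊕ Fin 2 → ℝ :=
  Sum.elim x ![z, β]

end BarrierCoverage

namespace BarrierCoverage

/-! ### The program

A leftist max-heap with entries `(key, payload)`, heap sort, a right-to-left sweep that keeps the
breakpoints of a convex value function in the heap, the marginal costs of bringing in one more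
sensor from outside on either side, and the placement of the sensors. -/

/-! Upper bound. Sort the sensors and number them from `0`. Exchanging two crossing targets never
costs anything (`abs_sub_swap_le`), so sorted locations suffice. Clamp the `i`-th location to `[-z,
β + z]` and subtract `2 z i`. The condition that neighbours leave no gap now says that these offsets
descend, and the two ends of the barrier bound them from above and below. For sensors near the
barrier this means minimising `∑ |u i - a i|` over descending sequences. The minimum is computed
from right to left by keeping the breakpoints of a convex piecewise linear function in a heap. The
least cost of a path between `L` and `U` is `K + ∑ (b - U)⁺ + ∑ (L - τ)⁺`: the two bounds do not
interact (`IsValue`).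

A sensor from outside has a nonconvex cost: nothing if it stays, otherwise a fixed charge up to the
border of `[-z, β + z]` plus the distance from there. The unused sensors are the first `e` on the
left and those from `f` on at the right (`exists_window`). This choice corresponds to the bounds `U
= z - 2 z e` and `L = β + z - 2 z f`, under which the unused sensors contribute nothing to the cost
counted from the border. One value function therefore serves all windows. With the charges added,
the objective is a function of `U` plus a function of `L`, and both are convex along steps of `2 z`,
since nearer sensors are brought in first. Every sensor brought in, on either side, lowers `L - U`
by `2 z`. So it is optimal to take marginal costs in increasing order as long as `U < L` or the cost
is negative (`greedy_optimal`); `plan_optimal` combines these facts. All this needs `O(n)`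
operations on leftist heaps, each of logarithmic cost, and otherwise linear time.

Lower bound. For `z = 1` and `β = 2 n` the covering intervals have no slack. For inputs close to a
permutation of `1, 3, …, 2 n - 1`, the only optimal solution is that permuted grid, so a correct
tree is constant on each of `n!` open sets, with different values. The quotients at one leaf can
equal only one of these constants on an open set. Hence `n! ≤ 3 ^ height`
(`card_le_three_pow_height`), and `n ^ n ≤ (n!) ^ 2` gives the bound. -/

/-- The main function `main(xs, z, b)`, with `w = z + z`:
* sort the coordinates with their indices, and sweep over them; this gives the breakpoints of the
  convex cost of the offsets and the sorted negated turning points;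
* `far` finds the sensors that lie left of `-z` and, in the mirrored picture, right of `b + z`;
* `side` lists the marginal costs of bringing these in one by one, tagged by `w` or by `0`;
* the two lists are merged by heap sort, and `greedy` selects the final bounds `u`, `l` of the
  offsets;
* `place` computes the locations, which are sorted back into input order. -/
def mainBody : Expr :=
  .letIn (.arith .add (.var 1) (.var 1)) (.letIn (.const 0) (.letIn .nil (.letIn (.call 8 [3,
    1]) (.letIn (.call 7 [0]) (.letIn (.call 10 [0, 3, 6, 7]) (.split (.var 0) .nil (.letIn
    (.call 6 [0, 5]) (.letIn (.call 11 [2]) (.letIn (.call 7 [0]) (.letIn (.arith .sub (.const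
    0) (.var 12)) (.letIn (.call 13 [7, 0, 11, 13, 9]) (.split (.var 0) .nil (.letIn (.call 12
    [10, 12, 13, 14]) (.split (.var 0) .nil (.letIn (.arith .sub (.var 6) (.var 20)) (.letIn
    (.arith .sub (.arith .sub (.var 1) (.var 21)) (.var 20)) (.letIn (.call 13 [3, 1, 19, 0,
    17]) (.split (.var 0) .nil (.letIn (.call 17 [14, 9, 8, 22, 22]) (.letIn (.call 17 [13, 2,
    1, 23, 22]) (.letIn (.call 5 [1, 22]) (.letIn (.call 5 [1, 0]) (.letIn (.call 6 [0, 24])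
    (.letIn (.arith .sub (.const 0) (.var 5)) (.letIn (.call 18 [1, 14, 0, 28]) (.split (.var
    0) .nil (.letIn (.call 19 [27, 25, 30, 0, 1, 33, 34]) (.letIn (.call 7 [0]) (.call 20
    [0])))))))))))))))))))))))))))))

/-- `rank(h)`: the rank of a leftist heap, `0` if it is empty. -/
def rankBody : Expr :=
  .split (.var 0) (.const 0) (.split (.var 1) (.const 0) (.var 0))

/-- `mk(e, l, r)`: the heap with root entry `e` and subheaps `l`, `r`, the one of larger rank
    first. -/
def mkBody : Expr :=
  .letIn (.call 1 [1]) (.letIn (.call 1 [3]) (.ifLt (.var 1) (.var 0) (.cons (.var 2) (.cons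
    (.arith .add (.var 1) (.const 1)) (.cons (.var 4) (.var 3)))) (.cons (.var 2) (.cons
    (.arith .add (.var 0) (.const 1)) (.cons (.var 3) (.var 4))))))

/-- `merge(g, h)`: the union of two heaps. -/
def mergeBody : Expr :=
  .split (.var 0) (.var 1) (.split (.var 3) (.var 2) (.split (.var 2) .nil (.split (.var 2)
    .nil (.ifLt (.var 2) (.var 0) (.call 3 [9, 8]) (.split (.var 7) .nil (.split (.var 1) .nil
    (.letIn (.call 3 [1, 13]) (.call 2 [11, 1, 0]))))))))

/-- `ins(k, p, h)`: insertion of the entry `(k, p)` into the heap `h`. -/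
def insBody : Expr :=
  .letIn (.cons (.cons (.var 0) (.var 1)) (.cons (.const 1) (.cons .nil .nil))) (.call 3 [0,
    3])

/-- `heapify(s, h)`: insertion of all entries of the list `s` into the heap `h`. -/
def heapifyBody : Expr :=
  .split (.var 0) (.var 1) (.split (.var 0) .nil (.letIn (.call 4 [0, 1, 5]) (.call 5 [4, 0])))

/-- `drain(h, acc)`: the entries of `h` in increasing order of keys, followed by `acc`. -/
def drainBody : Expr :=
  .split (.var 0) (.var 1) (.split (.var 1) .nil (.split (.var 1) .nil (.letIn (.call 3 [0, 1])
    (.letIn (.cons (.var 5) (.var 8)) (.call 6 [1, 0])))))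

/-- `sort(s)`: heap sort of a list of entries by their keys. -/
def sortBody : Expr :=
  .letIn .nil (.letIn (.call 5 [1, 0]) (.call 6 [0, 1]))

/-- `tag(s, i)`: pairs the reals of the list `s` with `i`, `i + 1`, and so on. -/
def tagBody : Expr :=
  .split (.var 0) .nil (.letIn (.arith .add (.var 3) (.const 1)) (.letIn (.call 8 [2, 0])
    (.cons (.cons (.var 2) (.var 5)) (.var 0))))

/-- `insPop(a, h, ts)`: inserts `a` into `h` and moves the maximum of the heap to the front of
    `ts`. -/
def insPopBody : Expr :=
  .letIn .nil (.letIn (.call 4 [1, 0, 2]) (.split (.var 0) .nil (.split (.var 0) .nil (.split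
    (.var 3) .nil (.split (.var 1) .nil (.letIn (.call 3 [0, 1]) (.cons (.var 0) (.cons (.var
    5) (.var 13)))))))))

/-- `sweep(s, c, z, b)`: the breakpoints (a heap) of the cost of the offsets of the sensors of the
sorted list `s`, and the list of their turning points, for cells that start at `c`. -/
def sweepBody : Expr :=
  .split (.var 0) (.cons .nil .nil) (.split (.var 0) .nil (.letIn (.arith .add (.var 5) (.arith
    .add (.var 6) (.var 6))) (.letIn (.call 10 [4, 0, 7, 8]) (.split (.var 0) .nil (.ifLt (.var
    4) (.arith .sub (.const 0) (.var 10)) (.letIn (.arith .sub (.arith .sub (.const 0) (.var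
    10)) (.var 9)) (.call 9 [0, 1, 2])) (.ifLt (.arith .add (.var 11) (.var 10)) (.var 4)
    (.letIn (.arith .sub (.arith .add (.var 11) (.var 10)) (.var 9)) (.letIn .nil (.letIn
    (.call 4 [1, 0, 2]) (.cons (.var 0) (.cons (.var 13) (.var 4)))))) (.letIn (.arith .sub
    (.var 4) (.var 9)) (.letIn .nil (.letIn (.call 4 [1, 0, 2]) (.call 9 [2, 0, 4]))))))))))

/-- `neg(s)`: the list of the negated reals of `s`, as entries without payload. -/
def negBody : Expr :=
  .split (.var 0) .nil (.letIn (.call 11 [1]) (.cons (.cons (.arith .sub (.const 0) (.var 1))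
    .nil) (.var 0)))

/-- `revNeg(s, acc, c, w)`: the keys of `s`, negated and in reverse order, before `acc`, together
    with
`c` increased by `w` for each entry. -/
def revNegBody : Expr :=
  .split (.var 0) (.cons (.var 2) (.var 1)) (.split (.var 0) .nil (.letIn (.cons (.cons (.arith
    .sub (.const 0) (.var 0)) .nil) (.var 5)) (.letIn (.arith .add (.var 7) (.var 8)) (.call 12
    [5, 1, 0, 9]))))

/-- `far(s, b, w, c, acc)`: the distances to `b` of the leading keys of `s` below `b`, put before
`acc`, together with `c` decreased by `w` for each of them. -/
def farBody : Expr :=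
  .split (.var 0) (.cons (.var 3) (.var 4)) (.split (.var 0) .nil (.ifLt (.var 0) (.var 5)
    (.letIn (.cons (.arith .sub (.var 5) (.var 0)) (.var 8)) (.letIn (.arith .sub (.var 8)
    (.var 7)) (.call 13 [5, 7, 8, 0, 1]))) (.cons (.var 7) (.var 8))))

/-- `sums(s, a, n)`: `a` plus the sum of the keys of `s`, and `n` plus their number. -/
def sumsBody : Expr :=
  .split (.var 0) (.cons (.var 1) (.var 2)) (.split (.var 0) .nil (.letIn (.arith .add (.var 5)
    (.var 0)) (.letIn (.arith .add (.var 7) (.const 1)) (.call 14 [5, 1, 0]))))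

/-- `marg(ds, bs, a, n, u, s, w, p)`: drops the leading breakpoints below `u` from `bs`, whose sum
    is
`a` and whose number is `n`, then continues with `emit`. -/
def margBody : Expr :=
  .split (.var 0) .nil (.split (.var 3) (.call 16 [2, 3, 4, 5, 6, 7, 8, 9]) (.split (.var 0)
    .nil (.ifLt (.var 0) (.var 10) (.letIn (.arith .sub (.var 8) (.var 0)) (.letIn (.arith .sub
    (.var 10) (.const 1)) (.call 15 [8, 5, 1, 0, 12, 13, 14, 15]))) (.call 16 [6, 7, 8, 9, 10,
    11, 12, 13]))))

/-- `emit(ds, bs, a, n, u, s, w, p)`: outputs the marginal cost of one more sensor at distance the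
first entry of `ds`, tagged by `p`; `s` is the hinge sum at the previous bound. -/
def emitBody : Expr :=
  .split (.var 0) .nil (.letIn (.arith .sub (.var 4) (.arith .mul (.var 5) (.var 6))) (.letIn
    (.arith .add (.var 7) (.var 9)) (.letIn (.call 15 [3, 5, 6, 7, 0, 1, 10, 11]) (.cons (.cons
    (.arith .sub (.arith .add (.var 3) (.var 2)) (.var 10)) (.var 12)) (.var 0)))))

/-- `side(bs, ds, u, w, p)`: the list of the marginal costs on one side, tagged by `p`. -/
def sideBody : Expr :=
  .letIn (.const 0) (.letIn (.call 14 [1, 0, 0]) (.split (.var 0) .nil (.letIn (.cons (.var 3)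
    (.var 5)) (.letIn (.call 15 [0, 5, 1, 2, 7, 4, 8, 9]) (.split (.var 0) .nil (.var 1))))))

/-- `greedy(s, u, l, w)`: runs through the sorted marginal costs as long as the bounds are
incompatible or the cost is negative, and updates the bounds `u`, `l`. -/
def greedyBody : Expr :=
  .split (.var 0) (.cons (.var 1) (.var 2)) (.split (.var 0) .nil (.letIn (.arith .add (.var 5)
    (.var 1)) (.letIn (.arith .sub (.arith .add (.var 7) (.var 2)) (.var 8)) (.ifLt (.var 7)
    (.var 8) (.call 18 [5, 1, 0, 9]) (.ifLt (.var 2) (.const 0) (.call 18 [5, 1, 0, 9]) (.cons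
    (.var 7) (.var 8)))))))

/-- `place(s, ts, c, v, l, z, b)`: the pairs of index and new location, obtained by backtracking
along the turning points `ts` from the offset bound `v`. -/
def placeBody : Expr :=
  .split (.var 0) .nil (.split (.var 0) .nil (.split (.var 5) .nil (.letIn (.ifLt (.var 9)
    (.var 0) (.var 9) (.var 0)) (.letIn (.ifLt (.var 0) (.var 11) (.var 11) (.var 0)) (.letIn
    (.arith .add (.var 0) (.var 10)) (.letIn (.ifLt (.var 5) (.arith .sub (.const 0) (.var 14))
    (.ifLt (.arith .sub (.const 0) (.var 14)) (.var 0) (.var 0) (.var 5)) (.ifLt (.arith .add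
    (.var 15) (.var 14)) (.var 5) (.ifLt (.var 0) (.arith .add (.var 15) (.var 14)) (.var 0)
    (.var 5)) (.var 0))) (.letIn (.arith .add (.var 12) (.arith .add (.var 15) (.var 15)))
    (.letIn (.call 19 [10, 6, 0, 3, 15, 16, 17]) (.cons (.cons (.var 9) (.var 2)) (.var
    0))))))))))

/-- `strip(s)`: the list of the second components. -/
def stripBody : Expr :=
  .split (.var 0) .nil (.split (.var 0) .nil (.letIn (.call 20 [3]) (.cons (.var 2) (.var 0))))

/-- The program. -/
def prog : Program :=
  [mainBody, rankBody, mkBody, mergeBody, insBody, heapifyBody, drainBody, sortBody, tagBody,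
    insPopBody, sweepBody, negBody, revNegBody, farBody, sumsBody, margBody, emitBody,
    sideBody, greedyBody, placeBody, stripBody]

/-! ### Bounded evaluation -/

/-- The expression `e` evaluates to `v` in at most `T` steps of the program `prog`. -/
def Ev (env : List Val) (e : Expr) (v : Val) (T : ℕ) : Prop :=
  ∃ t ≤ T, Eval prog env e v t

/-- Function number `f` of `prog`, called on `vs`, returns `v` in at most `T` steps. -/
def Call (f : ℕ) (vs : List Val) (v : Val) (T : ℕ) : Prop :=
  ∃ body, prog[f]? = some body ∧ Ev vs body v T

namespace Ev

variable {env : List Val} {e e₁ e₂ a b : Expr} {v v₁ v₂ w : Val} {r s : ℝ} {T T₁ T₂ T₃ : ℕ}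

/-- A derivation that follows the syntax of a program produces some value and some sum of steps;
this brings both into the desired form at the end. -/
theorem of_eq (h : Ev env e v T₁) (hv : v = w) (hT : T₁ ≤ T) : Ev env e w T := by
  obtain ⟨t, ht, h⟩ := h
  exact ⟨t, ht.trans hT, hv ▸ h⟩

theorem var {i : ℕ} (h : env[i]? = some v) : Ev env (.var i) v 1 := ⟨1, le_rfl, .var h⟩

theorem zero : Ev env (.const 0) (.num 0) 1 :=
  ⟨1, le_rfl, by simpa using Eval.const (P := prog) (env := env) 0⟩

theorem one : Ev env (.const 1) (.num 1) 1 :=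
  ⟨1, le_rfl, by simpa using Eval.const (P := prog) (env := env) 1⟩

theorem nil : Ev env .nil .nil 1 := ⟨1, le_rfl, .nil⟩

theorem cons (h₁ : Ev env e₁ v₁ T₁) (h₂ : Ev env e₂ v₂ T₂) :
    Ev env (.cons e₁ e₂) (.cons v₁ v₂) (T₁ + T₂ + 1) := by
  obtain ⟨t₁, l₁, h₁⟩ := h₁
  obtain ⟨t₂, l₂, h₂⟩ := h₂
  exact ⟨_, by omega, .cons h₁ h₂⟩

theorem arith {op : Op} {t : ℝ} (h₁ : Ev env e₁ (.num r) T₁) (h₂ : Ev env e₂ (.num s) T₂)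
    (h : op.Result r s t) : Ev env (.arith op e₁ e₂) (.num t) (T₁ + T₂ + 1) := by
  obtain ⟨t₁, l₁, h₁⟩ := h₁
  obtain ⟨t₂, l₂, h₂⟩ := h₂
  exact ⟨_, by omega, .arith h₁ h₂ h⟩

theorem add (h₁ : Ev env e₁ (.num r) T₁) (h₂ : Ev env e₂ (.num s) T₂) :
    Ev env (.arith .add e₁ e₂) (.num (r + s)) (T₁ + T₂ + 1) := arith h₁ h₂ rfl

theorem sub (h₁ : Ev env e₁ (.num r) T₁) (h₂ : Ev env e₂ (.num s) T₂) :
    Ev env (.arith .sub e₁ e₂) (.num (r - s)) (T₁ + T₂ + 1) := arith h₁ h₂ rfl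

theorem mul (h₁ : Ev env e₁ (.num r) T₁) (h₂ : Ev env e₂ (.num s) T₂) :
    Ev env (.arith .mul e₁ e₂) (.num (r * s)) (T₁ + T₂ + 1) := arith h₁ h₂ rfl

theorem letIn (h₁ : Ev env e₁ v₁ T₁) (h₂ : Ev (v₁ :: env) e₂ v T₂) :
    Ev env (.letIn e₁ e₂) v (T₁ + T₂ + 1) := by
  obtain ⟨t₁, l₁, h₁⟩ := h₁
  obtain ⟨t₂, l₂, h₂⟩ := h₂
  exact ⟨_, by omega, .letIn h₁ h₂⟩

theorem ifT (ha : Ev env a (.num r) T₁) (hb : Ev env b (.num s) T₂) (h : r < s)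
    (he : Ev env e₁ v T₃) : Ev env (.ifLt a b e₁ e₂) v (T₁ + T₂ + T₃ + 1) := by
  obtain ⟨t₁, l₁, h₁⟩ := ha
  obtain ⟨t₂, l₂, h₂⟩ := hb
  obtain ⟨t₃, l₃, h₃⟩ := he
  exact ⟨_, by omega, .ifLt_true h₁ h₂ h h₃⟩

theorem ifF (ha : Ev env a (.num r) T₁) (hb : Ev env b (.num s) T₂) (h : s ≤ r)
    (he : Ev env e₂ v T₃) : Ev env (.ifLt a b e₁ e₂) v (T₁ + T₂ + T₃ + 1) := by
  obtain ⟨t₁, l₁, h₁⟩ := ha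
  obtain ⟨t₂, l₂, h₂⟩ := hb
  obtain ⟨t₃, l₃, h₃⟩ := he
  exact ⟨_, by omega, .ifLt_false h₁ h₂ h h₃⟩

theorem splitN (h₁ : Ev env e .nil T₁) (h₂ : Ev env e₁ v T₂) :
    Ev env (.split e e₁ e₂) v (T₁ + T₂ + 1) := by
  obtain ⟨t₁, l₁, h₁⟩ := h₁
  obtain ⟨t₂, l₂, h₂⟩ := h₂
  exact ⟨_, by omega, .split_nil h₁ h₂⟩

theorem splitC (h₁ : Ev env e (.cons v₁ v₂) T₁) (h₂ : Ev (v₁ :: v₂ :: env) e₂ v T₂) :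
    Ev env (.split e e₁ e₂) v (T₁ + T₂ + 1) := by
  obtain ⟨t₁, l₁, h₁⟩ := h₁
  obtain ⟨t₂, l₂, h₂⟩ := h₂
  exact ⟨_, by omega, .split_cons h₁ h₂⟩

/-- The lookups of all arguments form one equation of lists, which `rfl` decides by computation in a
concrete environment. -/
theorem call {f : ℕ} {args : List ℕ} {vs : List Val}
    (hargs : args.map (fun i => env[i]?) = vs.map some) (h : Call f vs v T) :
    Ev env (.call f args) v (T + args.length + 1) := by
  obtain ⟨body, hf, t, ht, h⟩ := h
  refine ⟨t + args.length + 1, by omega, .call ?_ hf h⟩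
  have h' : List.Forall₂ (· = ·) (args.map fun i => env[i]?) (vs.map some) := by
    rw [hargs]; exact List.forall₂_same.2 fun _ _ => rfl
  simpa [List.forall₂_map_left_iff, List.forall₂_map_right_iff] using h'

end Ev

theorem Call.mono {f : ℕ} {vs : List Val} {v : Val} {T T' : ℕ} (h : Call f vs v T)
    (hT : T ≤ T') : Call f vs v T' := by
  obtain ⟨body, hf, h⟩ := h
  exact ⟨body, hf, h.of_eq rfl hT⟩

/-! ### Lists and heaps as data -/

/-- The linked list of the given data. -/
def lst : List Val → Val
  | [] => .nil
  | v :: l => .cons v (lst l)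

/-- An entry with a real key and a payload. -/
def entry (p : ℝ × Val) : Val := .cons (.num p.1) p.2

theorem ofList_eq_lst (l : List ℝ) : Val.ofList l = lst (l.map .num) := by
  induction l with
  | nil => rfl
  | cons r l ih => simp [Val.ofList, lst, ih]

/-- `IsHeap h s r`: the datum `h` is a leftist max-heap of rank `r` whose multiset of entries
is `s`. -/
inductive IsHeap : Val → Multiset (ℝ × Val) → ℕ → Prop
  | nil : IsHeap .nil 0 0
  | node {l r : Val} {sl sr : Multiset (ℝ × Val)} {nl nr : ℕ} (p : ℝ × Val)
      (hl : IsHeap l sl nl) (hr : IsHeap r sr nr) (hle : nr ≤ nl)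
      (hmax : ∀ q ∈ sl + sr, q.1 ≤ p.1) :
      IsHeap (.cons (entry p) (.cons (.num (nr + 1 : ℕ)) (.cons l r))) (p ::ₘ (sl + sr)) (nr + 1)

/-- The right subheap has the smaller rank, so below a root of rank `r + 1` there are two heaps of
rank at least `r`. This makes ranks logarithmic in the size. -/
theorem IsHeap.two_pow_le {h : Val} {s : Multiset (ℝ × Val)} {r : ℕ} (hh : IsHeap h s r) :
    2 ^ r ≤ Multiset.card s + 1 := by
  induction hh with
  | nil => simp
  | node p _ _ hle _ ihl ihr =>
    have := Nat.pow_le_pow_right (n := 2) (by norm_num) hle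
    simp only [Multiset.card_cons, Multiset.card_add, pow_succ]
    omega

theorem IsHeap.rank_le {h : Val} {s : Multiset (ℝ × Val)} {r ℓ : ℕ} (hh : IsHeap h s r)
    (hs : Multiset.card s < 2 ^ ℓ) : r ≤ ℓ := by
  have h1 := hh.two_pow_le
  exact (Nat.pow_le_pow_iff_right (by norm_num : 1 < 2)).1 (by omega)

/-! ### Heap operations -/

theorem rank_spec {h : Val} {s : Multiset (ℝ × Val)} {r : ℕ} (hh : IsHeap h s r) :
    Call 1 [h] (.num r) 6 := by
  cases hh with
  | nil =>
    exact ⟨_, rfl, Ev.of_eq (Ev.splitN (Ev.var rfl) Ev.zero) (by simp) (by norm_num)⟩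
  | node p hl hr hle hmax =>
    exact ⟨_, rfl, Ev.of_eq (Ev.splitC (Ev.var rfl) (Ev.splitC (Ev.var rfl)
        (Ev.var rfl))) rfl (by norm_num)⟩

theorem mk_spec {a b : Val} {sa sb : Multiset (ℝ × Val)} {ra rb : ℕ} (p : ℝ × Val)
    (ha : IsHeap a sa ra) (hb : IsHeap b sb rb) (hmax : ∀ q ∈ sa + sb, q.1 ≤ p.1) :
    ∃ v r, Call 2 [entry p, a, b] v 40 ∧ IsHeap v (p ::ₘ (sa + sb)) r := by
  by_cases h : ra < rb
  · have h' : (ra : ℝ) < rb := by exact_mod_cast h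
    refine ⟨_, ra + 1, ⟨_, rfl, Ev.of_eq (Ev.letIn (Ev.call rfl (rank_spec ha)) (Ev.letIn
        (Ev.call rfl (rank_spec hb)) (Ev.ifT (Ev.var
      rfl) (Ev.var rfl) h' (Ev.cons (Ev.var rfl) (Ev.cons (Ev.add (Ev.var rfl) Ev.one) (Ev.cons
      (Ev.var rfl) (Ev.var rfl))))))) rfl
      (by norm_num)⟩, ?_⟩
    have := IsHeap.node p hb ha h.le (by simpa [add_comm] using hmax)
    simpa [add_comm sb sa] using this
  · have h' : (rb : ℝ) ≤ ra := by exact_mod_cast not_lt.1 h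
    refine ⟨_, rb + 1, ⟨_, rfl, Ev.of_eq (Ev.letIn (Ev.call rfl (rank_spec ha)) (Ev.letIn
        (Ev.call rfl (rank_spec hb)) (Ev.ifF (Ev.var
      rfl) (Ev.var rfl) h' (Ev.cons (Ev.var rfl) (Ev.cons (Ev.add (Ev.var rfl) Ev.one) (Ev.cons
      (Ev.var rfl) (Ev.var rfl))))))) rfl
      (by norm_num)⟩, ?_⟩
    have := IsHeap.node p ha hb (not_lt.1 h) hmax
    simpa using this

/-- Merging descends along right subheaps, and each descent lowers the sum of the two ranks by at
least one. -/
theorem merge_spec (N : ℕ) : ∀ {g h : Val} {s₁ s₂ : Multiset (ℝ × Val)} {r₁ r₂ : ℕ},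
    IsHeap g s₁ r₁ → IsHeap h s₂ r₂ → r₁ + r₂ ≤ N →
    ∃ v r, Call 3 [g, h] v (100 * N + 100) ∧ IsHeap v (s₁ + s₂) r := by
  induction N using Nat.strong_induction_on with
  | _ N ih =>
    -- The case in which the first root dominates both heaps; the domination is expressed by the
    -- maxima of `s₁`, as the root is not yet exposed. In the other case the program first calls
    -- itself with the heaps exchanged, for which 30 steps are left over.
    have key : ∀ {g h : Val} {s₁ s₂ : Multiset (ℝ × Val)} {r₁ r₂ : ℕ},
        IsHeap g s₁ r₁ → IsHeap h s₂ r₂ → r₁ + r₂ ≤ N →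
        (∀ p ∈ s₁, (∀ q ∈ s₁, q.1 ≤ p.1) → ∀ q ∈ s₂, q.1 ≤ p.1) →
        ∃ v r, Call 3 [g, h] v (100 * N + 70) ∧ IsHeap v (s₁ + s₂) r := by
      intro g h s₁ s₂ r₁ r₂ hg hh hr hk
      cases hg with
      | nil =>
        exact ⟨h, r₂, ⟨_, rfl, Ev.of_eq (Ev.splitN (Ev.var rfl)
            (Ev.var rfl)) rfl (by omega)⟩, by simpa using hh⟩
      | @node l r sl sr nl nr p hl hr' hle hmax =>
        cases hh with
        | nil =>
          exact ⟨_, _, ⟨_, rfl, Ev.of_eq (Ev.splitC (Ev.var rfl) (Ev.splitN (Ev.var rfl)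
              (Ev.var rfl))) rfl (by omega)⟩,
            by simpa using IsHeap.node p hl hr' hle hmax⟩
        | @node l' r' sl' sr' nl' nr' p' hl' hr'' hle' hmax' =>
          have hp := hk p (by simp) (by
            intro q hq
            rcases Multiset.mem_cons.1 hq with rfl | hq
            exacts [le_rfl, hmax q hq])
          obtain ⟨m, rm, hm, hm'⟩ := ih (N - 1) (by omega) hr'
            (IsHeap.node p' hl' hr'' hle' hmax') (by omega)
          obtain ⟨v, rv, hv, hv'⟩ := mk_spec p hl hm' (by
            intro q hq
            simp only [Multiset.mem_add] at hq hmax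
            rcases hq with hq | hq | hq
            exacts [hmax q (Or.inl hq), hmax q (Or.inr hq), hp q hq])
          refine ⟨v, rv, ⟨_, rfl, Ev.of_eq (Ev.splitC (Ev.var rfl) (Ev.splitC (Ev.var rfl)
              (Ev.splitC (Ev.var rfl) (Ev.splitC (Ev.var
      rfl) (Ev.ifF (Ev.var rfl) (Ev.var rfl) (hp p' (by simp)) (Ev.splitC (Ev.var rfl)
      (Ev.splitC (Ev.var rfl) (Ev.letIn (Ev.call rfl hm) (Ev.call rfl hv)))))))))
            rfl ?_⟩, ?_⟩
          · simp only [List.length_cons, List.length_nil]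
            omega
          · rwa [Multiset.cons_add, add_assoc]
    intro g h s₁ s₂ r₁ r₂ hg hh hr
    cases hg with
    | nil =>
      exact ⟨h, r₂, ⟨_, rfl, Ev.of_eq (Ev.splitN (Ev.var rfl)
          (Ev.var rfl)) rfl (by omega)⟩, by simpa using hh⟩
    | @node l r sl sr nl nr p hl hr' hle hmax =>
      cases hh with
      | nil =>
        exact ⟨_, _, ⟨_, rfl, Ev.of_eq (Ev.splitC (Ev.var rfl) (Ev.splitN (Ev.var rfl)
            (Ev.var rfl))) rfl (by omega)⟩,
          by simpa using IsHeap.node p hl hr' hle hmax⟩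
      | @node l' r' sl' sr' nl' nr' p' hl' hr'' hle' hmax' =>
        have dom : ∀ {p p' : ℝ × Val} {s s' : Multiset (ℝ × Val)}, p'.1 ≤ p.1 →
            (∀ q ∈ s', q.1 ≤ p'.1) → ∀ q₀ ∈ p ::ₘ s, (∀ q ∈ p ::ₘ s, q.1 ≤ q₀.1) →
            ∀ q ∈ p' ::ₘ s', q.1 ≤ q₀.1 := by
          intro p p' s s' h1 h2 q₀ _ h4 q hq
          have h5 := h4 p (by simp)
          rcases Multiset.mem_cons.1 hq with rfl | hq
          · exact h1.trans h5
          · exact (h2 q hq).trans (h1.trans h5)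
        by_cases hlt : p.1 < p'.1
        · obtain ⟨v, rv, hv, hv'⟩ := key (IsHeap.node p' hl' hr'' hle' hmax')
            (IsHeap.node p hl hr' hle hmax) (by omega) (dom hlt.le hmax)
          refine ⟨v, rv, ⟨_, rfl, Ev.of_eq (Ev.splitC (Ev.var rfl) (Ev.splitC (Ev.var rfl)
              (Ev.splitC (Ev.var rfl) (Ev.splitC (Ev.var
      rfl) (Ev.ifT (Ev.var rfl) (Ev.var rfl) hlt (Ev.call rfl hv)))))) rfl ?_⟩, ?_⟩
          · simp only [List.length_cons, List.length_nil]
            omega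
          · rwa [add_comm]
        · obtain ⟨v, rv, hv, hv'⟩ := key (IsHeap.node p hl hr' hle hmax)
            (IsHeap.node p' hl' hr'' hle' hmax') (by omega) (dom (not_lt.1 hlt) hmax')
          exact ⟨v, rv, hv.mono (by omega), hv'⟩

theorem merge_log {g h : Val} {s₁ s₂ : Multiset (ℝ × Val)} {r₁ r₂ ℓ : ℕ}
    (hg : IsHeap g s₁ r₁) (hh : IsHeap h s₂ r₂) (h₁ : Multiset.card s₁ < 2 ^ ℓ)
    (h₂ : Multiset.card s₂ < 2 ^ ℓ) :
    ∃ v r, Call 3 [g, h] v (200 * ℓ + 100) ∧ IsHeap v (s₁ + s₂) r := by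
  obtain ⟨v, r, hv, hv'⟩ := merge_spec (2 * ℓ) hg hh
    (by have := hg.rank_le h₁; have := hh.rank_le h₂; omega)
  exact ⟨v, r, hv.mono (by omega), hv'⟩

theorem ins_spec {h : Val} {s : Multiset (ℝ × Val)} {r ℓ : ℕ} (p : ℝ × Val)
    (hh : IsHeap h s r) (hs : Multiset.card s < 2 ^ ℓ) (hℓ : 0 < ℓ) :
    ∃ v r', Call 4 [.num p.1, p.2, h] v (200 * ℓ + 120) ∧ IsHeap v (p ::ₘ s) r' := by
  have h1 : IsHeap (.cons (entry p) (.cons (.num 1) (.cons .nil .nil))) {p} 1 := by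
    simpa using IsHeap.node p IsHeap.nil IsHeap.nil le_rfl (by simp)
  obtain ⟨v, rv, hv, hv'⟩ := merge_log h1 hh
    (by simpa using Nat.one_lt_two_pow hℓ.ne') hs
  refine ⟨v, rv, ⟨_, rfl, Ev.of_eq (Ev.letIn (Ev.cons (Ev.cons (Ev.var rfl) (Ev.var rfl))
      (Ev.cons Ev.one (Ev.cons Ev.nil
      Ev.nil))) (Ev.call rfl hv)) rfl ?_⟩, ?_⟩
  · simp only [List.length_cons, List.length_nil]
    omega
  · simpa using hv'

theorem heapify_spec {ℓ : ℕ} (hℓ : 0 < ℓ) (l : List (ℝ × Val)) :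
    ∀ {h : Val} {s : Multiset (ℝ × Val)} {r : ℕ}, IsHeap h s r →
    Multiset.card s + l.length < 2 ^ ℓ →
    ∃ v r', Call 5 [lst (l.map entry), h] v ((200 * ℓ + 150) * (l.length + 1)) ∧
      IsHeap v (↑l + s) r' := by
  induction l with
  | nil =>
    intro h s r hh _
    exact ⟨h, r, ⟨_, rfl, Ev.of_eq (Ev.splitN (Ev.var rfl)
        (Ev.var rfl)) rfl (by simp)⟩, by simpa using hh⟩
  | cons p l ih =>
    intro h s r hh hs
    simp only [List.length_cons] at hs
    obtain ⟨g, rg, hg, hg'⟩ := ins_spec p hh (by omega) hℓ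
    obtain ⟨v, rv, hv, hv'⟩ := ih hg' (by simp only [Multiset.card_cons]; omega)
    refine ⟨v, rv, ⟨_, rfl, Ev.of_eq (Ev.splitC (Ev.var rfl) (Ev.splitC (Ev.var rfl) (Ev.letIn
        (Ev.call rfl hg) (Ev.call rfl hv)))) rfl ?_⟩, ?_⟩
    · simp only [List.length_cons, List.length_nil]
      ring_nf
      omega
    · simpa [← Multiset.cons_coe, ← Multiset.singleton_add, add_comm, add_left_comm] using hv'

/-- Maxima leave the heap first and are put in front of `acc`, so the invariant is that no key of
the heap exceeds a key of `acc`. -/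
theorem drain_spec {ℓ : ℕ} (N : ℕ) : ∀ {h : Val} {s : Multiset (ℝ × Val)} {r : ℕ}
    (acc : List (ℝ × Val)), IsHeap h s r → Multiset.card s = N → N < 2 ^ ℓ →
    acc.Pairwise (fun p q => p.1 ≤ q.1) → (∀ p ∈ s, ∀ q ∈ acc, p.1 ≤ q.1) →
    ∃ l : List (ℝ × Val), Call 6 [h, lst (acc.map entry)] (lst (l.map entry))
        ((200 * ℓ + 150) * (N + 1)) ∧
      (l : Multiset (ℝ × Val)) = s + acc ∧ l.Pairwise (fun p q => p.1 ≤ q.1) := by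
  induction N with
  | zero =>
    intro h s r acc hh hs hN hacc hle
    cases hh with
    | nil => exact ⟨acc, ⟨_, rfl, Ev.of_eq (Ev.splitN (Ev.var rfl)
        (Ev.var rfl)) rfl (by omega)⟩, by simp, hacc⟩
    | node p hl hr hle hmax => simp at hs
  | succ N ih =>
    intro h s r acc hh hs hN hacc hle
    cases hh with
    | nil => simp at hs
    | @node a b sa sb na nb p ha hb hab hmax =>
      simp only [Multiset.card_cons, Multiset.card_add] at hs
      obtain ⟨m, rm, hm, hm'⟩ := merge_log (ℓ := ℓ) ha hb (by omega) (by omega)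
      obtain ⟨l, hl, hl', hs'⟩ := ih (p :: acc) hm' (by simp only [Multiset.card_add]; omega)
        (by omega) (List.pairwise_cons.2 ⟨fun q hq => hle p (by simp) q hq, hacc⟩) (by
          intro q hq q' hq'
          rcases List.mem_cons.1 hq' with rfl | hq'
          · exact hmax q hq
          · exact hle q (Multiset.mem_cons_of_mem hq) q' hq')
      refine ⟨l, ⟨_, rfl, Ev.of_eq (Ev.splitC (Ev.var rfl) (Ev.splitC (Ev.var rfl) (Ev.splitC
          (Ev.var rfl) (Ev.letIn (Ev.call rfl
      hm) (Ev.letIn (Ev.cons (Ev.var rfl) (Ev.var rfl)) (Ev.call rfl hl)))))) rfl ?_⟩, ?_, hs'⟩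
      · simp only [List.length_cons, List.length_nil]
        ring_nf
        omega
      · rw [hl', ← Multiset.cons_coe, Multiset.add_cons, Multiset.cons_add]

theorem sort_spec {ℓ : ℕ} (hℓ : 0 < ℓ) (l : List (ℝ × Val)) (hl : l.length < 2 ^ ℓ) :
    ∃ l' : List (ℝ × Val), Call 7 [lst (l.map entry)] (lst (l'.map entry))
        ((400 * ℓ + 320) * (l.length + 1)) ∧
      l'.Perm l ∧ l'.Pairwise (fun p q => p.1 ≤ q.1) := by
  obtain ⟨h, r, hh, hh'⟩ := heapify_spec hℓ l IsHeap.nil (by simpa using hl)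
  obtain ⟨l', h1, h2, h3⟩ := drain_spec (ℓ := ℓ) l.length [] hh' (by simp) hl
    List.Pairwise.nil (by simp)
  refine ⟨l', ⟨_, rfl, Ev.of_eq (Ev.letIn Ev.nil (Ev.letIn (Ev.call rfl hh)
      (Ev.call rfl h1))) rfl ?_⟩, ?_, h3⟩
  · simp only [List.length_cons, List.length_nil]
    ring_nf
    omega
  · exact Multiset.coe_eq_coe.1 (by simpa using h2)

/-! ### The convex value function

For a sorted list of sensors and a shift that turns the gap condition `y (i+1) ≤ y i + 2 z` into
monotonicity, the least cost as a function of an upper bound `v` and a lower bound `L` is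
`K + ∑ (b - v)⁺ + ∑ (L - τ)⁺`, where `b` runs over the heap and `τ` over the removed maxima. -/

/-- `∑ (b - v)⁺` over the breakpoints `b`. -/
noncomputable def hinge (H : Multiset ℝ) (v : ℝ) : ℝ := (H.map fun b => max (b - v) 0).sum

@[simp] theorem hinge_zero (v : ℝ) : hinge 0 v = 0 := by simp [hinge]

@[simp] theorem hinge_cons (b : ℝ) (H : Multiset ℝ) (v : ℝ) :
    hinge (b ::ₘ H) v = max (b - v) 0 + hinge H v := by simp [hinge]

theorem hinge_anti (H : Multiset ℝ) {u v : ℝ} (h : u ≤ v) : hinge H v ≤ hinge H u := by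
  induction H using Multiset.induction with
  | empty => simp
  | cons b H ih =>
    have : max (b - v) 0 ≤ max (b - u) 0 := max_le_max (by linarith) le_rfl
    simp only [hinge_cons]
    linarith

theorem hinge_eq_zero {H : Multiset ℝ} {v : ℝ} (h : ∀ b ∈ H, b ≤ v) : hinge H v = 0 := by
  induction H using Multiset.induction with
  | empty => simp
  | cons b H ih =>
    rw [hinge_cons, ih fun c hc => h c (Multiset.mem_cons_of_mem hc),
      max_eq_right (by linarith [h b (by simp)]), zero_add]

/-- Convexity in the only form needed: increments over steps of length `w` increase, so that
marginal costs come out sorted. -/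
theorem hinge_convex (H : Multiset ℝ) (v : ℝ) {w : ℝ} (hw : 0 ≤ w) :
    hinge H (v + w) - hinge H v ≤ hinge H (v + w + w) - hinge H (v + w) := by
  induction H using Multiset.induction with
  | empty => simp
  | cons b H ih =>
    have : max (b - (v + w)) 0 - max (b - v) 0 ≤
        max (b - (v + w + w)) 0 - max (b - (v + w)) 0 := by
      rcases max_cases (b - (v + w)) 0 with h1 | h1 <;> rcases max_cases (b - v) 0 with h2 | h2 <;>
      rcases max_cases (b - (v + w + w)) 0 with h3 | h3 <;> linarith
    simp only [hinge_cons]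
    linarith

/-- Cost of placing the sensor `x` at `u + c`, counted from the border of `[-z, β + z]` for a
sensor from outside, which is never charged for lying outside on its own side. -/
noncomputable def shiftCost (z β c x u : ℝ) : ℝ :=
  if x < -z then max (u - (-z - c)) 0
  else if β + z < x then max (β + z - c - u) 0
  else |u - (x - c)|

/-- Total `shiftCost` of consecutive sensors, the shift growing by `2 z` per sensor. -/
noncomputable def pathCost (z β : ℝ) : ℝ → List ℝ → List ℝ → ℝ
  | c, x :: xs, u :: us => shiftCost z β c x u + pathCost z β (c + (z + z)) xs us
  | _, _, _ => 0

/-- The list descends from at most `v` to at least `L`. -/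
def Desc (L : ℝ) : ℝ → List ℝ → Prop
  | v, [] => L ≤ v
  | v, u :: us => u ≤ v ∧ Desc L u us

theorem Desc.le {L v : ℝ} {us : List ℝ} (h : Desc L v us) : L ≤ v := by
  induction us generalizing v with
  | nil => exact h
  | cons u us ih => exact (ih h.2).trans h.1

/-- The optimal path between `L` and `v`, computed from the removed maxima. -/
noncomputable def backtrack (L : ℝ) : ℝ → List ℝ → List ℝ
  | _, [] => []
  | v, t :: ts => max L (min v t) :: backtrack L (max L (min v t)) ts

@[simp] theorem length_backtrack (L v : ℝ) (ts : List ℝ) :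
    (backtrack L v ts).length = ts.length := by
  induction ts generalizing v with
  | nil => rfl
  | cons t ts ih => simp [backtrack, ih]

theorem backtrack_desc {L v : ℝ} (h : L ≤ v) (ts : List ℝ) : Desc L v (backtrack L v ts) := by
  induction ts generalizing v with
  | nil => exact h
  | cons t ts ih => exact ⟨max_le h (min_le_left _ _), ih (le_max_left _ _)⟩

/-- `H`, `ts` and `K` describe the value function of the sensors `xs` with initial shift `c`. -/
structure IsValue (z β c : ℝ) (xs : List ℝ) (H : Multiset ℝ) (ts : List ℝ) (K : ℝ) : Prop where
  length_eq : ts.length = xs.length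
  lower : ∀ (L v : ℝ) (us : List ℝ), L ≤ z → us.length = xs.length → Desc L v us →
    K + hinge H v + hinge ↑(ts.map Neg.neg) (-L) ≤ pathCost z β c xs us
  attained : ∀ L v : ℝ, L ≤ v → v ≤ z →
    pathCost z β c xs (backtrack L v ts) = K + hinge H v + hinge ↑(ts.map Neg.neg) (-L)

theorem IsValue.nil (z β c : ℝ) : IsValue z β c [] 0 [] 0 :=
  ⟨rfl, fun L v us _ _ _ => by simp [pathCost], fun L v _ _ => by simp [pathCost]⟩

/-! ### Inserting a breakpoint and removing the maximum. -/

section push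

variable {a t : ℝ} {H H' : Multiset ℝ}

/-- As `(u - a)⁺ = (u - a) + (a - u)⁺`, the left side is `u - a` plus the hinge sum of `a ::ₘ H`.
Decomposing the same multiset at `t` instead changes only the linear term. -/
theorem hinge_push (h : a ::ₘ H = t ::ₘ H') (u : ℝ) :
    max (u - a) 0 + hinge H u = t - a + max (u - t) 0 + hinge H' u := by
  have h1 := congrArg (fun M => hinge M u) h
  simp only [hinge_cons] at h1
  rcases max_cases (u - a) 0 with h2 | h2 <;> rcases max_cases (u - t) 0 with h3 | h3 <;>
  rcases max_cases (a - u) 0 with h4 | h4 <;> rcases max_cases (t - u) 0 with h5 | h5 <;>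
  linarith

/-- In the form of `hinge_push` the falling part is least at `v` and the rising part at `L`.
Estimating them separately decouples the two bounds. -/
theorem push_lower (h : a ::ₘ H = t ::ₘ H') {L u v : ℝ} (hL : L ≤ u) (hv : u ≤ v) :
    t - a + hinge H' v + max (-t - -L) 0 ≤ max (u - a) 0 + hinge H u := by
  rw [hinge_push h]
  have h1 := hinge_anti H' hv
  have h2 : max (-t - -L) 0 ≤ max (u - t) 0 := max_le_max (by linarith) le_rfl
  linarith

/-- When `t` is the maximum, the falling part vanishes to the right of `t` and the rising part to
the left. So the point of `[L, v]` nearest to `t` attains both estimates of `push_lower` at once. -/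
theorem push_attained (h : a ::ₘ H = t ::ₘ H') (ht : ∀ b ∈ H', b ≤ t) {L v : ℝ} (hL : L ≤ v) :
    max (max L (min v t) - a) 0 + hinge H (max L (min v t)) =
      t - a + hinge H' v + max (-t - -L) 0 := by
  rw [hinge_push h]
  rcases le_total t L with h1 | h1
  · rw [min_eq_right (h1.trans hL), max_eq_left h1, hinge_eq_zero fun b hb => (ht b hb).trans h1,
      hinge_eq_zero fun b hb => (ht b hb).trans (h1.trans hL), show -t - -L = L - t by ring]
    ring
  · rw [max_eq_right (le_min hL h1), max_eq_right (show -t - -L ≤ 0 by linarith)]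
    rcases le_total t v with h2 | h2
    · rw [min_eq_right h2, hinge_eq_zero ht, hinge_eq_zero fun b hb => (ht b hb).trans h2]
      simp
    · rw [min_eq_left h2, max_eq_right (by linarith : v - t ≤ 0)]
      ring

end push

/-! ### Adding one sensor in front of the others. -/

section cons

variable {z β c x : ℝ} {xs : List ℝ} {H : Multiset ℝ} {ts : List ℝ} {K : ℝ}

/-- One step of dynamic programming. The new offset `u` is the upper bound for the remaining path,
so only the hinge sum of `H` changes; the earlier terms in `L` are carried along. -/
theorem IsValue.cons_of_step {t K' : ℝ} {H' : Multiset ℝ}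
    (h : IsValue z β (c + (z + z)) xs H ts K)
    (hlow : ∀ L u v, L ≤ z → L ≤ u → u ≤ v →
      K' + hinge H' v + max (-t - -L) 0 ≤ shiftCost z β c x u + hinge H u)
    (hatt : ∀ L v, L ≤ v → v ≤ z → max L (min v t) ≤ z →
      shiftCost z β c x (max L (min v t)) + hinge H (max L (min v t)) =
        K' + hinge H' v + max (-t - -L) 0) :
    IsValue z β c (x :: xs) H' (t :: ts) (K + K') := by
  refine ⟨by simp [h.length_eq], ?_, ?_⟩
  · intro L v us hL hlen hd
    cases us with
    | nil => simp at hlen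
    | cons u us =>
      have h1 := h.lower L u us hL (by simpa using hlen) hd.2
      have h2 := hlow L u v hL hd.2.le hd.1
      simp only [pathCost, List.map_cons, ← Multiset.cons_coe, hinge_cons]
      linarith
  · intro L v hL hv
    have h0 : max L (min v t) ≤ z := (max_le hL (min_le_left _ _)).trans hv
    have h1 := h.attained L (max L (min v t)) (le_max_left _ _) h0
    have h2 := hatt L v hL hv h0
    simp only [backtrack, pathCost, List.map_cons, ← Multiset.cons_coe, hinge_cons]
    linarith

theorem IsValue.cons_left {t : ℝ} {H' : Multiset ℝ} (h : IsValue z β (c + (z + z)) xs H ts K)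
    (hx : x < -z) (hH : (-z - c) ::ₘ H = t ::ₘ H') (ht : ∀ b ∈ H', b ≤ t) :
    IsValue z β c (x :: xs) H' (t :: ts) (K + (t - (-z - c))) := by
  refine h.cons_of_step ?_ ?_
  · intro L u v _ hL hv
    simpa only [shiftCost, if_pos hx] using push_lower hH hL hv
  · intro L v hL _ _
    simpa only [shiftCost, if_pos hx] using push_attained hH ht hL

/-- An absolute value is a rising plus a falling hinge, so `x - c` enters the breakpoints twice
before one maximum is removed. -/
theorem IsValue.cons_inner {t : ℝ} {H' : Multiset ℝ} (h : IsValue z β (c + (z + z)) xs H ts K)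
    (hx : -z ≤ x) (hx' : x ≤ β + z) (hH : (x - c) ::ₘ (x - c) ::ₘ H = t ::ₘ H')
    (ht : ∀ b ∈ H', b ≤ t) :
    IsValue z β c (x :: xs) H' (t :: ts) (K + (t - (x - c))) := by
  have habs : ∀ u a : ℝ, |u - a| = max (u - a) 0 + max (a - u) 0 := by
    intro u a
    rcases max_cases (u - a) 0 with h1 | h1 <;> rcases max_cases (a - u) 0 with h2 | h2 <;>
    rcases abs_cases (u - a) with h3 | h3 <;> linarith
  refine h.cons_of_step ?_ ?_
  · intro L u v _ hL hv
    have := push_lower hH hL hv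
    rw [hinge_cons] at this
    rw [shiftCost, if_neg hx.not_gt, if_neg hx'.not_gt, habs]
    linarith
  · intro L v hL _ _
    have := push_attained hH ht hL
    rw [hinge_cons] at this
    rw [shiftCost, if_neg hx.not_gt, if_neg hx'.not_gt, habs]
    linarith

/-- This cost only falls, so nothing is removed and the best offset is the upper bound itself. The
turning point `z` stands for infinity: all admissible bounds are at most `z`, whence `min v z = v`
and `(L - z)⁺ = 0`. This is why `IsValue` restricts the bounds. -/
theorem IsValue.cons_right (h : IsValue z β (c + (z + z)) xs H ts K)
    (hx : -z ≤ x) (hx' : β + z < x) :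
    IsValue z β c (x :: xs) ((β + z - c) ::ₘ H) (z :: ts) K := by
  have h0 := h.cons_of_step (t := z) (K' := 0) (H' := (β + z - c) ::ₘ H) (x := x) ?_ ?_
  · simpa using h0
  · intro L u v hLz _ hv
    rw [shiftCost, if_neg hx.not_gt, if_pos hx', max_eq_right (by linarith : -z - -L ≤ 0),
      ← hinge_cons]
    linarith [hinge_anti ((β + z - c) ::ₘ H) hv]
  · intro L v hL hv _
    rw [shiftCost, if_neg hx.not_gt, if_pos hx', max_eq_right (by linarith : -z - -L ≤ 0),
      ← hinge_cons, min_eq_left hv, max_eq_right hL]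
    ring

end cons

/-! ### Windows of used sensors -/

/-- The charge for bringing a sensor from outside to the border of `[-z, β + z]`, when the path
is bounded by `U` and `L`. -/
noncomputable def charge (z β c x U L : ℝ) : ℝ :=
  if x < -z then (if -z - c < U then -z - x else 0)
  else if β + z < x then (if L < β + z - c then x - (β + z) else 0)
  else 0

/-- The location of the sensor `x` for the path value `u`: a sensor from outside that does not
enter `[-z, β + z]` stays where it is. -/
noncomputable def settle (z β c x u : ℝ) : ℝ :=
  if x < -z then (if -z < u + c then u + c else x)
  else if β + z < x then (if u + c < β + z then u + c else x)
  else u + c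

/-- A sensor that enters `[-z, β + z]` has its border offset strictly on the inner side of `U` or
`L`, so the charge pays its way to the border and the shift cost the rest. A sensor that stays costs
nothing. -/
theorem abs_sub_settle_le {z β c x u U L : ℝ} (hL : L ≤ u) (hU : u ≤ U) :
    |x - settle z β c x u| ≤ shiftCost z β c x u + charge z β c x U L := by
  unfold settle shiftCost charge
  split_ifs with h1 h2 h3 h3 h4 h5 h6 h6 <;> try linarith
  · rw [abs_of_nonpos (by linarith)]
    linarith [le_max_left (u - (-z - c)) 0]
  · simp; linarith [le_max_right (u - (-z - c)) 0]
  · simp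
  · rw [abs_of_nonneg (by linarith)]
    linarith [le_max_left (β + z - c - u) 0]
  · simp; linarith [le_max_right (β + z - c - u) 0]
  · simp
  · rw [abs_sub_comm, add_zero, show u + c - x = u - (x - c) by ring]

/-- The first sensor whose interval ends beyond `p` covers `p`, because its predecessor ends at or
before `p` and descending offsets leave no gap. The difficulty is that `settle` may leave a sensor
outside; this matters only for `p = β`. -/
theorem covered_of_path {n : ℕ} {z β : ℝ} (hz : 0 < z) (hβ : 2 * z < β) (hn : 0 < n)
    (x u : ℕ → ℝ) (hu0 : u 0 ≤ z) (hstep : ∀ i, i + 1 < n → u (i + 1) ≤ u i)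
    (hlast : β + z - n * (2 * z) ≤ u (n - 1)) {p : ℝ} (hp : p ∈ Set.Icc 0 β) :
    ∃ i < n, p ∈ Set.Icc (settle z β (i * (2 * z)) (x i) (u i) - z)
      (settle z β (i * (2 * z)) (x i) (u i) + z) := by
  obtain ⟨hp0, hpβ⟩ := hp
  -- a position strictly between the two borders is not changed by `settle`
  have hset : ∀ i : ℕ, -z < u i + i * (2 * z) → u i + i * (2 * z) < β + z →
      settle z β (i * (2 * z)) (x i) (u i) = u i + i * (2 * z) := by
    intro i h1 h2
    unfold settle
    rw [if_pos h1, if_pos h2]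
    simp
  have hend : ∀ i < n, u i + i * (2 * z) = β - z → p = β →
      ∃ i < n, p ∈ Set.Icc (settle z β (i * (2 * z)) (x i) (u i) - z)
        (settle z β (i * (2 * z)) (x i) (u i) + z) := by
    intro i hi h1 h2
    refine ⟨i, hi, ?_⟩
    rw [hset i (by linarith) (by linarith)]
    constructor <;> linarith
  -- The strict inequality forces the location above `-z`. A sensor placed exactly at `-z` would
  -- touch the point `0`, but `settle` may leave it outside.
  by_cases hex : ∃ i, i < n ∧ p < u i + i * (2 * z) + z
  · classical
    have hspec := Nat.find_spec hex
    set i := Nat.find hex with hi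
    have hlow : u i + i * (2 * z) - z ≤ p := by
      rcases Nat.eq_zero_or_pos i with h0 | h0
      · rw [h0]; push_cast; linarith
      · have hmin := Nat.find_min hex (m := i - 1) (by omega)
        have h1 : p ≥ u (i - 1) + (i - 1 : ℕ) * (2 * z) + z := by
          by_contra hcon
          exact hmin ⟨by omega, by linarith⟩
        have h2 := hstep (i - 1) (by omega)
        rw [Nat.sub_add_cancel h0] at h2
        rw [Nat.cast_sub h0] at h1
        push_cast at h1
        linarith
    by_cases hb : u i + i * (2 * z) < β + z
    · refine ⟨i, hspec.1, ?_⟩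
      rw [hset i (by linarith [hspec.2]) hb]
      exact ⟨hlow, hspec.2.le⟩
    -- The sensor found may be one that stays outside on the right. Then `p = β`, and its
    -- predecessor lies exactly at `β - z`.
    · push Not at hb
      have hpe : p = β := by linarith
      have h0 : 0 < i := by
        rcases Nat.eq_zero_or_pos i with h0 | h0
        · rw [h0] at hb; push_cast at hb; linarith
        · exact h0
      have hmin := Nat.find_min hex (m := i - 1) (by omega)
      have h1 : p ≥ u (i - 1) + (i - 1 : ℕ) * (2 * z) + z := by
        by_contra hcon
        exact hmin ⟨by omega, by linarith⟩
      have h2 := hstep (i - 1) (by omega)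
      rw [Nat.sub_add_cancel h0] at h2
      refine hend (i - 1) (by omega) ?_ hpe
      rw [Nat.cast_sub h0] at h1 ⊢
      push_cast at h1 ⊢
      linarith
  · push Not at hex
    have h1 := hex (n - 1) (by omega)
    have h2 : ((n - 1 : ℕ) : ℝ) = n - 1 := by rw [Nat.cast_sub hn]; simp
    refine hend (n - 1) (by omega) ?_ (by rw [h2] at h1; linarith)
    rw [h2] at h1 ⊢
    linarith

/-! ### Every covering by sorted locations pays for a window -/

section lower

variable {n : ℕ} {z β : ℝ} {x y : ℕ → ℝ}

/-- Restriction of a location to `[-z, β + z]`. -/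
noncomputable def clampLoc (z β y : ℝ) : ℝ := max (-z) (min y (β + z))

/-- Otherwise the midpoint of the two clamped locations belongs to the barrier and is farther than
`z` from both of them, hence, by sortedness, from every sensor. -/
theorem clampLoc_step (hz : 0 < z) (hβ : 2 * z < β)
    (hy : ∀ i j, i ≤ j → j < n → y i ≤ y j)
    (hcov : ∀ p ∈ Set.Icc 0 β, ∃ i < n, p ∈ Set.Icc (y i - z) (y i + z)) {i : ℕ}
    (hi : i + 1 < n) : clampLoc z β (y (i + 1)) ≤ clampLoc z β (y i) + 2 * z := by
  by_contra hcon
  push Not at hcon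
  have h1 : -z ≤ clampLoc z β (y i) := le_max_left _ _
  have h2 : clampLoc z β (y (i + 1)) ≤ β + z := max_le (by linarith) (min_le_right _ _)
  obtain ⟨l, hl, hl1, hl2⟩ := hcov ((clampLoc z β (y i) + clampLoc z β (y (i + 1))) / 2)
    ⟨by linarith, by linarith⟩
  rcases Nat.lt_or_ge i l with h | h
  · have h3 := hy (i + 1) l h hl
    have h4 : clampLoc z β (y (i + 1)) ≤ y (i + 1) := by
      refine max_le ?_ (min_le_left _ _)
      by_contra hlt
      have : clampLoc z β (y (i + 1)) ≤ -z :=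
        max_le le_rfl ((min_le_left _ _).trans (by linarith))
      linarith
    linarith
  · have h3 := hy l i h (by omega)
    have h4 : y i ≤ clampLoc z β (y i) := by
      refine le_max_of_le_right (le_min le_rfl ?_)
      by_contra hlt
      have : β + z ≤ clampLoc z β (y i) := le_max_of_le_right (le_min (by linarith) le_rfl)
      linarith
    linarith

/-- The offsets of the clamped locations form a descending path. Cutting it off at the bounds of the
window gives every unused sensor cost zero and does not alter the offsets of the sensors from `e` to
`f - 1`. -/
theorem exists_window (hz : 0 < z) (hβ : 2 * z < β) (hn : 0 < n)
    (hx : ∀ i j, i ≤ j → j < n → x i ≤ x j) (hy : ∀ i j, i ≤ j → j < n → y i ≤ y j)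
    (hcov : ∀ p ∈ Set.Icc 0 β, ∃ i < n, p ∈ Set.Icc (y i - z) (y i + z)) :
    ∃ (e f : ℕ) (u : ℕ → ℝ), e ≤ n ∧ f ≤ n ∧ (∀ i < e, x i < -z) ∧
      (∀ i, f ≤ i → i < n → β + z < x i) ∧
      β + z - f * (2 * z) ≤ z - e * (2 * z) ∧
      (∀ i < n, β + z - f * (2 * z) ≤ u i ∧ u i ≤ z - e * (2 * z)) ∧
      (∀ i, i + 1 < n → u (i + 1) ≤ u i) ∧
      ∑ i ∈ Finset.range n, (shiftCost z β (i * (2 * z)) (x i) (u i) +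
        charge z β (i * (2 * z)) (x i) (z - e * (2 * z)) (β + z - f * (2 * z))) ≤
      ∑ i ∈ Finset.range n, |x i - y i| := by
  classical
  have hy0 : y 0 ≤ z := by
    obtain ⟨i, hi, h1, _⟩ := hcov 0 ⟨le_rfl, by linarith⟩
    linarith [hy 0 i (Nat.zero_le _) hi]
  have hyl : β - z ≤ y (n - 1) := by
    obtain ⟨i, hi, _, h2⟩ := hcov β ⟨by linarith, le_rfl⟩
    linarith [hy i (n - 1) (by omega) (by omega)]
  have hstep := fun {i} => clampLoc_step (n := n) (i := i) hz hβ hy hcov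
  have hcl : ∀ {t}, t ≤ -z → clampLoc z β t = -z := fun {t} ht =>
    max_eq_left ((min_le_left _ _).trans ht)
  have hcr : ∀ {t}, β + z ≤ t → clampLoc z β t = β + z := fun {t} ht => by
    rw [clampLoc, min_eq_right ht, max_eq_right (by linarith)]
  have hcm : ∀ {t}, -z ≤ t → t ≤ β + z → clampLoc z β t = t := fun {t} h1 h2 => by
    rw [clampLoc, min_eq_left h2, max_eq_right h1]
  -- the unused sensors on the left are those before `e`
  have he : ∃ i, n ≤ i ∨ ¬(x i < -z ∧ y i ≤ -z) := ⟨n, Or.inl le_rfl⟩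
  obtain ⟨e, he1, he2⟩ : ∃ e, (n ≤ e ∨ ¬(x e < -z ∧ y e ≤ -z)) ∧
      ∀ i < e, i < n ∧ x i < -z ∧ y i ≤ -z :=
    ⟨Nat.find he, Nat.find_spec he, fun i hi => by simpa using Nat.find_min he hi⟩
  have hen : e ≤ n := by
    by_contra h
    exact absurd (he2 n (by omega)).1 (lt_irrefl n)
  have hge : ∀ i, e ≤ i → i < n → ¬(x i < -z ∧ y i ≤ -z) := fun i h1 h2 h3 =>
    (he1.resolve_left (by omega))
      ⟨(hx e i h1 h2).trans_lt h3.1, (hy e i h1 h2).trans h3.2⟩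
  -- the unused sensors on the right are those from `f` on
  have hf : ∃ i, n ≤ i ∨ (β + z < x i ∧ β + z ≤ y i) := ⟨n, Or.inl le_rfl⟩
  obtain ⟨f, hf1, hf2⟩ : ∃ f, (n ≤ f ∨ (β + z < x f ∧ β + z ≤ y f)) ∧
      ∀ i < f, i < n ∧ ¬(β + z < x i ∧ β + z ≤ y i) :=
    ⟨Nat.find hf, Nat.find_spec hf, fun i hi => by
      have := Nat.find_min hf hi
      rw [not_or, not_le] at this
      exact this⟩
  have hfn : f ≤ n := by
    by_contra h
    exact absurd (hf2 n (by omega)).1 (lt_irrefl n)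
  have hgf : ∀ i, f ≤ i → i < n → β + z < x i ∧ β + z ≤ y i := fun i h1 h2 =>
    have h3 := hf1.resolve_left (by omega)
    ⟨h3.1.trans_le (hx f i h1 h2), h3.2.trans (hy f i h1 h2)⟩
  set w : ℕ → ℝ := fun i => clampLoc z β (y i) - i * (2 * z) with hw
  have hwstep : ∀ i, i + 1 < n → w (i + 1) ≤ w i := by
    intro i hi
    have := hstep hi
    simp only [hw]
    push_cast
    linarith
  have hwanti : ∀ i j, i ≤ j → j < n → w j ≤ w i := by
    intro i j hij
    induction j, hij using Nat.le_induction with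
    | base => intro _; exact le_rfl
    | succ j hj ih => intro h; exact (hwstep j h).trans (ih (by omega))
  set U := z - e * (2 * z) with hU
  set L := β + z - f * (2 * z) with hL
  -- Sensor `e - 1` is clamped to `-z`, so sensor `e` is clamped to at most `z`. For `e = 0` this
  -- holds because `0` has to be covered.
  have hwU : ∀ i, e ≤ i → i < n → w i ≤ U := by
    intro i h1 h2
    refine (hwanti e i h1 h2).trans ?_
    simp only [hw, hU]
    rcases Nat.eq_zero_or_pos e with h0 | h0
    · have : clampLoc z β (y 0) ≤ z := max_le (by linarith) ((min_le_left _ _).trans hy0)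
      rw [h0]
      linarith
    · have h3 := hstep (i := e - 1) (by omega)
      rw [Nat.sub_add_cancel h0, hcl (he2 (e - 1) (by omega)).2.2] at h3
      linarith
  have hwL : ∀ i, i < f → L ≤ w i := by
    intro i h1
    refine le_trans ?_ (hwanti i (f - 1) (by omega) (by omega))
    have hc : ((f - 1 : ℕ) : ℝ) = f - 1 := by rw [Nat.cast_sub (by omega)]; simp
    simp only [hw, hL, hc]
    rcases Nat.lt_or_ge f n with h0 | h0
    · have h3 := hstep (i := f - 1) (by omega)
      rw [Nat.sub_add_cancel (by omega), hcr (hgf f le_rfl h0).2] at h3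
      linarith
    · have : f = n := by omega
      have h3 : β - z ≤ clampLoc z β (y (n - 1)) :=
        le_max_of_le_right (le_min hyl (by linarith))
      rw [← this] at h3
      linarith
  -- With `e = f` no sensor would be used and the barrier would be uncovered; with `f < e` sensor
  -- `f` would start on both sides of the barrier.
  have hLU : L ≤ U := by
    rcases Nat.lt_trichotomy e f with h | h | h
    · exact (hwL e h).trans (hwU e le_rfl (by omega))
    · exfalso
      rcases Nat.eq_zero_or_pos e with h0 | h0
      · have := (hgf 0 (by omega) hn).2
        linarith
      · have h1 := (he2 (e - 1) (by omega)).2.2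
        rcases Nat.lt_or_ge f n with h2 | h2
        · have h3 := hstep (i := e - 1) (by omega)
          rw [Nat.sub_add_cancel h0, hcl h1, h, hcr (hgf f le_rfl h2).2] at h3
          linarith
        · rw [show e - 1 = n - 1 by omega] at h1
          linarith
    · exfalso
      have h1 := (he2 f h).2.1
      have h2 := (hgf f le_rfl (by omega)).1
      linarith
  refine ⟨e, f, fun i => max L (min (w i) U), hen, hfn, fun i hi => (he2 i hi).2.1,
    fun i h1 h2 => (hgf i h1 h2).1, hLU,
    fun i _ => ⟨le_max_left _ _, max_le hLU (min_le_right _ _)⟩,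
    fun i hi => max_le_max le_rfl (min_le_min (hwstep i hi) le_rfl),
    Finset.sum_le_sum fun i hi => ?_⟩
  have hin := Finset.mem_range.1 hi
  change shiftCost z β (i * (2 * z)) (x i) (max L (min (w i) U)) +
    charge z β (i * (2 * z)) (x i) U L ≤ |x i - y i|
  have hcast : ∀ {a b : ℕ}, a + 1 ≤ b → (a : ℝ) * (2 * z) + 2 * z ≤ b * (2 * z) := by
    intro a b hab
    have : ((a + 1 : ℕ) : ℝ) ≤ b := by exact_mod_cast hab
    push_cast at this
    nlinarith
  have hcast' : ∀ {a b : ℕ}, a ≤ b → (a : ℝ) * (2 * z) ≤ b * (2 * z) := by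
    intro a b hab
    have : (a : ℝ) ≤ b := by exact_mod_cast hab
    nlinarith
  rcases Nat.lt_or_ge i e with h1 | h1
  · have h2 := he2 i h1
    -- For `i < e` the border offset is at least `U`, so both the hinge and the charge of this
    -- unused sensor vanish.
    have h3 : U ≤ -z - i * (2 * z) := by have := hcast h1; linarith
    have h4 : max L (min (w i) U) ≤ U := max_le hLU (min_le_right _ _)
    rw [shiftCost, if_pos h2.2.1, charge, if_pos h2.2.1, if_neg (by linarith),
      max_eq_right (by linarith)]
    simp
  · rcases Nat.lt_or_ge i f with h2 | h2
    · have h3 := hwU i h1 hin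
      have h4 := hwL i h2
      rw [min_eq_left h3, max_eq_right h4]
      have h5 := hge i h1 hin
      have h6 := (hf2 i h2).2
      have hwi : w i = clampLoc z β (y i) - i * (2 * z) := rfl
      rcases lt_or_ge (x i) (-z) with h7 | h7
      · have h8 : -z < y i := by
          by_contra h; exact h5 ⟨h7, not_lt.1 h⟩
        have h9 : clampLoc z β (y i) ≤ y i := max_le h8.le (min_le_left _ _)
        have h10 : -z ≤ clampLoc z β (y i) := le_max_left _ _
        have h11 : -z - i * (2 * z) < U := by have := hcast' h1; linarith
        rw [shiftCost, if_pos h7, charge, if_pos h7, if_pos h11, hwi,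
          max_eq_left (by linarith), abs_of_nonpos (by linarith)]
        linarith
      · rcases lt_or_ge (β + z) (x i) with h8 | h8
        · have h9 : y i < β + z := by
            by_contra h; exact h6 ⟨h8, not_lt.1 h⟩
          have h10 : y i ≤ clampLoc z β (y i) := le_max_of_le_right (le_min le_rfl h9.le)
          have h11 : clampLoc z β (y i) ≤ β + z := max_le (by linarith) (min_le_right _ _)
          have h12 : L < β + z - i * (2 * z) := by have := hcast h2; linarith
          rw [shiftCost, if_neg h7.not_gt, if_pos h8, charge, if_neg h7.not_gt, if_pos h8,
            if_pos h12, hwi, max_eq_left (by linarith), abs_of_nonneg (by linarith)]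
          linarith
        · rw [shiftCost, if_neg h7.not_gt, if_neg h8.not_gt, charge, if_neg h7.not_gt,
            if_neg h8.not_gt, hwi, add_zero]
          rw [show clampLoc z β (y i) - i * (2 * z) - (x i - i * (2 * z)) =
            clampLoc z β (y i) - x i by ring, abs_sub_comm]
          rcases le_total (y i) (-z) with h9 | h9
          · rw [hcl h9, abs_of_nonneg (by linarith), abs_of_nonneg (by linarith)]
            linarith
          · rcases le_total (y i) (β + z) with h10 | h10
            · rw [hcm h9 h10]
            · rw [hcr h10, abs_of_nonpos (by linarith), abs_of_nonpos (by linarith)]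
              linarith
    · have h3 := hgf i h2 hin
      have h4 : β + z - i * (2 * z) ≤ L := by have := hcast' h2; linarith
      have h5 : L ≤ max L (min (w i) U) := le_max_left _ _
      have h6 : ¬ x i < -z := by linarith [h3.1]
      rw [shiftCost, if_neg h6, if_pos h3.1, charge, if_neg h6, if_pos h3.1,
        if_neg (by linarith), max_eq_right (by linarith)]
      simp

end lower

/-! ### Greedy choice of the window -/

/-- After cancelling the common part of `A` and `M`, what remains of `A` is nonpositive and what
remains of `M` comes from `B`. -/
theorem sum_le_of_le_add {A B M : Multiset ℝ} (hM : M ≤ A + B) (hA : ∀ a ∈ A, a ≤ 0)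
    (hB : ∀ b ∈ B, 0 ≤ b) : A.sum ≤ M.sum := by
  classical
  have h1 : M - A ≤ B := tsub_le_iff_left.2 hM
  have h2 : ∀ P Q : Multiset ℝ, P ∩ Q + (P - Q) = P := fun P Q => by
    ext a
    simp only [Multiset.count_add, Multiset.count_inter, Multiset.count_sub]
    omega
  have h3 : (A - M).sum ≤ 0 := by
    have := Multiset.sum_le_card_nsmul (A - M) 0 fun a ha =>
      hA a (Multiset.mem_of_le tsub_le_self ha)
    simpa using this
  have h4 : 0 ≤ (M - A).sum := Multiset.sum_nonneg fun b hb => hB b (Multiset.mem_of_le h1 hb)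
  have h5 := congrArg Multiset.sum (h2 A M)
  have h6 := congrArg Multiset.sum (h2 M A)
  rw [Multiset.sum_add] at h5 h6
  rw [Multiset.inter_comm] at h5
  linarith

theorem exists_separator {l₁ l₂ : List ℝ} (h : (l₁ ++ l₂).Pairwise (· ≤ ·)) :
    ∃ m, (∀ a ∈ l₁, a ≤ m) ∧ ∀ b ∈ l₂, m ≤ b := by
  cases l₂ with
  | nil =>
    clear h
    induction l₁ with
    | nil => exact ⟨0, by simp⟩
    | cons a l ih =>
      obtain ⟨m, hm, _⟩ := ih
      refine ⟨max a m, ?_, by simp⟩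
      intro b hb
      rcases List.mem_cons.1 hb with rfl | hb
      exacts [le_max_left _ _, (hm b hb).trans (le_max_right _ _)]
  | cons b l =>
    rw [List.pairwise_append, List.pairwise_cons] at h
    refine ⟨b, fun a ha => h.2.2 a ha b (by simp), fun c hc => ?_⟩
    rcases List.mem_cons.1 hc with rfl | hc
    exacts [le_rfl, h.2.1.1 c hc]

/-- `sum_le_of_le_add` after subtracting the threshold `m` from all elements, which accounts for the
difference of the cardinalities. -/
theorem sum_add_le_sum {A B M : Multiset ℝ} {m : ℝ} (hM : M ≤ A + B) (hA : ∀ a ∈ A, a ≤ m)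
    (hB : ∀ b ∈ B, m ≤ b) :
    A.sum + m * ((Multiset.card M : ℝ) - Multiset.card A) ≤ M.sum := by
  have key := sum_le_of_le_add (A := A.map (· - m)) (B := B.map (· - m)) (M := M.map (· - m))
    (by rw [← Multiset.map_add]; exact Multiset.map_le_map hM)
    (by simpa using hA) (by simpa using hB)
  have hs : ∀ N : Multiset ℝ, (N.map (· - m)).sum = N.sum - Multiset.card N * m := by
    intro N
    induction N using Multiset.induction with
    | empty => simp
    | cons a N ih => simp only [Multiset.map_cons, Multiset.sum_cons, ih, Multiset.card_cons]
                     push_cast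
                     ring
  rw [hs, hs] at key
  linarith

theorem sum_take_le {l : List ℝ} (hl : l.Pairwise (· ≤ ·)) {M : Multiset ℝ} (hM : M ≤ ↑l)
    {j : ℕ} (hj : Multiset.card M = j) : (l.take j).sum ≤ M.sum := by
  obtain ⟨m, h1, h2⟩ := exists_separator (l₁ := l.take j) (l₂ := l.drop j) (by simpa using hl)
  have h3 := sum_add_le_sum (A := ↑(l.take j)) (B := ↑(l.drop j)) (M := M) (m := m)
    (by rw [Multiset.coe_add, List.take_append_drop]; exact hM) (by simpa using h1)
    (by simpa using h2)
  have h4 : j ≤ l.length := by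
    rw [← hj]; simpa using Multiset.card_le_card hM
  rw [hj, Multiset.coe_card, List.length_take, min_eq_left h4] at h3
  simpa using h3

/-- The marginal costs of bringing in one more sensor at a time: `ds` are the charges, `g` is the
value function. -/
def marginals (g : ℝ → ℝ) (w : ℝ) : List ℝ → ℝ → ℝ → List ℝ
  | [], _, _ => []
  | d :: ds, u, s => (d + g u - s) :: marginals g w ds (u + w) (g u)

@[simp] theorem length_marginals (g : ℝ → ℝ) (w : ℝ) (ds : List ℝ) (u s : ℝ) :
    (marginals g w ds u s).length = ds.length := by
  induction ds generalizing u s with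
  | nil => rfl
  | cons d ds ih => simp [marginals, ih]

theorem sum_take_marginals (g : ℝ → ℝ) (w : ℝ) (ds : List ℝ) (u : ℝ) {j : ℕ}
    (hj : j ≤ ds.length) :
    ((marginals g w ds (u + w) (g u)).take j).sum = (ds.take j).sum + g (u + j * w) - g u := by
  induction ds generalizing u j with
  | nil =>
    obtain rfl : j = 0 := by simpa using hj
    simp
  | cons d ds ih =>
    cases j with
    | zero => simp
    | succ j =>
      simp only [marginals, List.take_succ_cons, List.sum_cons]
      rw [ih (u + w) (by simpa using hj)]
      rw [show u + w + j * w = u + (j + 1 : ℕ) * w by push_cast; ring]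
      ring

/-- Charges increase with the distance and the increments of `g` increase by convexity. Without this
order a greedy choice could not be a prefix on each side. -/
theorem marginals_pairwise {g : ℝ → ℝ} {w : ℝ}
    (hg : ∀ u, g (u + w) - g u ≤ g (u + w + w) - g (u + w)) {ds : List ℝ}
    (hds : ds.Pairwise (· ≤ ·)) (u : ℝ) :
    (marginals g w ds (u + w) (g u)).Pairwise (· ≤ ·) := by
  rw [← List.isChain_iff_pairwise] at hds ⊢
  induction ds generalizing u with
  | nil => simp [marginals]
  | cons d ds ih =>
    cases ds with
    | nil => simp [marginals]
    | cons d' ds =>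
      rw [List.isChain_cons_cons] at hds
      have h1 := ih hds.2 (u + w)
      simp only [marginals] at h1 ⊢
      rw [List.isChain_cons_cons]
      refine ⟨?_, h1⟩
      linarith [hg u, hds.1]

/-- Take marginal costs, in increasing order, as long as the window is too small or the cost is
negative. The second component of an entry is the amount by which `u` grows. -/
noncomputable def greedy (w : ℝ) : List (ℝ × ℝ) → ℝ → ℝ → ℝ × ℝ
  | [], u, l => (u, l)
  | (d, p) :: g, u, l => if u < l ∨ d < 0 then greedy w g (u + p) (l + p - w) else (u, l)

/-- Whatever its payload, each entry lowers `l - u` by `w`, so feasibility depends only on the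
number of entries taken. The last alternative tells why the run did not stop earlier: all costs
taken are negative, or one entry fewer would not have been enough. -/
theorem greedy_prefix (w : ℝ) (g : List (ℝ × ℝ)) (u l : ℝ)
    (hg : g.Pairwise fun p q => p.1 ≤ q.1) :
    ∃ g₁ g₂, g = g₁ ++ g₂ ∧
      greedy w g u l = (u + (g₁.map Prod.snd).sum, l + (g₁.map Prod.snd).sum - g₁.length * w) ∧
      (g₂ = [] ∨ (l - u ≤ g₁.length * w ∧ ∀ q ∈ g₂, 0 ≤ q.1)) ∧
      ((∀ q ∈ g₁, q.1 < 0) ∨ g₁.length * w < l - u + w) := by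
  induction g generalizing u l with
  | nil => exact ⟨[], [], by simp [greedy]⟩
  | cons q g ih =>
    obtain ⟨d, p⟩ := q
    rw [List.pairwise_cons] at hg
    by_cases h : u < l ∨ d < 0
    · obtain ⟨g₁, g₂, h1, h2, h3, h4⟩ := ih (u + p) (l + p - w) hg.2
      refine ⟨(d, p) :: g₁, g₂, by simp [h1], ?_, ?_, ?_⟩
      · simp only [greedy, if_pos h, h2, List.map_cons, List.sum_cons, List.length_cons]
        push_cast
        exact Prod.ext (by ring) (by ring)
      · refine h3.imp id fun h3 => ⟨?_, h3.2⟩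
        simp only [List.length_cons]
        push_cast
        linarith [h3.1]
      · simp only [List.length_cons]
        push_cast
        rcases h4 with h4 | h4
        · rcases h with h | h
          · cases g₁ with
            | nil => right; simp; linarith
            | cons q g₁ =>
              left
              have h5 := h4 q (by simp)
              have h6 := hg.1 q (by simp [h1])
              intro q' hq'
              rcases List.mem_cons.1 hq' with rfl | hq'
              · exact h6.trans_lt h5
              · exact h4 q' hq'
          · left
            intro q' hq'
            rcases List.mem_cons.1 hq' with rfl | hq'
            · exact h
            · exact h4 q' hq'
        · right; linarith
    · refine ⟨[], (d, p) :: g, by simp, by simp [greedy, h], Or.inr ?_, by simp⟩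
      push Not at h
      refine ⟨by simpa using h.1, fun q hq => ?_⟩
      rcases List.mem_cons.1 hq with rfl | hq
      · exact h.2
      · exact h.2.trans (hg.1 q hq)

/-- Any competitor selects a submultiset `M` of the same entries. The greedy choice `g₁` is
separated from the rest by a threshold, and it either has only negative costs or has no more entries
than a feasible `M`. -/
theorem greedy_optimal {w u l : ℝ} (hw : 0 < w) {A B : List ℝ} (hA : A.Pairwise (· ≤ ·))
    (hB : B.Pairwise (· ≤ ·)) {g : List (ℝ × ℝ)} (hg : g.Pairwise fun p q => p.1 ≤ q.1)
    (hperm : g.Perm (A.map (fun d => (d, w)) ++ B.map (fun d => (d, 0))))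
    (hfeas : l - u ≤ (A.length + B.length) * w) :
    ∃ j r : ℕ, j ≤ A.length ∧ r ≤ B.length ∧ greedy w g u l = (u + j * w, l - r * w) ∧
      l - r * w ≤ u + j * w ∧
      ∀ j' r' : ℕ, j' ≤ A.length → r' ≤ B.length → l - r' * w ≤ u + j' * w →
        (A.take j).sum + (B.take r).sum ≤ (A.take j').sum + (B.take r').sum := by
  classical
  obtain ⟨g₁, g₂, rfl, hrun, hend, htake⟩ := greedy_prefix w g u l hg
  set gl := g₁.filter fun q => q.2 = w with hgl
  set gr := g₁.filter fun q => ¬ q.2 = w with hgr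
  have hpay : ∀ q ∈ g₁, q.2 = w ∨ q.2 = 0 := by
    intro q hq
    have := hperm.mem_iff.1 (List.mem_append_left g₂ hq)
    simp only [List.mem_append, List.mem_map] at this
    rcases this with ⟨d, _, rfl⟩ | ⟨d, _, rfl⟩ <;> simp
  have hsplit : (gl : Multiset (ℝ × ℝ)) + gr = g₁ := by
    rw [hgl, hgr, Multiset.coe_add]
    exact Multiset.coe_eq_coe.2 (by
      simpa using List.filter_append_perm (fun q : ℝ × ℝ => decide (q.2 = w)) g₁)
  have hlen : gl.length + gr.length = g₁.length := by
    have := congrArg Multiset.card hsplit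
    simpa using this
  have hsnd : (g₁.map Prod.snd).sum = gl.length * w := by
    have : ∀ g : List (ℝ × ℝ), (∀ q ∈ g, q.2 = w ∨ q.2 = 0) →
        (g.map Prod.snd).sum = (g.filter fun q => q.2 = w).length * w := by
      intro g
      induction g with
      | nil => simp
      | cons q g ih =>
        intro h
        have h1 := ih fun q hq => h q (by simp [hq])
        rcases h q (by simp) with h2 | h2
        · simp only [List.map_cons, List.sum_cons, h1, h2, List.filter_cons]
          simp
          ring
        · simp [h1, h2, hw.ne]
    exact this g₁ hpay
  have hgA : ((gl.map Prod.fst : List ℝ) : Multiset ℝ) ≤ ↑A := by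
    have h1 : (gl : Multiset (ℝ × ℝ)) ≤ ↑(A.map fun d => (d, w)) := by
      have h2 : gl.Sublist ((g₁ ++ g₂).filter fun q => q.2 = w) := by
        rw [List.filter_append]; exact List.sublist_append_left _ _
      have h3 := hperm.filter (fun q => decide (q.2 = w))
      rw [List.filter_append (l₁ := A.map _), List.filter_eq_self (l := A.map _) |>.2 (by simp),
        List.filter_eq_nil_iff (l := B.map _) |>.2 (by simp [hw.ne]), List.append_nil] at h3
      exact h2.subperm.trans h3.subperm
    have := Multiset.map_le_map (f := Prod.fst) h1
    simpa [Function.comp_def] using this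
  have hgB : ((gr.map Prod.fst : List ℝ) : Multiset ℝ) ≤ ↑B := by
    have h1 : (gr : Multiset (ℝ × ℝ)) ≤ ↑(B.map fun d => (d, (0 : ℝ))) := by
      have h2 : gr.Sublist ((g₁ ++ g₂).filter fun q => ¬ q.2 = w) := by
        rw [List.filter_append]; exact List.sublist_append_left _ _
      have h3 := hperm.filter (fun q => decide (¬ q.2 = w))
      rw [List.filter_append (l₁ := A.map _), List.filter_eq_nil_iff (l := A.map _) |>.2 (by simp),
        List.nil_append, List.filter_eq_self (l := B.map _) |>.2 (by simp [hw.ne])] at h3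
      exact h2.subperm.trans h3.subperm
    have := Multiset.map_le_map (f := Prod.fst) h1
    simpa [Function.comp_def] using this
  have hjA : gl.length ≤ A.length := by simpa using Multiset.card_le_card hgA
  have hrB : gr.length ≤ B.length := by simpa using Multiset.card_le_card hgB
  have hlen' : (g₁.length : ℝ) = gl.length + gr.length := by exact_mod_cast hlen.symm
  have hfeas' : l - u ≤ g₁.length * w := by
    rcases hend with h | h
    · have := hperm.length_eq
      simp only [h, List.append_nil, List.length_append, List.length_map] at this
      rw [this]
      exact_mod_cast hfeas
    · exact h.1
  refine ⟨gl.length, gr.length, hjA, hrB, ?_, ?_, ?_⟩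
  · rw [hrun, hsnd, hlen']
    exact Prod.ext rfl (by ring)
  · rw [hlen'] at hfeas'; linarith
  · intro j' r' hj' hr' hf
    -- Among equal costs the sorted order may pick entries of `A` that are not its first ones, so
    -- only an inequality with the prefix sum is available; it has the right direction.
    have h1 := sum_take_le hA hgA (j := gl.length) (by simp)
    have h2 := sum_take_le hB hgB (j := gr.length) (by simp)
    have hsum : ((gl.map Prod.fst : List ℝ) : Multiset ℝ).sum +
        ((gr.map Prod.fst : List ℝ) : Multiset ℝ).sum = (g₁.map Prod.fst).sum := by
      rw [← Multiset.sum_add, ← Multiset.map_coe, ← Multiset.map_coe, ← Multiset.map_add, hsplit,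
        Multiset.map_coe, Multiset.sum_coe]
    set M : Multiset ℝ := ↑(A.take j') + ↑(B.take r') with hM
    have hMle : M ≤ ↑(g₁.map Prod.fst) + ↑(g₂.map Prod.fst) := by
      have h3 := hperm.map Prod.fst
      simp only [List.map_append, List.map_map, Function.comp_def, List.map_id'] at h3
      rw [Multiset.coe_add, Multiset.coe_eq_coe.2 h3, ← Multiset.coe_add]
      exact add_le_add (List.take_sublist _ _).subperm (List.take_sublist _ _).subperm
    have hMcard : (Multiset.card M : ℝ) = j' + r' := by
      rw [hM, Multiset.card_add, Multiset.coe_card, Multiset.coe_card, List.length_take,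
        List.length_take, min_eq_left hj', min_eq_left hr']
      push_cast; rfl
    have hMsum : M.sum = (A.take j').sum + (B.take r').sum := by simp [hM]
    rw [← hMsum]
    refine (add_le_add h1 h2).trans ?_
    rw [hsum]
    have hpos : ∀ q ∈ g₂, 0 ≤ q.1 := by
      rcases hend with h | h
      · simp [h]
      · exact h.2
    rcases htake with h | h
    · have := sum_add_le_sum (m := 0) hMle (by simpa using fun a b hab => (h _ hab).le)
        (by simpa using fun a b hab => hpos _ hab)
      simpa using this
    · have hcard : (g₁.length : ℝ) ≤ Multiset.card M := by
        have h4 : (g₁.length : ℝ) * w < (Multiset.card M + 1 : ℝ) * w := by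
          rw [hMcard]; linarith
        have h5 := lt_of_mul_lt_mul_right h4 hw.le
        have h6 : g₁.length < Multiset.card M + 1 := by exact_mod_cast h5
        exact_mod_cast Nat.lt_succ_iff.1 h6
      -- The threshold is raised to `max m 0`, still below all of `g₂`, so that additional elements
      -- of `M` cannot lower the sum.
      obtain ⟨m, hm1, hm2⟩ := exists_separator (l₁ := g₁.map Prod.fst) (l₂ := g₂.map Prod.fst)
        (by rw [← List.map_append]; exact List.pairwise_map.2 hg)
      have h5 := sum_add_le_sum (m := max m 0) hMle
        (fun a ha => (hm1 a ha).trans (le_max_left _ _))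
        (fun b hb => max_le (hm2 b hb) (by
          simp only [Multiset.mem_coe, List.mem_map] at hb
          obtain ⟨q, hq, rfl⟩ := hb
          exact hpos q hq))
      simp only [Multiset.coe_card, List.length_map, Multiset.sum_coe] at h5
      have h6 : 0 ≤ max m 0 * ((Multiset.card M : ℝ) - g₁.length) :=
        mul_nonneg (le_max_right _ _) (by linarith)
      linarith

/-! ### Sorted locations suffice -/

/-- Sum of the moving distances between the entries of two lists. -/
noncomputable def moveSum (xs ys : List ℝ) : ℝ := (List.zipWith (fun x y => |x - y|) xs ys).sum

theorem moveSum_cons (x y : ℝ) (xs ys : List ℝ) :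
    moveSum (x :: xs) (y :: ys) = |x - y| + moveSum xs ys := by simp [moveSum]

theorem moveSum_eq_sum {xs ys : List ℝ} (h : ys.length = xs.length) :
    moveSum xs ys = ∑ i ∈ Finset.range xs.length, |xs.getD i 0 - ys.getD i 0| := by
  induction xs generalizing ys with
  | nil => simp [moveSum]
  | cons x xs ih =>
    cases ys with
    | nil => simp at h
    | cons y ys =>
      rw [moveSum_cons, List.length_cons, Finset.sum_range_succ', ih (by simpa using h), add_comm]
      simp

theorem abs_sub_swap_le {a b c d : ℝ} (hab : a ≤ b) (hcd : c ≤ d) :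
    |a - c| + |b - d| ≤ |a - d| + |b - c| := by
  rcases abs_cases (a - c) with h1 | h1 <;> rcases abs_cases (b - d) with h2 | h2 <;>
  rcases abs_cases (a - d) with h3 | h3 <;> rcases abs_cases (b - c) with h4 | h4 <;> linarith

/-- While `y` moves past a smaller target `b`, the two targets are uncrossed by `abs_sub_swap_le`;
iterated, this gives the bound for insertion sort. -/
theorem moveSum_orderedInsert_le {x y : ℝ} {xs zs : List ℝ}
    (hx : (x :: xs).Pairwise (· ≤ ·)) (hlen : zs.length = xs.length) :
    moveSum (x :: xs) (zs.orderedInsert (· ≤ ·) y) ≤ |x - y| + moveSum xs zs := by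
  induction zs generalizing x xs with
  | nil => simp [moveSum_cons, List.eq_nil_of_length_eq_zero (l := xs) (by simpa using hlen.symm)]
  | cons b zs ih =>
    cases xs with
    | nil => simp at hlen
    | cons x' xs =>
      rw [List.orderedInsert_cons]
      split_ifs with h
      · rw [moveSum_cons]
      · have h1 := ih (List.pairwise_cons.1 hx).2 (by simpa using hlen)
        have h2 := abs_sub_swap_le ((List.pairwise_cons.1 hx).1 x' (by simp)) (not_le.1 h).le
        rw [moveSum_cons, moveSum_cons]
        linarith

theorem moveSum_insertionSort_le {xs ys : List ℝ} (hx : xs.Pairwise (· ≤ ·))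
    (hlen : ys.length = xs.length) :
    moveSum xs (ys.insertionSort (· ≤ ·)) ≤ moveSum xs ys := by
  induction ys generalizing xs with
  | nil => simp
  | cons y ys ih =>
    cases xs with
    | nil => simp at hlen
    | cons x xs =>
      rw [List.insertionSort_cons, moveSum_cons]
      refine (moveSum_orderedInsert_le hx (by simpa using hlen)).trans ?_
      linarith [ih (List.pairwise_cons.1 hx).2 (by simpa using hlen)]

/-! ### Paths as lists -/

theorem pathCost_eq_sum {z β c : ℝ} {xs us : List ℝ} (h : us.length = xs.length) :
    pathCost z β c xs us = ∑ i ∈ Finset.range xs.length,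
      shiftCost z β (c + i * (2 * z)) (xs.getD i 0) (us.getD i 0) := by
  induction xs generalizing us c with
  | nil => simp [pathCost]
  | cons x xs ih =>
    cases us with
    | nil => simp at h
    | cons u us =>
      rw [pathCost, List.length_cons, Finset.sum_range_succ', ih (by simpa using h), add_comm]
      simp only [List.getD_cons_succ, List.getD_cons_zero, Nat.cast_zero, zero_mul, add_zero]
      congr 1
      refine Finset.sum_congr rfl fun i _ => ?_
      congr 1
      push_cast
      ring

theorem Desc.bounds {L v : ℝ} {us : List ℝ} (h : Desc L v us) :
    ∀ i < us.length, L ≤ us.getD i 0 ∧ us.getD i 0 ≤ v := by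
  induction us generalizing v with
  | nil => simp
  | cons u us ih =>
    intro i hi
    cases i with
    | zero => exact ⟨by simpa using h.2.le, by simpa using h.1⟩
    | succ i =>
      have := ih h.2 i (by simpa using hi)
      exact ⟨by simpa using this.1, by simpa using this.2.trans h.1⟩

theorem Desc.step {L v : ℝ} {us : List ℝ} (h : Desc L v us) :
    ∀ i, i + 1 < us.length → us.getD (i + 1) 0 ≤ us.getD i 0 := by
  induction us generalizing v with
  | nil => simp
  | cons u us ih =>
    intro i hi
    cases i with
    | zero => simpa using (h.2.bounds 0 (by simpa using hi)).2
    | succ i => simpa using ih h.2 i (by simpa using hi)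

theorem desc_map_range {L v : ℝ} {n : ℕ} {u : ℕ → ℝ} (hL : ∀ i < n, L ≤ u i)
    (hv : ∀ i < n, u i ≤ v) (hLv : L ≤ v) (hu : ∀ i, i + 1 < n → u (i + 1) ≤ u i) :
    Desc L v ((List.range n).map u) := by
  induction n generalizing u v with
  | zero => simpa [Desc] using hLv
  | succ n ih =>
    rw [List.range_succ_eq_map, List.map_cons, List.map_map]
    refine ⟨hv 0 (by omega), ih (fun i hi => hL (i + 1) (by omega)) (fun i hi => ?_)
      (hL 0 (by omega)) fun i hi => hu (i + 1) (by omega)⟩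
    induction i with
    | zero => exact hu 0 (by omega)
    | succ i ih => exact (hu (i + 1) (by omega)).trans (ih (by omega))

/-- The locations for the path `us`. -/
noncomputable def settleAll (z β : ℝ) : ℝ → List ℝ → List ℝ → List ℝ
  | c, x :: xs, u :: us => settle z β c x u :: settleAll z β (c + (z + z)) xs us
  | _, _, _ => []

theorem length_settleAll {z β c : ℝ} {xs us : List ℝ} (h : us.length = xs.length) :
    (settleAll z β c xs us).length = xs.length := by
  induction xs generalizing us c with
  | nil => simp [settleAll]
  | cons x xs ih =>
    cases us with
    | nil => simp at h
    | cons u us => simp [settleAll, ih (c := c + (z + z)) (us := us) (by simpa using h)]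

theorem settleAll_getD {z β c : ℝ} {xs us : List ℝ} (h : us.length = xs.length) :
    ∀ i < xs.length, (settleAll z β c xs us).getD i 0 =
      settle z β (c + i * (2 * z)) (xs.getD i 0) (us.getD i 0) := by
  induction xs generalizing us c with
  | nil => simp
  | cons x xs ih =>
    cases us with
    | nil => simp at h
    | cons u us =>
      intro i hi
      cases i with
      | zero => simp [settleAll]
      | succ i =>
        simp only [settleAll, List.getD_cons_succ]
        rw [ih (by simpa using h) i (by simpa using hi)]
        congr 1
        push_cast
        ring

/-! ### Sums of charges -/

/-- Sum of the charges of consecutive sensors. -/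
noncomputable def chargeSum (z β U L : ℝ) : ℝ → List ℝ → ℝ
  | _, [] => 0
  | c, x :: xs => charge z β c x U L + chargeSum z β U L (c + 2 * z) xs

theorem chargeSum_eq_sum {z β U L c : ℝ} {xs : List ℝ} :
    chargeSum z β U L c xs = ∑ i ∈ Finset.range xs.length,
      charge z β (c + i * (2 * z)) (xs.getD i 0) U L := by
  induction xs generalizing c with
  | nil => simp [chargeSum]
  | cons x xs ih =>
    rw [chargeSum, List.length_cons, Finset.sum_range_succ', ih, add_comm]
    simp only [List.getD_cons_succ, List.getD_cons_zero, Nat.cast_zero, zero_mul, add_zero]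
    congr 1
    refine Finset.sum_congr rfl fun i _ => ?_
    congr 1
    push_cast
    ring

theorem chargeSum_append {z β U L c : ℝ} {l₁ l₂ : List ℝ} :
    chargeSum z β U L c (l₁ ++ l₂) =
      chargeSum z β U L c l₁ + chargeSum z β U L (c + l₁.length * (2 * z)) l₂ := by
  induction l₁ generalizing c with
  | nil => simp [chargeSum]
  | cons x l ih =>
    simp only [List.cons_append, chargeSum, ih, List.length_cons]
    push_cast
    rw [show c + 2 * z + l.length * (2 * z) = c + (l.length + 1) * (2 * z) by ring]
    ring

theorem chargeSum_inner {z β U L c : ℝ} {l : List ℝ} (h : ∀ x ∈ l, -z ≤ x ∧ x ≤ β + z) :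
    chargeSum z β U L c l = 0 := by
  induction l generalizing c with
  | nil => rfl
  | cons x l ih =>
    have hx := h x (by simp)
    rw [chargeSum, ih fun y hy => h y (by simp [hy]), charge, if_neg hx.1.not_gt,
      if_neg hx.2.not_gt, add_zero]

theorem chargeSum_left_all {z β U L c : ℝ} (hz : 0 < z) {l : List ℝ} (h : ∀ x ∈ l, x < -z)
    (hU : -z - c < U) : chargeSum z β U L c l = (l.map fun x => -z - x).sum := by
  induction l generalizing c with
  | nil => rfl
  | cons x l ih =>
    rw [chargeSum, ih (fun y hy => h y (by simp [hy])) (by linarith), charge,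
      if_pos (h x (by simp)), if_pos hU]
    simp

/-- The border offset of the `i`-th sensor is `-z - c - 2 z i`, which is below `z - c - 2 z e`
precisely when `e ≤ i`. -/
theorem chargeSum_left {z β L c : ℝ} (hz : 0 < z) {l : List ℝ} (h : ∀ x ∈ l, x < -z) (e : ℕ) :
    chargeSum z β (z - c - e * (2 * z)) L c l = ((l.drop e).map fun x => -z - x).sum := by
  induction l generalizing c e with
  | nil => simp [chargeSum]
  | cons x l ih =>
    cases e with
    | zero => rw [chargeSum_left_all hz h (by push_cast; linarith)]; simp
    | succ e =>
      have h1 := ih (c := c + 2 * z) (fun y hy => h y (by simp [hy])) e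
      rw [show z - (c + 2 * z) - e * (2 * z) = z - c - (e + 1 : ℕ) * (2 * z) by
        push_cast; ring] at h1
      have h2 : (0 : ℝ) ≤ e * (2 * z) := by positivity
      rw [chargeSum, h1, charge, if_pos (h x (by simp)), if_neg (by push_cast; linarith)]
      simp

theorem chargeSum_right_none {z β U L c : ℝ} (hz : 0 < z) (hβ : 0 < β) {l : List ℝ}
    (h : ∀ x ∈ l, β + z < x) (hL : β + z - c ≤ L) : chargeSum z β U L c l = 0 := by
  induction l generalizing c with
  | nil => rfl
  | cons x l ih =>
    have hx := h x (by simp)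
    rw [chargeSum, ih (fun y hy => h y (by simp [hy])) (by linarith), charge,
      if_neg (by linarith), if_pos hx, if_neg (by linarith), add_zero]

/-- Here the border offset `β + z - c - 2 z i` exceeds the lower bound precisely when `i < r`. -/
theorem chargeSum_right {z β U c : ℝ} (hz : 0 < z) (hβ : 0 < β) {l : List ℝ}
    (h : ∀ x ∈ l, β + z < x) (r : ℕ) :
    chargeSum z β U (β + z - c - r * (2 * z)) c l =
      ((l.take r).map fun x => x - (β + z)).sum := by
  induction l generalizing c r with
  | nil => simp [chargeSum]
  | cons x l ih =>
    cases r with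
    | zero => rw [chargeSum_right_none hz hβ h (by simp)]; simp
    | succ r =>
      have h1 := ih (c := c + 2 * z) (fun y hy => h y (by simp [hy])) r
      rw [show β + z - (c + 2 * z) - r * (2 * z) = β + z - c - (r + 1 : ℕ) * (2 * z) by
        push_cast; ring] at h1
      have hx := h x (by simp)
      have h2 : (0 : ℝ) ≤ r * (2 * z) := by positivity
      rw [chargeSum, h1, charge, if_neg (by linarith), if_pos hx,
        if_pos (by push_cast; linarith)]
      simp

/-! ### The sensors outside on one side -/

/-- The distances `b - x` of the sensors `x < b` at the front of a list, nearest first, and the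
shift after passing them. -/
noncomputable def far (b w : ℝ) : List ℝ → ℝ → List ℝ → ℝ × List ℝ
  | [], c, acc => (c, acc)
  | x :: xs, c, acc => if x < b then far b w xs (c - w) ((b - x) :: acc) else (c, acc)

theorem far_append {b w : ℝ} {l₁ l₂ : List ℝ} (h₁ : ∀ x ∈ l₁, x < b) (h₂ : ∀ x ∈ l₂, b ≤ x)
    (c : ℝ) (acc : List ℝ) :
    far b w (l₁ ++ l₂) c acc =
      (c - l₁.length * w, (l₁.map fun x => b - x).reverse ++ acc) := by
  induction l₁ generalizing c acc with
  | nil =>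
    cases l₂ with
    | nil => simp [far]
    | cons x l => simp [far, (h₂ x (by simp)).not_gt]
  | cons x l ih =>
    rw [List.cons_append, far, if_pos (h₁ x (by simp)), ih fun y hy => h₁ y (by simp [hy])]
    refine Prod.ext ?_ ?_
    · simp only [List.length_cons]; push_cast; ring
    · simp

theorem exists_append_of_pairwise {P : ℝ → Prop} (hP : ∀ a b, a ≤ b → P b → P a) {xs : List ℝ}
    (hx : xs.Pairwise (· ≤ ·)) :
    ∃ l₁ l₂, xs = l₁ ++ l₂ ∧ (∀ x ∈ l₁, P x) ∧ ∀ x ∈ l₂, ¬ P x := by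
  induction xs with
  | nil => exact ⟨[], [], by simp⟩
  | cons x xs ih =>
    rw [List.pairwise_cons] at hx
    by_cases h : P x
    · obtain ⟨l₁, l₂, rfl, h1, h2⟩ := ih hx.2
      exact ⟨x :: l₁, l₂, by simp, by simpa using ⟨h, h1⟩, h2⟩
    · refine ⟨[], x :: xs, by simp, by simp, ?_⟩
      intro y hy
      rcases List.mem_cons.1 hy with rfl | hy
      · exact h
      · exact fun hy' => h (hP x y (hx.1 y hy) hy')

/-! ### Optimality of the placement -/

/-- Every point of `[0, β]` is covered by a sensor of the list. -/
def CoversList (z β : ℝ) (ys : List ℝ) : Prop :=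
  ∀ p ∈ Set.Icc 0 β, ∃ y ∈ ys, p ∈ Set.Icc (y - z) (y + z)

theorem CoversList.exists_index {z β : ℝ} {ys : List ℝ} (h : CoversList z β ys) :
    ∀ p ∈ Set.Icc 0 β, ∃ i < ys.length, p ∈ Set.Icc (ys.getD i 0 - z) (ys.getD i 0 + z) := by
  intro p hp
  obtain ⟨y, hy, hpy⟩ := h p hp
  obtain ⟨i, hi, rfl⟩ := List.getElem_of_mem hy
  exact ⟨i, hi, by rwa [List.getD_eq_getElem _ _ hi]⟩

theorem getD_mono {l : List ℝ} (h : l.Pairwise (· ≤ ·)) :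
    ∀ i j, i ≤ j → j < l.length → l.getD i 0 ≤ l.getD j 0 := by
  intro i j hij hj
  rw [List.getD_eq_getElem _ _ hj, List.getD_eq_getElem _ _ (hij.trans_lt hj)]
  rcases hij.eq_or_lt with rfl | hlt
  · exact le_rfl
  · exact List.pairwise_iff_getElem.1 h i j _ _ hlt

section plan

variable {z β : ℝ} {xs : List ℝ} {H : Multiset ℝ} {ts : List ℝ} {K : ℝ}

/-- Least cost for a path between `L` and `U`, with the charges. -/
noncomputable def objective (z β : ℝ) (xs : List ℝ) (H : Multiset ℝ) (ts : List ℝ)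
    (K U L : ℝ) : ℝ :=
  K + hinge H U + hinge ↑(ts.map Neg.neg) (-L) + chargeSum z β U L 0 xs

theorem settle_le_objective (hval : IsValue z β 0 xs H ts K) {U L : ℝ} (hLU : L ≤ U)
    (hU : U ≤ z) :
    moveSum xs (settleAll z β 0 xs (backtrack L U ts)) ≤ objective z β xs H ts K U L := by
  have hlen : (backtrack L U ts).length = xs.length := by simp [hval.length_eq]
  rw [objective, ← hval.attained L U hLU hU, moveSum_eq_sum (length_settleAll hlen),
    pathCost_eq_sum hlen, chargeSum_eq_sum, ← Finset.sum_add_distrib]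
  refine Finset.sum_le_sum fun i hi => ?_
  have hi' := Finset.mem_range.1 hi
  rw [settleAll_getD hlen i hi']
  have hb := (backtrack_desc hLU ts).bounds i (by omega)
  exact abs_sub_settle_le hb.1 hb.2

theorem coversList_settleAll (hz : 0 < z) (hβ : 2 * z < β) (hn : 0 < xs.length)
    (hval : IsValue z β 0 xs H ts K) {U L : ℝ} (hLU : L ≤ U) (hU : U ≤ z)
    (hL : β + z - xs.length * (2 * z) ≤ L) :
    CoversList z β (settleAll z β 0 xs (backtrack L U ts)) := by
  intro p hp
  have hlen : (backtrack L U ts).length = xs.length := by simp [hval.length_eq]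
  have hd := backtrack_desc hLU ts
  obtain ⟨i, hi, h⟩ := covered_of_path hz hβ hn (fun i => xs.getD i 0)
    (fun i => (backtrack L U ts).getD i 0) ((hd.bounds 0 (by omega)).2.trans hU)
    (fun i hi => hd.step i (by omega)) (hL.trans (hd.bounds _ (by omega)).1) hp
  have hi' : i < (settleAll z β 0 xs (backtrack L U ts)).length := by
    rwa [length_settleAll hlen]
  have h1 := settleAll_getD (z := z) (β := β) (c := 0) hlen i hi
  rw [zero_add] at h1
  rw [← h1] at h
  exact ⟨_, by rw [List.getD_eq_getElem _ _ hi']; exact List.getElem_mem hi', h⟩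

/-- Sorting the locations does not increase the cost, the sorted covering pays for a window, and the
value function bounds the path in this window from below. -/
theorem exists_objective_le (hz : 0 < z) (hβ : 2 * z < β) (hn : 0 < xs.length)
    (hx : xs.Pairwise (· ≤ ·)) (hval : IsValue z β 0 xs H ts K) {ys : List ℝ}
    (hlen : ys.length = xs.length) (hcov : CoversList z β ys) :
    ∃ e f : ℕ, e ≤ xs.length ∧ f ≤ xs.length ∧ (∀ i < e, xs.getD i 0 < -z) ∧
      (∀ i, f ≤ i → i < xs.length → β + z < xs.getD i 0) ∧
      β + z - f * (2 * z) ≤ z - e * (2 * z) ∧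
      objective z β xs H ts K (z - e * (2 * z)) (β + z - f * (2 * z)) ≤ moveSum xs ys := by
  set zs := ys.insertionSort (· ≤ ·) with hzs
  have hzlen : zs.length = xs.length := by rw [hzs, List.length_insertionSort, hlen]
  have hzcov : CoversList z β zs := fun p hp => by
    obtain ⟨y, hy, h⟩ := hcov p hp
    exact ⟨y, (List.perm_insertionSort _ ys).mem_iff.2 hy, h⟩
  have hzsort : zs.Pairwise (· ≤ ·) := List.pairwise_insertionSort _ ys
  obtain ⟨e, f, u, he, hf, h1, h2, h3, h4, h5, h6⟩ := exists_window hz hβ hn (getD_mono hx)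
    (fun i j hij hj => getD_mono hzsort i j hij (by omega))
    (fun p hp => by simpa [hzlen] using hzcov.exists_index p hp)
  refine ⟨e, f, he, hf, h1, h2, h3, ?_⟩
  refine le_trans ?_ (moveSum_insertionSort_le hx hlen)
  rw [moveSum_eq_sum hzlen]
  refine le_trans ?_ h6
  have h0 : (0 : ℝ) ≤ e * (2 * z) := by positivity
  have h7 := hval.lower (β + z - f * (2 * z)) (z - e * (2 * z)) ((List.range xs.length).map u)
    (by linarith) (by simp)
    (desc_map_range (fun i hi => (h4 i hi).1) (fun i hi => (h4 i hi).2) h3 h5)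
  rw [pathCost_eq_sum (by simp)] at h7
  rw [objective, chargeSum_eq_sum, Finset.sum_add_distrib]
  simp only [zero_add] at h7 ⊢
  have h8 : ∑ i ∈ Finset.range xs.length, shiftCost z β (i * (2 * z)) (xs.getD i 0)
      (((List.range xs.length).map u).getD i 0) =
      ∑ i ∈ Finset.range xs.length, shiftCost z β (i * (2 * z)) (xs.getD i 0) (u i) := by
    refine Finset.sum_congr rfl fun i hi => ?_
    have := Finset.mem_range.1 hi
    rw [List.getD_eq_getElem (List.map u _) _ (by simpa using this), List.getElem_map,
      List.getElem_range]
  rw [h8] at h7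
  linarith

/-- `U₀` and `-V₀` are the bounds with no outside sensor in use. Bringing in `j` from the left and
`r` from the right changes the objective by two prefix sums of marginal costs, so the greedy choice
minimises it over all windows. -/
theorem plan_optimal (hz : 0 < z) (hβ : 2 * z < β) (hfeas : β ≤ 2 * z * xs.length)
    (hx : xs.Pairwise (· ≤ ·)) (hval : IsValue z β 0 xs H ts K) {U₀ V₀ : ℝ} {dl dr : List ℝ}
    (hl : far (-z) (2 * z) xs z [] = (U₀, dl))
    (hr : far (-z - β) (2 * z) (xs.map Neg.neg).reverse (xs.length * (2 * z) - β - z) [] =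
      (V₀, dr))
    {g : List (ℝ × ℝ)} (hg : g.Pairwise fun p q => p.1 ≤ q.1)
    (hperm : g.Perm
      ((marginals (hinge H) (2 * z) dl (U₀ + 2 * z) (hinge H U₀)).map (fun d => (d, 2 * z)) ++
        (marginals (hinge ↑(ts.map Neg.neg)) (2 * z) dr (V₀ + 2 * z)
          (hinge ↑(ts.map Neg.neg) V₀)).map (fun d => (d, 0))))
    {U L : ℝ} (hgr : greedy (2 * z) g U₀ (-V₀) = (U, L)) :
    CoversList z β (settleAll z β 0 xs (backtrack L U ts)) ∧
      ∀ ys : List ℝ, ys.length = xs.length → CoversList z β ys →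
        moveSum xs (settleAll z β 0 xs (backtrack L U ts)) ≤ moveSum xs ys := by
  have hn : 0 < xs.length := by
    rcases Nat.eq_zero_or_pos xs.length with h | h
    · rw [h] at hfeas; push_cast at hfeas; linarith
    · exact h
  obtain ⟨l₁, rs, rfl, h1, hrs⟩ := exists_append_of_pairwise (P := (· ≤ β + z))
    (fun a b h1 h2 => h1.trans h2) hx
  obtain ⟨ls, ms, rfl, hls, hms⟩ := exists_append_of_pairwise (P := (· < -z))
    (fun a b h1 h2 => h1.trans_lt h2) (List.pairwise_append.1 hx).1
  simp only [not_le, not_lt] at hrs hms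
  have hrs' : ∀ x ∈ rs, -z ≤ x := fun x hx => by linarith [hrs x hx]
  rw [List.append_assoc, far_append hls (by
    intro x hx
    rcases List.mem_append.1 hx with h | h
    exacts [hms x h, hrs' x h])] at hl
  rw [List.map_append, List.reverse_append, far_append (by
    intro x hx
    simp only [List.mem_reverse, List.mem_map] at hx
    obtain ⟨y, hy, rfl⟩ := hx
    linarith [hrs y hy]) (by
    intro x hx
    simp only [List.mem_reverse, List.mem_map] at hx
    obtain ⟨y, hy, rfl⟩ := hx
    linarith [h1 y hy])] at hr
  obtain ⟨hU₀, hdl⟩ := Prod.ext_iff.1 hl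
  obtain ⟨hV₀, hdr⟩ := Prod.ext_iff.1 hr
  simp only [List.append_nil, List.map_reverse, List.reverse_reverse, List.map_map,
    List.length_reverse, List.length_map, Function.comp_def] at hU₀ hdl hV₀ hdr
  set k := ls.length with hk
  set m := ms.length with hm
  have hnlen : (((ls ++ ms) ++ rs).length : ℝ) = k + m + rs.length := by
    simp only [List.length_append, ← hk, ← hm]
    push_cast
    ring
  have hdll : dl.length = k := by rw [← hdl]; simp [hk]
  have hdrl : dr.length = rs.length := by rw [← hdr]; simp
  have hxl := (List.pairwise_append.1 (List.pairwise_append.1 hx).1).1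
  have hxr := (List.pairwise_append.1 hx).2.1
  have hdls : dl.Pairwise (· ≤ ·) := by
    rw [← hdl, List.pairwise_reverse, List.pairwise_map]
    exact hxl.imp fun h => by linarith
  have hdrs : dr.Pairwise (· ≤ ·) := by
    rw [← hdr, List.pairwise_map]
    exact hxr.imp fun h => by linarith
  have hw : (0 : ℝ) < 2 * z := by linarith
  have hobj : ∀ j r : ℕ, j ≤ dl.length → r ≤ dr.length →
      objective z β ((ls ++ ms) ++ rs) H ts K (U₀ + j * (2 * z)) (-V₀ - r * (2 * z)) =
        K + hinge H U₀ + hinge ↑(ts.map Neg.neg) V₀ +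
        ((marginals (hinge H) (2 * z) dl (U₀ + 2 * z) (hinge H U₀)).take j).sum +
        ((marginals (hinge ↑(ts.map Neg.neg)) (2 * z) dr (V₀ + 2 * z)
          (hinge ↑(ts.map Neg.neg) V₀)).take r).sum := by
    intro j r hj hr
    have hkj : ((k - j : ℕ) : ℝ) = k - j := by rw [Nat.cast_sub (by omega)]
    have hc1 : chargeSum z β (U₀ + j * (2 * z)) (-V₀ - r * (2 * z)) 0 ls = (dl.take j).sum := by
      have := chargeSum_left (β := β) (L := -V₀ - r * (2 * z)) (c := 0) hz hls (k - j)
      rw [show z - 0 - ((k - j : ℕ) : ℝ) * (2 * z) = U₀ + j * (2 * z) by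
        rw [hkj, ← hU₀]; ring] at this
      rw [this, ← hdl, List.take_reverse, List.sum_reverse, List.length_map, ← List.map_drop]
    have hc2 : chargeSum z β (U₀ + j * (2 * z)) (-V₀ - r * (2 * z))
        (0 + ((ls ++ ms).length : ℝ) * (2 * z)) rs = (dr.take r).sum := by
      have := chargeSum_right (U := U₀ + j * (2 * z))
        (c := 0 + ((ls ++ ms).length : ℝ) * (2 * z)) hz (by linarith) hrs r
      rw [show β + z - (0 + ((ls ++ ms).length : ℝ) * (2 * z)) - r * (2 * z) =
        -V₀ - r * (2 * z) by
          rw [← hV₀, hnlen]; simp only [List.length_append, ← hk, ← hm]; push_cast; ring] at this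
      rw [this, ← hdr, List.map_take]
      refine congrArg (fun l => (List.take r l).sum) (List.map_congr_left fun x _ => ?_)
      ring
    rw [sum_take_marginals _ _ _ _ hj, sum_take_marginals _ _ _ _ hr, objective,
      chargeSum_append, chargeSum_append, hc1, hc2,
      chargeSum_inner fun x hx => ⟨hms x hx, h1 x (List.mem_append_right _ hx)⟩,
      show -(-V₀ - r * (2 * z)) = V₀ + r * (2 * z) by ring]
    ring
  obtain ⟨j, r, hj, hr', hrun, hLU, hopt⟩ := greedy_optimal (u := U₀) (l := -V₀) hw
    (marginals_pairwise (fun u => hinge_convex H u hw.le) hdls U₀)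
    (marginals_pairwise (fun u => hinge_convex _ u hw.le) hdrs V₀) hg hperm (by
      rw [length_marginals, length_marginals, hdll, hdrl, ← hU₀, ← hV₀]
      nlinarith [hfeas, hnlen])
  rw [length_marginals] at hj hr'
  rw [hgr] at hrun
  obtain ⟨rfl, rfl⟩ := Prod.ext_iff.1 hrun
  simp only at hLU hopt ⊢
  have hjk : (j : ℝ) ≤ k := by exact_mod_cast hdll ▸ hj
  have hrk : (r : ℝ) ≤ rs.length := by exact_mod_cast hdrl ▸ hr'
  have hUz : U₀ + j * (2 * z) ≤ z := by rw [← hU₀]; nlinarith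
  refine ⟨coversList_settleAll hz hβ hn hval hLU hUz ?_, fun ys hlen hcov => ?_⟩
  · rw [← hV₀, hnlen]; nlinarith
  refine (settle_le_objective hval hLU hUz).trans ?_
  obtain ⟨e, f, he, hf, hel, hfr, hef, hle⟩ := exists_objective_le hz hβ hn hx hval hlen hcov
  refine le_trans ?_ hle
  -- The window of a competitor is an admissible choice for the greedy comparison: it excludes only
  -- outside sensors, so it uses `k - e` of those on the left and `f - (k + m)` of those on the
  -- right.
  have hek : e ≤ k := by
    by_contra hcon
    have h2 := hel k (by omega)
    have hkn : k < ((ls ++ ms) ++ rs).length := by omega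
    rw [List.append_assoc] at h2 hkn
    rw [List.getD_eq_getElem _ _ hkn, List.getElem_append_right (by omega)] at h2
    have h3 := List.getElem_mem (l := ms ++ rs) (n := k - ls.length)
      (by rw [List.length_append] at hkn; omega)
    rcases List.mem_append.1 h3 with h | h
    · exact absurd h2 (hms _ h).not_gt
    · exact absurd h2 (hrs' _ h).not_gt
  have hfk : k + m ≤ f := by
    by_contra hcon
    have hfn : f < (ls ++ ms).length := by rw [List.length_append]; omega
    have hfn' : f < ((ls ++ ms) ++ rs).length := by rw [List.length_append]; omega
    have h2 := hfr f le_rfl hfn'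
    rw [List.getD_eq_getElem _ _ hfn', List.getElem_append_left hfn] at h2
    exact absurd (h1 _ (List.getElem_mem hfn)) h2.not_ge
  have hfr' : f - (k + m) ≤ dr.length := by
    rw [hdrl]; rw [List.length_append, List.length_append] at hf; omega
  have hU1 : U₀ + ((k - e : ℕ) : ℝ) * (2 * z) = z - e * (2 * z) := by
    rw [Nat.cast_sub hek, ← hU₀]; ring
  have hL1 : -V₀ - ((f - (k + m) : ℕ) : ℝ) * (2 * z) = β + z - f * (2 * z) := by
    rw [Nat.cast_sub hfk, ← hV₀, hnlen]; push_cast; ring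
  rw [← hU1, ← hL1, hobj _ _ (by omega) hfr', hobj _ _ hj hr']
  have := hopt (k - e) (f - (k + m)) (by rw [length_marginals]; omega)
    (by rw [length_marginals]; exact hfr') (by rw [hU1, hL1]; exact hef)
  linarith

end plan

/-! ### List functions of the program -/

theorem Ev.min {env : List Val} {a b : Expr} {r s : ℝ} {T₁ T₂ : ℕ} (ha : Ev env a (.num r) T₁)
    (hb : Ev env b (.num s) T₂) :
    Ev env (.ifLt a b a b) (.num (min r s)) (2 * T₁ + 2 * T₂ + 1) := by
  rcases lt_or_ge r s with h | h
  · exact (Ev.ifT ha hb h ha).of_eq (by rw [min_eq_left h.le]) (by omega)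
  · exact (Ev.ifF ha hb h hb).of_eq (by rw [min_eq_right h]) (by omega)

theorem Ev.max {env : List Val} {a b : Expr} {r s : ℝ} {T₁ T₂ : ℕ} (ha : Ev env a (.num r) T₁)
    (hb : Ev env b (.num s) T₂) :
    Ev env (.ifLt a b b a) (.num (max s r)) (2 * T₁ + 2 * T₂ + 1) := by
  rcases lt_or_ge r s with h | h
  · exact (Ev.ifT ha hb h hb).of_eq (by rw [max_eq_left h.le]) (by omega)
  · exact (Ev.ifF ha hb h ha).of_eq (by rw [max_eq_right h]) (by omega)

theorem Ev.settle {env : List Val} {ix ih iz ib : ℕ} {x u c z β : ℝ}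
    (hx : env[ix]? = some (.num x)) (hh : env[ih]? = some (.num (u + c)))
    (hz : env[iz]? = some (.num z)) (hb : env[ib]? = some (.num β)) :
    Ev env (.ifLt (.var ix) (.arith .sub (.const 0) (.var iz))
        (.ifLt (.arith .sub (.const 0) (.var iz)) (.var ih) (.var ih) (.var ix))
        (.ifLt (.arith .add (.var ib) (.var iz)) (.var ix)
          (.ifLt (.var ih) (.arith .add (.var ib) (.var iz)) (.var ih) (.var ix)) (.var ih)))
      (.num (settle z β c x u)) 20 := by
  have hnz : Ev env (.arith .sub (.const 0) (.var iz)) (.num (-z)) 3 :=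
    (Ev.sub Ev.zero (Ev.var hz)).of_eq (by simp) le_rfl
  have hbz := Ev.add (Ev.var hb) (Ev.var hz)
  unfold BarrierCoverage.settle
  split_ifs with h1 h2 h3 h4
  · exact (Ev.ifT (Ev.var hx) hnz h1 (Ev.ifT hnz (Ev.var hh) h2 (Ev.var hh))).of_eq rfl
      (by norm_num)
  · exact (Ev.ifT (Ev.var hx) hnz h1 (Ev.ifF hnz (Ev.var hh) (not_lt.1 h2) (Ev.var hx))).of_eq
      rfl (by norm_num)
  · exact (Ev.ifF (Ev.var hx) hnz (not_lt.1 h1) (Ev.ifT hbz (Ev.var hx) h3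
      (Ev.ifT (Ev.var hh) hbz h4 (Ev.var hh)))).of_eq rfl (by norm_num)
  · exact (Ev.ifF (Ev.var hx) hnz (not_lt.1 h1) (Ev.ifT hbz (Ev.var hx) h3
      (Ev.ifF (Ev.var hh) hbz (not_lt.1 h4) (Ev.var hx)))).of_eq rfl (by norm_num)
  · exact (Ev.ifF (Ev.var hx) hnz (not_lt.1 h1) (Ev.ifF hbz (Ev.var hx) (not_lt.1 h3)
      (Ev.var hh))).of_eq rfl (by norm_num)

/-- The list of the entries `(x, i)`, `i` being the position, counted from the given number. -/
def tagged : List ℝ → ℝ → List (ℝ × ℝ)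
  | [], _ => []
  | x :: xs, i => (x, i) :: tagged xs (i + 1)

/-- The linked list of entries with numbers as payloads. -/
def pairs (l : List (ℝ × ℝ)) : Val := lst (l.map fun q => entry (q.1, .num q.2))

theorem pairs_eq (l : List (ℝ × ℝ)) :
    pairs l = lst ((l.map fun q => ((q.1, .num q.2) : ℝ × Val)).map entry) := by
  simp [pairs, Function.comp_def]

theorem tag_spec (xs : List ℝ) (i : ℝ) :
    Call 8 [lst (xs.map .num), .num i] (pairs (tagged xs i)) (30 * (xs.length + 1)) := by
  induction xs generalizing i with
  | nil => exact ⟨_, rfl, Ev.of_eq (Ev.splitN (Ev.var rfl) Ev.nil) rfl (by simp)⟩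
  | cons x xs ih =>
    refine ⟨_, rfl, Ev.of_eq (Ev.splitC (Ev.var rfl) (Ev.letIn (Ev.add (Ev.var rfl) Ev.one)
        (Ev.letIn (Ev.call rfl (ih (i +
      1))) (Ev.cons (Ev.cons (Ev.var rfl) (Ev.var rfl)) (Ev.var rfl))))) rfl ?_⟩
    simp only [List.length_cons, List.length_nil]
    omega

theorem neg_spec (ts : List ℝ) :
    Call 11 [lst (ts.map .num)]
      (lst ((ts.map fun t => ((-t, .nil) : ℝ × Val)).map entry)) (30 * (ts.length + 1)) := by
  induction ts with
  | nil => exact ⟨_, rfl, Ev.of_eq (Ev.splitN (Ev.var rfl) Ev.nil) rfl (by simp)⟩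
  | cons x xs ih =>
    refine ⟨_, rfl, Ev.of_eq (Ev.splitC (Ev.var rfl) (Ev.letIn (Ev.call rfl ih) (Ev.cons
        (Ev.cons (Ev.sub Ev.zero (Ev.var
      rfl)) Ev.nil) (Ev.var rfl)))) (by simp [lst, entry]) ?_⟩
    simp only [List.length_cons, List.length_nil]
    omega

theorem revNeg_spec (es : List (ℝ × Val)) (acc : List (ℝ × Val)) (c w : ℝ) :
    Call 12 [lst (es.map entry), lst (acc.map entry), .num c, .num w]
      (.cons (.num (c + es.length * w))
        (lst (((es.map fun p => ((-p.1, .nil) : ℝ × Val)).reverse ++ acc).map entry)))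
      (40 * (es.length + 1)) := by
  induction es generalizing acc c with
  | nil => exact ⟨_, rfl, Ev.of_eq (Ev.splitN (Ev.var rfl) (Ev.cons (Ev.var rfl)
      (Ev.var rfl))) (by simp) (by simp)⟩
  | cons p es ih =>
    have h := ih ((0 - p.1, .nil) :: acc) (c + w)
    refine ⟨_, rfl, Ev.of_eq (Ev.splitC (Ev.var rfl) (Ev.splitC (Ev.var rfl) (Ev.letIn (Ev.cons
        (Ev.cons (Ev.sub Ev.zero
      (Ev.var rfl)) Ev.nil) (Ev.var rfl)) (Ev.letIn (Ev.add (Ev.var rfl) (Ev.var rfl)) (Ev.call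
      rfl h))))) ?_ ?_⟩
    · congr 2
      · simp only [List.length_cons]; push_cast; ring
      · simp
    · simp only [List.length_cons, List.length_nil]
      omega

theorem far_spec (es : List (ℝ × Val)) (b w c : ℝ) (acc : List ℝ) :
    Call 13 [lst (es.map entry), .num b, .num w, .num c, lst (acc.map .num)]
      (.cons (.num (far b w (es.map Prod.fst) c acc).1)
        (lst ((far b w (es.map Prod.fst) c acc).2.map .num))) (40 * (es.length + 1)) := by
  induction es generalizing acc c with
  | nil => exact ⟨_, rfl, Ev.of_eq (Ev.splitN (Ev.var rfl) (Ev.cons (Ev.var rfl)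
      (Ev.var rfl))) rfl (by simp)⟩
  | cons p es ih =>
    simp only [List.map_cons, far]
    by_cases hp : p.1 < b
    · have h := ih (c - w) ((b - p.1) :: acc)
      rw [if_pos hp]
      refine ⟨_, rfl, Ev.of_eq (Ev.splitC (Ev.var rfl) (Ev.splitC (Ev.var rfl) (Ev.ifT
          (Ev.var rfl) (Ev.var rfl) hp (Ev.letIn
      (Ev.cons (Ev.sub (Ev.var rfl) (Ev.var rfl)) (Ev.var rfl)) (Ev.letIn (Ev.sub (Ev.var rfl)
      (Ev.var rfl)) (Ev.call rfl h)))))) rfl ?_⟩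
      simp only [List.length_cons, List.length_nil]
      omega
    · rw [if_neg hp]
      refine ⟨_, rfl, Ev.of_eq (Ev.splitC (Ev.var rfl) (Ev.splitC (Ev.var rfl) (Ev.ifF
          (Ev.var rfl) (Ev.var rfl) (not_lt.1
      hp) (Ev.cons (Ev.var rfl) (Ev.var rfl))))) rfl ?_⟩
      simp only [List.length_cons]
      omega

theorem sums_spec (es : List (ℝ × Val)) (a n : ℝ) :
    Call 14 [lst (es.map entry), .num a, .num n]
      (.cons (.num (a + (es.map Prod.fst).sum)) (.num (n + es.length)))
      (40 * (es.length + 1)) := by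
  induction es generalizing a n with
  | nil => exact ⟨_, rfl, Ev.of_eq (Ev.splitN (Ev.var rfl) (Ev.cons (Ev.var rfl)
      (Ev.var rfl))) (by simp) (by simp)⟩
  | cons p es ih =>
    have h := ih (a + p.1) (n + 1)
    refine ⟨_, rfl, Ev.of_eq (Ev.splitC (Ev.var rfl) (Ev.splitC (Ev.var rfl) (Ev.letIn (Ev.add
        (Ev.var rfl) (Ev.var rfl))
      (Ev.letIn (Ev.add (Ev.var rfl) Ev.one) (Ev.call rfl h))))) ?_ ?_⟩
    · congr 2
      · simp only [List.map_cons, List.sum_cons]; ring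
      · simp only [List.length_cons]; push_cast; ring
    · simp only [List.length_cons, List.length_nil]
      omega

/-! ### Marginal costs from sorted breakpoints, greedy choice and placement. -/

theorem hinge_eq_sum_sub {D : Multiset ℝ} {l : List ℝ} {u : ℝ} (hD : ∀ d ∈ D, d ≤ u)
    (hl : ∀ b ∈ l, u ≤ b) : hinge (D + ↑l) u = l.sum - l.length * u := by
  induction l with
  | nil => simpa using hinge_eq_zero hD
  | cons b l ih =>
    rw [← Multiset.cons_coe, Multiset.add_cons, hinge_cons, ih fun c hc => hl c (by simp [hc]),
      max_eq_left (by linarith [hl b (by simp)])]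
    simp only [List.sum_cons, List.length_cons]
    push_cast
    ring

/-- The bound `u` only grows, so the breakpoints `D` dropped below it never count again, and the
hinge sum is the remaining sum minus their number times `u`. Each call of `marg` drops a breakpoint,
emits a marginal cost or ends, which gives linear time. -/
theorem marg_spec {w : ℝ} (hw : 0 ≤ w) (p : ℝ) (H : Multiset ℝ) (N : ℕ) :
    ∀ (ds : List ℝ) (bs : List (ℝ × Val)) (D : Multiset ℝ) (u s : ℝ), ds.length + bs.length = N →
    bs.Pairwise (fun p q => p.1 ≤ q.1) → H = D + ↑(bs.map Prod.fst) → (∀ d ∈ D, d ≤ u) →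
    Call 15 [lst (ds.map .num), lst (bs.map entry), .num (bs.map Prod.fst).sum,
        .num bs.length, .num u, .num s, .num w, .num p]
      (pairs ((marginals (hinge H) w ds u s).map fun d => (d, p))) (80 * (N + 1)) := by
  induction N with
  | zero =>
    intro ds bs D u s hN _ _ _
    obtain rfl : ds = [] := List.eq_nil_of_length_eq_zero (by omega)
    exact ⟨_, rfl, Ev.of_eq (Ev.splitN (Ev.var rfl) Ev.nil) rfl (by omega)⟩
  | succ N ih =>
    intro ds bs D u s hN hbs hH hD
    cases ds with
    | nil => exact ⟨_, rfl, Ev.of_eq (Ev.splitN (Ev.var rfl) Ev.nil) rfl (by omega)⟩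
    | cons d ds =>
      simp only [List.length_cons] at hN
      have hemit : (∀ b ∈ bs.map Prod.fst, u ≤ b) →
          Call 16 [lst ((d :: ds).map .num), lst (bs.map entry), .num (bs.map Prod.fst).sum,
            .num bs.length, .num u, .num s, .num w, .num p]
          (pairs ((marginals (hinge H) w (d :: ds) u s).map fun d => (d, p)))
          (80 * (N + 1) + 40) := by
        intro hu
        have hval := hinge_eq_sum_sub hD hu
        rw [List.length_map, ← hH] at hval
        have h := ih ds bs D (u + w) (hinge H u) (by omega) hbs hH
          fun d hd => (hD d hd).trans (by linarith)
        rw [hval] at h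
        refine ⟨_, rfl, Ev.of_eq (Ev.splitC (Ev.var rfl) (Ev.letIn (Ev.sub (Ev.var rfl) (Ev.mul
            (Ev.var rfl) (Ev.var rfl)))
      (Ev.letIn (Ev.add (Ev.var rfl) (Ev.var rfl)) (Ev.letIn (Ev.call rfl h) (Ev.cons (Ev.cons
      (Ev.sub (Ev.add (Ev.var rfl) (Ev.var rfl)) (Ev.var rfl)) (Ev.var rfl))
          (Ev.var rfl)))))) ?_ ?_⟩
        · simp only [marginals, hval, pairs, List.map_cons, lst, entry]
        · simp only [List.length_cons, List.length_nil]
          omega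
      cases bs with
      | nil =>
        refine ⟨_, rfl, Ev.of_eq (Ev.splitC (Ev.var rfl) (Ev.splitN (Ev.var rfl)
            (Ev.call rfl (hemit (by simp))))) rfl ?_⟩
        simp only [List.length_cons, List.length_nil]
        omega
      | cons q bs =>
        rw [List.pairwise_cons] at hbs
        by_cases hq : q.1 < u
        · have h := ih (d :: ds) bs (q.1 ::ₘ D) u s (by simp only [List.length_cons] at hN ⊢; omega)
            hbs.2 (by rw [hH]; simp [← Multiset.cons_coe]) (by
              intro d hd
              rcases Multiset.mem_cons.1 hd with rfl | hd
              exacts [hq.le, hD d hd])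
          rw [show (bs.map Prod.fst).sum = ((q :: bs).map Prod.fst).sum - q.1 by simp,
            show (bs.length : ℝ) = ((q :: bs).length : ℝ) - 1 by simp] at h
          refine ⟨_, rfl, Ev.of_eq (Ev.splitC (Ev.var rfl) (Ev.splitC (Ev.var rfl) (Ev.splitC
              (Ev.var rfl) (Ev.ifT (Ev.var rfl)
      (Ev.var rfl) hq (Ev.letIn (Ev.sub (Ev.var rfl) (Ev.var rfl)) (Ev.letIn (Ev.sub (Ev.var
      rfl) Ev.one) (Ev.call rfl h))))))) rfl ?_⟩
          simp only [List.length_cons, List.length_nil]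
          omega
        · have h := hemit (by
            intro b hb
            obtain ⟨q', hq', rfl⟩ := List.mem_map.1 hb
            rcases List.mem_cons.1 hq' with rfl | hq'
            exacts [not_lt.1 hq, (not_lt.1 hq).trans (hbs.1 q' hq')])
          refine ⟨_, rfl, Ev.of_eq (Ev.splitC (Ev.var rfl) (Ev.splitC (Ev.var rfl) (Ev.splitC
              (Ev.var rfl) (Ev.ifF (Ev.var rfl)
      (Ev.var rfl) (not_lt.1 hq) (Ev.call rfl h))))) rfl ?_⟩
          simp only [List.length_cons, List.length_nil]
          omega

theorem side_spec {w : ℝ} (hw : 0 ≤ w) (p u : ℝ) (ds : List ℝ) {bs : List (ℝ × Val)}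
    (hbs : bs.Pairwise (fun p q => p.1 ≤ q.1)) {H : Multiset ℝ} (hH : H = ↑(bs.map Prod.fst)) :
    Call 17 [lst (bs.map entry), lst (ds.map .num), .num u, .num w, .num p]
      (pairs ((marginals (hinge H) w ds (u + w) (hinge H u)).map fun d => (d, p)))
      (120 * (ds.length + bs.length + 2)) := by
  have h1 := sums_spec bs 0 0
  -- A dummy sensor at distance `0` with previous value `0` makes the first entry the hinge sum at
  -- `u` itself. It is thrown away, but the next marginal cost then refers to the right previous
  -- value.
  have h2 := marg_spec hw p H _ (0 :: ds) bs 0 u 0 rfl hbs (by simpa using hH) (by simp)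
  simp only [zero_add] at h1
  simp only [marginals, zero_add, sub_zero] at h2
  refine ⟨_, rfl, Ev.of_eq (Ev.letIn Ev.zero (Ev.letIn (Ev.call rfl h1) (Ev.splitC (Ev.var rfl)
      (Ev.letIn (Ev.cons
      (Ev.var rfl) (Ev.var rfl)) (Ev.letIn (Ev.call rfl h2) (Ev.splitC (Ev.var rfl) (Ev.var
      rfl))))))) rfl ?_⟩
  simp only [List.length_cons, List.length_nil]
  omega

theorem greedy_spec (g : List (ℝ × ℝ)) (u l w : ℝ) :
    Call 18 [pairs g, .num u, .num l, .num w]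
      (.cons (.num (greedy w g u l).1) (.num (greedy w g u l).2)) (40 * (g.length + 1)) := by
  induction g generalizing u l with
  | nil => exact ⟨_, rfl, Ev.of_eq (Ev.splitN (Ev.var rfl) (Ev.cons (Ev.var rfl)
      (Ev.var rfl))) rfl (by simp)⟩
  | cons q g ih =>
    obtain ⟨d, p⟩ := q
    have h := ih (u + p) (l + p - w)
    rcases lt_or_ge u l with h1 | h1
    · rw [greedy, if_pos (Or.inl h1)]
      refine ⟨_, rfl, Ev.of_eq (Ev.splitC (Ev.var rfl) (Ev.splitC (Ev.var rfl) (Ev.letIn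
          (Ev.add (Ev.var rfl) (Ev.var rfl))
      (Ev.letIn (Ev.sub (Ev.add (Ev.var rfl) (Ev.var rfl)) (Ev.var rfl)) (Ev.ifT (Ev.var rfl)
      (Ev.var rfl) h1 (Ev.call rfl h)))))) rfl ?_⟩
      simp only [List.length_cons, List.length_nil]
      omega
    · rcases lt_or_ge d 0 with h2 | h2
      · rw [greedy, if_pos (Or.inr h2)]
        refine ⟨_, rfl, Ev.of_eq (Ev.splitC (Ev.var rfl) (Ev.splitC (Ev.var rfl) (Ev.letIn
            (Ev.add (Ev.var rfl) (Ev.var rfl))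
      (Ev.letIn (Ev.sub (Ev.add (Ev.var rfl) (Ev.var rfl)) (Ev.var rfl)) (Ev.ifF (Ev.var rfl)
      (Ev.var rfl) h1 (Ev.ifT (Ev.var rfl) Ev.zero h2 (Ev.call rfl h))))))) rfl ?_⟩
        simp only [List.length_cons, List.length_nil]
        omega
      · rw [greedy, if_neg (not_or.2 ⟨h1.not_gt, h2.not_gt⟩)]
        refine ⟨_, rfl, Ev.of_eq (Ev.splitC (Ev.var rfl) (Ev.splitC (Ev.var rfl) (Ev.letIn
            (Ev.add (Ev.var rfl) (Ev.var rfl))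
      (Ev.letIn (Ev.sub (Ev.add (Ev.var rfl) (Ev.var rfl)) (Ev.var rfl)) (Ev.ifF (Ev.var rfl)
      (Ev.var rfl) h1 (Ev.ifF (Ev.var rfl) Ev.zero h2 (Ev.cons (Ev.var rfl)
          (Ev.var rfl)))))))) rfl ?_⟩
        simp only [List.length_cons]
        omega

theorem place_spec (es : List (ℝ × ℝ)) (ts : List ℝ) (hlen : ts.length = es.length)
    (c v l z β : ℝ) :
    Call 19 [pairs es, lst (ts.map .num), .num c, .num v, .num l, .num z, .num β]
      (pairs (List.zipWith (fun q y => (q.2, y)) es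
        (settleAll z β c (es.map Prod.fst) (backtrack l v ts)))) (100 * (es.length + 1)) := by
  induction es generalizing ts c v with
  | nil => exact ⟨_, rfl, Ev.of_eq (Ev.splitN (Ev.var rfl) Ev.nil) rfl (by simp)⟩
  | cons q es ih =>
    cases ts with
    | nil => simp at hlen
    | cons t ts =>
      have h := ih ts (by simpa using hlen) (c + (z + z)) (Max.max l (Min.min v t))
      refine ⟨_, rfl, Ev.of_eq (Ev.splitC (Ev.var rfl) (Ev.splitC (Ev.var rfl) (Ev.splitC
          (Ev.var rfl) (Ev.letIn (Ev.min
      (Ev.var rfl) (Ev.var rfl)) (Ev.letIn (Ev.max (Ev.var rfl) (Ev.var rfl)) (Ev.letIn (Ev.add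
      (Ev.var rfl) (Ev.var rfl)) (Ev.letIn (Ev.settle rfl rfl rfl rfl) (Ev.letIn (Ev.add
      (Ev.var rfl) (Ev.add (Ev.var rfl) (Ev.var rfl))) (Ev.letIn (Ev.call rfl h) (Ev.cons
      (Ev.cons (Ev.var rfl) (Ev.var rfl)) (Ev.var rfl))))))))))) rfl ?_⟩
      simp only [List.length_cons, List.length_nil]
      omega

theorem strip_spec (l : List (ℝ × ℝ)) :
    Call 20 [pairs l] (lst ((l.map Prod.snd).map .num)) (30 * (l.length + 1)) := by
  induction l with
  | nil => exact ⟨_, rfl, Ev.of_eq (Ev.splitN (Ev.var rfl) Ev.nil) rfl (by simp)⟩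
  | cons q l ih =>
    refine ⟨_, rfl, Ev.of_eq (Ev.splitC (Ev.var rfl) (Ev.splitC (Ev.var rfl) (Ev.letIn
        (Ev.call rfl ih) (Ev.cons (Ev.var
      rfl) (Ev.var rfl))))) rfl ?_⟩
    simp only [List.length_cons, List.length_nil]
    omega

/-- The equation of multisets is the hypothesis of `hinge_push`, and the bound by `t` that of
`push_attained`. -/
theorem insPop_spec {h : Val} {s : Multiset (ℝ × Val)} {r ℓ : ℕ} (a : ℝ) (ts : List ℝ)
    (hh : IsHeap h s r) (hs : Multiset.card s < 2 ^ ℓ) (hℓ : 0 < ℓ) :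
    ∃ h' t s' r', Call 9 [.num a, h, lst (ts.map .num)] (.cons h' (lst ((t :: ts).map .num)))
        (400 * ℓ + 300) ∧ IsHeap h' s' r' ∧ a ::ₘ s.map Prod.fst = t ::ₘ s'.map Prod.fst ∧
      (∀ b ∈ s'.map Prod.fst, b ≤ t) ∧ Multiset.card s' = Multiset.card s := by
  obtain ⟨g, rg, hg, hg'⟩ := ins_spec (a, .nil) hh hs hℓ
  generalize hM : ((a, .nil) : ℝ × Val) ::ₘ s = M at hg'
  cases hg' with
  | nil => simp at hM
  | @node lh rh sl sr nl nr p hl hr hle hmax =>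
    have hcard : Multiset.card s = Multiset.card sl + Multiset.card sr := by
      have := congrArg Multiset.card hM
      simpa using this
    obtain ⟨m, rm, hm, hm'⟩ := merge_log (ℓ := ℓ) hl hr (by omega) (by omega)
    refine ⟨m, p.1, sl + sr, rm, ⟨_, rfl, Ev.of_eq (Ev.letIn Ev.nil (Ev.letIn (Ev.call rfl hg)
        (Ev.splitC (Ev.var rfl) (Ev.splitC (Ev.var rfl)
      (Ev.splitC (Ev.var rfl) (Ev.splitC (Ev.var rfl) (Ev.letIn (Ev.call rfl hm) (Ev.cons
      (Ev.var rfl) (Ev.cons (Ev.var rfl) (Ev.var rfl)))))))))) rfl ?_⟩, hm', ?_,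
      ?_, ?_⟩
    · simp only [List.length_cons, List.length_nil]
      omega
    · have := congrArg (Multiset.map Prod.fst) hM
      simpa using this
    · intro b hb
      obtain ⟨q, hq, rfl⟩ := Multiset.mem_map.1 hb
      exact hmax q hq
    · rw [hcard, Multiset.card_add]

/-- Each sensor causes at most two insertions and one removal and enlarges the heap by at most one
entry. -/
theorem sweep_spec {ℓ : ℕ} (hℓ : 0 < ℓ) (z β : ℝ)
    (es : List (ℝ × Val)) (hes : es.length < 2 ^ ℓ) (c : ℝ) :
    ∃ h s r ts K, Call 10 [lst (es.map entry), .num c, .num z, .num β]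
        (.cons h (lst (ts.map .num))) ((600 * ℓ + 500) * (es.length + 1)) ∧
      IsHeap h s r ∧ IsValue z β c (es.map Prod.fst) (s.map Prod.fst) ts K ∧
      Multiset.card s ≤ es.length := by
  induction es generalizing c with
  | nil =>
    exact ⟨.nil, 0, 0, [], 0, ⟨_, rfl, Ev.of_eq (Ev.splitN (Ev.var rfl) (Ev.cons Ev.nil Ev.nil)) rfl
      (by simp only [List.length_nil]; omega)⟩, IsHeap.nil, IsValue.nil z β c, by simp⟩
  | cons p es ih =>
    simp only [List.length_cons] at hes
    obtain ⟨h, s, r, ts, K, hrun, hh, hval, hcard⟩ := ih (by omega) (c + (z + z))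
    have hnz : 0 - z = -z := by ring
    rcases lt_or_ge p.1 (-z) with h1 | h1
    · obtain ⟨h', t, s', r', hp, hh', hst, hmax, hc⟩ :=
        insPop_spec (ℓ := ℓ) (0 - z - c) ts hh (by omega) hℓ
      refine ⟨h', s', r', t :: ts, _, ⟨_, rfl, Ev.of_eq (Ev.splitC (Ev.var rfl) (Ev.splitC
          (Ev.var rfl) (Ev.letIn (Ev.add (Ev.var rfl) (Ev.add (Ev.var
      rfl) (Ev.var rfl))) (Ev.letIn (Ev.call rfl hrun) (Ev.splitC (Ev.var rfl) (Ev.ifT (Ev.var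
      rfl) (Ev.sub Ev.zero (Ev.var rfl)) (hnz ▸ h1) (Ev.letIn (Ev.sub (Ev.sub Ev.zero (Ev.var
      rfl)) (Ev.var rfl)) (Ev.call rfl hp))))))))
        rfl ?_⟩, hh', hval.cons_left h1 (by rw [← hnz]; exact hst) hmax, ?_⟩
      · simp only [List.length_cons, List.length_nil]
        ring_nf
        omega
      · simp only [List.length_cons]; omega
    · rcases lt_or_ge (β + z) p.1 with h2 | h2
      · obtain ⟨g, rg, hg, hg'⟩ := ins_spec (ℓ := ℓ) (β + z - c, .nil) hh (by omega) hℓ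
        refine ⟨g, _, rg, z :: ts, _, ⟨_, rfl,
          Ev.of_eq (Ev.splitC (Ev.var rfl) (Ev.splitC (Ev.var rfl) (Ev.letIn (Ev.add
              (Ev.var rfl) (Ev.add (Ev.var
      rfl) (Ev.var rfl))) (Ev.letIn (Ev.call rfl hrun) (Ev.splitC (Ev.var rfl) (Ev.ifF (Ev.var
      rfl) (Ev.sub Ev.zero (Ev.var rfl)) (hnz ▸ h1) (Ev.ifT (Ev.add (Ev.var rfl) (Ev.var rfl))
      (Ev.var rfl) h2 (Ev.letIn (Ev.sub (Ev.add (Ev.var rfl) (Ev.var rfl)) (Ev.var rfl))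
      (Ev.letIn Ev.nil (Ev.letIn (Ev.call rfl hg) (Ev.cons (Ev.var rfl) (Ev.cons (Ev.var rfl)
      (Ev.var rfl))))))))))))) rfl ?_⟩, hg', by
            simpa using hval.cons_right h1 h2, ?_⟩
        · simp only [List.length_cons, List.length_nil]
          ring_nf
          omega
        · simp only [List.length_cons, Multiset.card_cons]; omega
      · obtain ⟨g, rg, hg, hg'⟩ := ins_spec (ℓ := ℓ) (p.1 - c, .nil) hh (by omega) hℓ
        obtain ⟨h', t, s', r', hp, hh', hst, hmax, hc⟩ :=
          insPop_spec (ℓ := ℓ) (p.1 - c) ts hg' (by rw [Multiset.card_cons]; omega) hℓ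
        refine ⟨h', s', r', t :: ts, _, ⟨_, rfl,
          Ev.of_eq (Ev.splitC (Ev.var rfl) (Ev.splitC (Ev.var rfl) (Ev.letIn (Ev.add
              (Ev.var rfl) (Ev.add (Ev.var
      rfl) (Ev.var rfl))) (Ev.letIn (Ev.call rfl hrun) (Ev.splitC (Ev.var rfl) (Ev.ifF (Ev.var
      rfl) (Ev.sub Ev.zero (Ev.var rfl)) (hnz ▸ h1) (Ev.ifF (Ev.add (Ev.var rfl) (Ev.var rfl))
      (Ev.var rfl) h2 (Ev.letIn (Ev.sub (Ev.var rfl) (Ev.var rfl)) (Ev.letIn Ev.nil (Ev.letIn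
      (Ev.call rfl hg) (Ev.call rfl hp))))))))))) rfl ?_⟩, hh',
          hval.cons_inner h1 h2 (by simpa using hst) hmax, ?_⟩
        · simp only [List.length_cons, List.length_nil]
          ring_nf
          omega
        · simp only [List.length_cons, hc, Multiset.card_cons]; omega

/-! ### The main function -/

theorem exists_map_eq_of_perm {α γ : Type*} {f : α → γ} {g : γ → α} (hgf : ∀ a, g (f a) = a)
    {l : List α} {l' : List γ} (h : l'.Perm (l.map f)) : ∃ k : List α, k.Perm l ∧ l' = k.map f := by
  refine ⟨l'.map g, ?_, ?_⟩
  · simpa [Function.comp_def, hgf] using h.map g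
  · rw [List.map_map]
    refine (List.map_id' l').symm.trans (List.map_congr_left fun c hc => ?_)
    obtain ⟨a, _, rfl⟩ := List.mem_map.1 (h.mem_iff.1 hc)
    simp [hgf]

/-- Sorting treats payloads as opaque data; being a permutation of the input, its output still
carries only numbers. -/
theorem exists_pairs_of_perm {l : List (ℝ × ℝ)} {l' : List (ℝ × Val)}
    (h : l'.Perm (l.map fun q => (q.1, Val.num q.2))) (hs : l'.Pairwise fun p q => p.1 ≤ q.1) :
    ∃ k : List (ℝ × ℝ), k.Perm l ∧ lst (l'.map entry) = pairs k ∧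
      k.Pairwise fun p q => p.1 ≤ q.1 := by
  obtain ⟨k, hk, rfl⟩ := exists_map_eq_of_perm (f := fun q : ℝ × ℝ => (q.1, Val.num q.2))
    (g := fun p => (p.1, match p.2 with | .num r => r | _ => 0)) (fun a => rfl) h
  exact ⟨k, hk, (pairs_eq k).symm, by simpa [List.pairwise_map] using hs⟩

theorem sort_pairs_spec {ℓ : ℕ} (hℓ : 0 < ℓ) (l : List (ℝ × ℝ)) (hl : l.length < 2 ^ ℓ) :
    ∃ k : List (ℝ × ℝ), Call 7 [pairs l] (pairs k) ((400 * ℓ + 320) * (l.length + 1)) ∧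
      k.Perm l ∧ k.Pairwise fun p q => p.1 ≤ q.1 := by
  obtain ⟨l', h1, h2, h3⟩ := sort_spec hℓ (l.map fun q => ((q.1, Val.num q.2) : ℝ × Val))
    (by simpa using hl)
  obtain ⟨k, hk, hk', hk''⟩ := exists_pairs_of_perm h2 h3
  rw [hk', ← pairs_eq, List.length_map] at h1
  exact ⟨k, h1, hk, hk''⟩

theorem length_far_le (b w : ℝ) (l : List ℝ) (c : ℝ) (acc : List ℝ) :
    (far b w l c acc).2.length ≤ l.length + acc.length := by
  induction l generalizing c acc with
  | nil => simp [far]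
  | cons x l ih =>
    rw [far]
    split_ifs
    · have := ih (c - w) ((b - x) :: acc)
      simp only [List.length_cons] at this ⊢
      omega
    · simp

theorem length_tagged (xs : List ℝ) (i : ℝ) : (tagged xs i).length = xs.length := by
  induction xs generalizing i with
  | nil => rfl
  | cons x xs ih => simp [tagged, ih]

/-- The factor `2` in `hℓ` allows for the common heap of both lists of marginal costs, each of which
is simply bounded by the number of sensors. -/
theorem main_spec {z β : ℝ} {xs : List ℝ} (hz : 0 < z) (hβ : 2 * z < β)
    (hfeas : β ≤ 2 * z * xs.length) {ℓ : ℕ} (hℓ : 2 * xs.length < 2 ^ ℓ) :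
    ∃ (es out : List (ℝ × ℝ)) (ys : List ℝ),
      Call 0 [lst (xs.map .num), .num z, .num β] (lst ((out.map Prod.snd).map .num))
        ((5000 * ℓ + 5000) * (xs.length + 1)) ∧
      es.Perm (tagged xs 0) ∧ out.Perm (List.zipWith (fun q y => (q.2, y)) es ys) ∧
      (out.Pairwise fun p q => p.1 ≤ q.1) ∧ ys.length = es.length ∧ CoversList z β ys ∧
      ∀ ys' : List ℝ, ys'.length = es.length → CoversList z β ys' →
        moveSum (es.map Prod.fst) ys ≤ moveSum (es.map Prod.fst) ys' := by
  have hℓ0 : 0 < ℓ := by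
    rcases Nat.eq_zero_or_pos ℓ with rfl | h
    · have : xs.length = 0 := by omega
      rw [this] at hfeas; push_cast at hfeas; linarith
    · exact h
  set n := xs.length with hn
  have htag := tag_spec xs 0
  obtain ⟨es, hsort, hes, hess⟩ := sort_pairs_spec hℓ0 (tagged xs 0)
    (by rw [length_tagged]; omega)
  have helen : es.length = n := by rw [hes.length_eq, length_tagged]
  rw [length_tagged, ← hn] at hsort
  set ev := es.map fun q => ((q.1, Val.num q.2) : ℝ × Val) with hev
  have hevlen : ev.length = n := by rw [hev, List.length_map, helen]
  have hevx : ev.map Prod.fst = es.map Prod.fst := by simp [hev, Function.comp_def]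
  have hpes : pairs es = lst (ev.map entry) := pairs_eq es
  obtain ⟨h, s, r, ts, K, hsweep, hh, hval, hcard⟩ := sweep_spec hℓ0 z β ev (by omega) 0
  rw [hevx] at hval
  have htslen : ts.length = n := by rw [hval.length_eq, List.length_map, helen]
  obtain ⟨hs, hdrain, hhs, hhss⟩ := drain_spec (ℓ := ℓ) (Multiset.card s) [] hh rfl (by omega)
    List.Pairwise.nil (by simp)
  have hhsl : hs.length = Multiset.card s := by
    have := congrArg Multiset.card hhs
    simpa using this
  have hneg := neg_spec ts
  obtain ⟨qs, hsortq, hqs, hqss⟩ := sort_spec hℓ0 (ts.map fun t => ((-t, .nil) : ℝ × Val))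
    (by rw [List.length_map]; omega)
  have hqsl : qs.length = n := by rw [hqs.length_eq, List.length_map, htslen]
  rw [List.length_map] at hsortq
  have hfl := far_spec ev (0 - z) (z + z) z []
  rcases hl : far (0 - z) (z + z) (ev.map Prod.fst) z [] with ⟨U₀, dl⟩
  have hdl := length_far_le (0 - z) (z + z) (ev.map Prod.fst) z []
  rw [hl] at hfl hdl
  have hrn := revNeg_spec ev [] 0 (z + z)
  set rv := (ev.map fun p => ((-p.1, .nil) : ℝ × Val)).reverse ++ [] with hrv
  have hrvl : rv.length = n := by simp [hrv, hevlen]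
  have hfr := far_spec rv (0 - z - β) (z + z) (0 + ev.length * (z + z) - β - z) []
  rcases hr : far (0 - z - β) (z + z) (rv.map Prod.fst)
    (0 + ev.length * (z + z) - β - z) [] with ⟨V₀, dr⟩
  have hdr := length_far_le (0 - z - β) (z + z) (rv.map Prod.fst)
    (0 + ev.length * (z + z) - β - z) []
  rw [hr] at hfr hdr
  simp only [List.length_map, List.length_nil, hevlen, hrvl, add_zero] at hdl hdr
  have hw : 0 ≤ z + z := by linarith
  have hml := side_spec hw (z + z) U₀ dl hhss (H := s.map Prod.fst) (by
    rw [← Multiset.map_coe, hhs]; simp)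
  have hmr := side_spec hw 0 V₀ dr hqss (H := ↑(ts.map Neg.neg)) (by
    have := Multiset.coe_eq_coe.2 (hqs.map Prod.fst)
    simpa [Function.comp_def] using this.symm)
  set ml := (marginals (hinge (s.map Prod.fst)) (z + z) dl (U₀ + (z + z))
    (hinge (s.map Prod.fst) U₀)).map fun d => (d, z + z) with hmldef
  set mr := (marginals (hinge ↑(ts.map Neg.neg)) (z + z) dr (V₀ + (z + z))
    (hinge ↑(ts.map Neg.neg) V₀)).map fun d => (d, (0 : ℝ)) with hmrdef
  have hmll : ml.length = dl.length := by simp [hmldef]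
  have hmrl : mr.length = dr.length := by simp [hmrdef]
  obtain ⟨h1, r1, hhp1, hh1⟩ := heapify_spec hℓ0
    (ml.map fun q => ((q.1, Val.num q.2) : ℝ × Val)) IsHeap.nil (by simp; omega)
  obtain ⟨h2, r2, hhp2, hh2⟩ := heapify_spec hℓ0
    (mr.map fun q => ((q.1, Val.num q.2) : ℝ × Val)) hh1 (by simp; omega)
  obtain ⟨g', hdg, hg', hg's⟩ := drain_spec (ℓ := ℓ) (mr.length + ml.length) [] hh2 (by simp)
    (by omega) List.Pairwise.nil (by simp)
  obtain ⟨g, hg, hgp, hgs⟩ := exists_pairs_of_perm (l := ml ++ mr) (l' := g') (by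
    refine Multiset.coe_eq_coe.1 (hg'.trans ?_)
    rw [List.map_append, ← Multiset.coe_add]
    simp [add_comm]) hg's
  rw [← pairs_eq] at hhp1 hhp2
  rw [List.length_map] at hhp1 hhp2
  rw [hgp] at hdg
  have hgl : g.length = ml.length + mr.length := by rw [hg.length_eq, List.length_append]
  have hgr := greedy_spec g U₀ (0 - V₀) (z + z)
  rcases hUL : greedy (z + z) g U₀ (0 - V₀) with ⟨U, L⟩
  rw [hUL] at hgr
  have hpl := place_spec es ts (by rw [htslen, helen]) 0 U L z β
  set ys := settleAll z β 0 (es.map Prod.fst) (backtrack L U ts) with hys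
  have hyl : ys.length = es.length := by
    rw [hys, length_settleAll (by simp [htslen, helen]), List.length_map]
  obtain ⟨out, hso, hout, houts⟩ := sort_pairs_spec hℓ0
    (List.zipWith (fun q y => (q.2, y)) es ys) (by simp [hyl]; omega)
  have hol : out.length = n := by rw [hout.length_eq]; simp [hyl, helen]
  have hzl : (List.zipWith (fun (q : ℝ × ℝ) y => (q.2, y)) es ys).length = n := by
    simp [hyl, helen]
  have hst := strip_spec out
  rw [hpes] at hsort hpl
  refine ⟨es, out, ys, ⟨_, rfl, Ev.of_eq (Ev.letIn (Ev.add (Ev.var rfl) (Ev.var rfl))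
      (Ev.letIn Ev.zero (Ev.letIn Ev.nil (Ev.letIn
      (Ev.call rfl htag) (Ev.letIn (Ev.call rfl hsort) (Ev.letIn (Ev.call rfl hsweep)
      (Ev.splitC (Ev.var rfl) (Ev.letIn (Ev.call rfl hdrain) (Ev.letIn (Ev.call rfl hneg)
      (Ev.letIn (Ev.call rfl hsortq) (Ev.letIn (Ev.sub Ev.zero (Ev.var rfl)) (Ev.letIn (Ev.call
      rfl hfl) (Ev.splitC (Ev.var rfl) (Ev.letIn (Ev.call rfl hrn) (Ev.splitC (Ev.var rfl)
      (Ev.letIn (Ev.sub (Ev.var rfl) (Ev.var rfl)) (Ev.letIn (Ev.sub (Ev.sub (Ev.var rfl)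
      (Ev.var rfl)) (Ev.var rfl)) (Ev.letIn (Ev.call rfl hfr) (Ev.splitC (Ev.var rfl) (Ev.letIn
      (Ev.call rfl hml) (Ev.letIn (Ev.call rfl hmr) (Ev.letIn (Ev.call rfl hhp1) (Ev.letIn
      (Ev.call rfl hhp2) (Ev.letIn (Ev.call rfl hdg) (Ev.letIn (Ev.sub Ev.zero (Ev.var rfl))
      (Ev.letIn (Ev.call rfl hgr) (Ev.splitC (Ev.var rfl) (Ev.letIn (Ev.call rfl hpl) (Ev.letIn
      (Ev.call rfl hso) (Ev.call rfl hst)))))))))))))))))))))))))))))) rfl ?_⟩, hes, hout,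
    houts, hyl, ?_⟩
  · simp only [List.length_cons, List.length_nil, hevlen, hrvl, htslen, hhsl, hqsl, hol, hzl,
      helen, hgl, hmll, hmrl]
    clear * - hdl hdr hcard hevlen
    -- Products with the sizes of intermediate lists are first bounded by multiples of `n + 1` and
    -- then treated as atoms, which leaves linear arithmetic.
    have e1 : (200 * ℓ + 150) * (Multiset.card s + 1) ≤ (200 * ℓ + 150) * (n + 1) :=
      Nat.mul_le_mul_left _ (by omega)
    have e2 : (200 * ℓ + 150) * (dl.length + 1) ≤ (200 * ℓ + 150) * (n + 1) :=
      Nat.mul_le_mul_left _ (by omega)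
    have e3 : (200 * ℓ + 150) * (dr.length + 1) ≤ (200 * ℓ + 150) * (n + 1) :=
      Nat.mul_le_mul_left _ (by omega)
    have e4 : (200 * ℓ + 150) * (dr.length + dl.length + 1) ≤ (200 * ℓ + 150) * (2 * (n + 1)) :=
      Nat.mul_le_mul_left _ (by omega)
    have e5 : Multiset.card s ≤ n := by omega
    generalize (200 * ℓ + 150) * (Multiset.card s + 1) = A₁ at *
    generalize (200 * ℓ + 150) * (dl.length + 1) = A₂ at *
    generalize (200 * ℓ + 150) * (dr.length + 1) = A₃ at *
    generalize (200 * ℓ + 150) * (dr.length + dl.length + 1) = A₄ at *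
    ring_nf at *
    omega
  · have e1 : (0 : ℝ) - z = -z := by ring
    have e2 : z + z = 2 * z := by ring
    have e3 : (0 : ℝ) - V₀ = -V₀ := by ring
    rw [e1, e2, hevx] at hl
    rw [e1, e2, zero_add, hevlen] at hr
    rw [e2, e3] at hUL
    rw [hmldef, hmrdef, e2] at hg
    have hxl : ((es.map Prod.fst).length : ℝ) = n := by rw [List.length_map, helen]
    have key := plan_optimal hz hβ (by rw [hxl]; exact hfeas)
      (List.pairwise_map.2 hess) hval hl (V₀ := V₀) (dr := dr) (by
        rw [hxl, ← hr]
        congr 1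
        simp [hrv, hev, Function.comp_def]) hgs hg hUL
    exact ⟨key.1, fun ys' h1 h2 => key.2 ys' (by rw [List.length_map]; exact h1) h2⟩

/-! ### Correctness and running time of the program -/

theorem tagged_ofFn {n : ℕ} (x : Fin n → ℝ) (a : ℝ) :
    tagged (List.ofFn x) a = (List.finRange n).map fun i : Fin n => (x i, a + (i : ℕ)) := by
  induction n generalizing a with
  | zero => simp [tagged]
  | succ n ih =>
    rw [List.ofFn_succ, tagged, ih, List.finRange_succ, List.map_cons, List.map_map]
    simp only [Fin.val_zero, Nat.cast_zero, add_zero, List.cons.injEq, true_and]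
    refine List.map_congr_left fun i _ => ?_
    simp [add_comm, add_left_comm]

theorem sum_zipWith_map {α : Type*} (f g : α → ℝ) (l : List α) :
    moveSum (l.map f) (l.map g) = (l.map fun a => |f a - g a|).sum := by
  induction l with
  | nil => simp [moveSum]
  | cons a l ih => simp only [List.map_cons, moveSum_cons, ih, List.sum_cons]

theorem exists_run {n : ℕ} (x : Fin n → ℝ) {z β : ℝ} (hi : IsInstance n z β) {ℓ : ℕ}
    (hℓ : 2 * n < 2 ^ ℓ) :
    ∃ (y : Fin n → ℝ) (t : ℕ), prog.Run (encodeInput x z β) (encodeOutput y) t ∧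
      IsOptimal x z β y ∧ t ≤ (5000 * ℓ + 5000) * (n + 1) := by
  obtain ⟨hz, hβ, hfeas⟩ := hi
  have hn : 0 < n := by
    rcases Nat.eq_zero_or_pos n with rfl | h
    · push_cast at hfeas; linarith
    · exact h
  have : NeZero n := ⟨hn.ne'⟩
  obtain ⟨es, out, ys, hrun, hes, hout, houts, hyl, hcov, hopt⟩ :=
    main_spec (xs := List.ofFn x) hz hβ (by simpa using hfeas) (ℓ := ℓ) (by simpa using hℓ)
  have hcast : Function.Injective fun i : Fin n => ((i : ℕ) : ℝ) := fun i j h =>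
    Fin.ext (Nat.cast_injective h)
  rw [tagged_ofFn] at hes
  simp only [zero_add] at hes
  -- `qs` lists the sensor indices in the order of their coordinates.
  obtain ⟨qs, hqs, rfl⟩ := exists_map_eq_of_perm (g := Function.invFun _)
    (Function.leftInverse_invFun (f := fun i : Fin n => (x i, ((i : ℕ) : ℝ)))
      fun i j h => hcast (Prod.ext_iff.1 h).2) hes
  have hql : qs.length = n := by rw [hqs.length_eq, List.length_finRange]
  rw [List.length_map] at hyl
  simp only [List.zipWith_map_left] at hout
  have hmaps : ∀ (l : List (Fin n)) (l' : List ℝ), l'.length = l.length →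
      (List.zipWith (fun (i : Fin n) (y : ℝ) => (((i : ℕ) : ℝ), y)) l l').map Prod.snd = l' ∧
      (List.zipWith (fun (i : Fin n) (y : ℝ) => (((i : ℕ) : ℝ), y)) l l').map Prod.fst =
        l.map fun i : Fin n => ((i : ℕ) : ℝ) := by
    intro l
    induction l with
    | nil => intro l' h; simp [List.eq_nil_of_length_eq_zero (l := l') (by simpa using h)]
    | cons i l ih =>
      intro l' h
      cases l' with
      | nil => simp at h
      | cons y l' =>
        have := ih l' (by simpa using h)
        simp [this.1, this.2]
  have hol : out.length = n := by rw [hout.length_eq]; simp [hyl, hql]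
  -- The keys of `out` are the indices in sorted order, and a sorted list is determined by its
  -- multiset. So the output is back in input order.
  have hkeys : out.map Prod.fst = (List.finRange n).map fun i : Fin n => ((i : ℕ) : ℝ) := by
    refine List.Perm.eq_of_pairwise (le := (· ≤ ·)) (fun a b _ _ => le_antisymm)
      (List.pairwise_map.2 houts) (List.pairwise_map.2 ?_) ?_
    · refine (List.pairwise_le_finRange n).imp fun h => ?_
      exact_mod_cast h
    · have h1 := hout.map Prod.fst
      rw [(hmaps qs ys hyl).2] at h1
      exact h1.trans (hqs.map _)
  set y : Fin n → ℝ := fun i => (out[(i : ℕ)]'(by rw [hol]; exact i.2)).2 with hy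
  have houtf : out = (List.finRange n).map fun i : Fin n => (((i : ℕ) : ℝ), y i) := by
    refine List.ext_getElem (by simp [hol]) fun i h1 h2 => ?_
    rw [List.getElem_map, List.getElem_finRange]
    refine Prod.ext ?_ rfl
    have h3 := List.getElem_of_eq hkeys (i := i) (by simpa using h1)
    simpa using h3
  have hsnd : out.map Prod.snd = List.ofFn y := by
    rw [houtf, List.map_map, List.ofFn_eq_map]; rfl
  have hmove : totalMove x y = moveSum (qs.map x) ys := by
    have h1 := hout.map fun p : ℝ × ℝ =>
      |x (Function.invFun (fun i : Fin n => ((i : ℕ) : ℝ)) p.1) - p.2|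
    have hinv : ∀ i : Fin n, Function.invFun (fun i : Fin n => ((i : ℕ) : ℝ)) ((i : ℕ) : ℝ) = i :=
      Function.leftInverse_invFun hcast
    rw [houtf, List.map_map, List.map_zipWith] at h1
    simp only [Function.comp_def, hinv] at h1
    have h2 := h1.sum_eq
    rw [totalMove, ← List.sum_ofFn, List.ofFn_eq_map, h2, moveSum, List.zipWith_map_left]
  obtain ⟨body, hbody, t, ht, hev⟩ := hrun
  refine ⟨y, t, ⟨body, hbody, ?_⟩, ⟨?_, ?_⟩, by simpa using ht⟩
  · rw [hsnd] at hev
    simpa only [encodeInput, encodeOutput, ofList_eq_lst] using hev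
  · intro p hp
    obtain ⟨v, hv, hpv⟩ := hcov p hp
    have h1 := hout.map Prod.snd
    rw [(hmaps qs ys hyl).1, hsnd] at h1
    obtain ⟨i, rfl⟩ := (List.mem_ofFn' y v).1 (h1.mem_iff.2 hv)
    exact ⟨i, hpv⟩
  · intro y' hy'
    have h1 := hopt (qs.map y') (by simp) (fun p hp => by
      obtain ⟨i, hi⟩ := hy' p hp
      exact ⟨y' i, List.mem_map.2 ⟨i, hqs.mem_iff.2 (List.mem_finRange i), rfl⟩, hi⟩)
    rw [List.map_map] at h1
    change moveSum (qs.map x) ys ≤ moveSum (qs.map x) (qs.map y') at h1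
    rw [hmove]
    refine h1.trans_eq ?_
    rw [sum_zipWith_map, (hqs.map _).sum_eq, totalMove, ← List.sum_ofFn, List.ofFn_eq_map]

theorem exists_program :
    ∃ (P : Program) (C : ℝ), ∀ (n : ℕ) (x : Fin n → ℝ) (z β : ℝ), IsInstance n z β →
      ∃ (y : Fin n → ℝ) (t : ℕ), P.Run (encodeInput x z β) (encodeOutput y) t ∧
        IsOptimal x z β y ∧ (t : ℝ) ≤ C * (n * Real.log n) := by
  -- With `q = log₂ n ≥ 1` the exponent `ℓ` is at most `q + 2`, so `5000 ℓ + 5000 ≤ 20000 q`, and `n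
  -- + 1 ≤ 2 n`.
  refine ⟨prog, 40000 / Real.log 2, fun n x z β hi => ?_⟩
  have hn : 2 ≤ n := by
    have h1 : 2 * z * 1 < 2 * z * n := by linarith [hi.not_trivial, hi.feasible]
    have h2 := lt_of_mul_lt_mul_left h1 (by linarith [hi.range_pos])
    exact_mod_cast h2
  obtain ⟨y, t, hrun, hopt, ht⟩ := exists_run x hi (ℓ := Nat.log 2 (2 * n) + 1)
    (Nat.lt_pow_succ_log_self (by norm_num) _)
  refine ⟨y, t, hrun, hopt, ?_⟩
  have hlog2 : 0 < Real.log 2 := Real.log_pos (by norm_num)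
  have hnR : (2 : ℝ) ≤ n := by exact_mod_cast hn
  set q := Real.log n / Real.log 2 with hq
  have hq1 : 1 ≤ q := by
    rw [hq, le_div_iff₀ hlog2, one_mul]
    exact Real.log_le_log (by norm_num) hnR
  have hℓ : (Nat.log 2 (2 * n) : ℝ) ≤ 1 + q := by
    have h1 : (2 : ℝ) ^ Nat.log 2 (2 * n) ≤ 2 * n := by
      exact_mod_cast Nat.pow_log_le_self 2 (by omega : 2 * n ≠ 0)
    have h2 := Real.log_le_log (by positivity) h1
    rw [Real.log_pow, Real.log_mul (by norm_num) (by linarith)] at h2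
    rw [hq, ← mul_le_mul_iff_left₀ hlog2]
    field_simp
    exact h2
  have ht' : (t : ℝ) ≤ (5000 * (Nat.log 2 (2 * n) + 1) + 5000) * (n + 1) := by exact_mod_cast ht
  calc (t : ℝ) ≤ (5000 * (Nat.log 2 (2 * n) + 1) + 5000) * (n + 1) := ht'
    _ ≤ (20000 * q) * (2 * n) := by
      refine mul_le_mul (by linarith) (by linarith) (by positivity) (by positivity)
    _ = 40000 / Real.log 2 * (n * Real.log n) := by rw [hq]; field_simp; ring

/-! ### The lower bound for algebraic decision trees -/

/-- If the barrier is exactly as long as all covering intervals together, and sensor `i` is near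
the centre of the `π i`-th of the `n` cells of the barrier, then it is not to the right of that
centre. -/
theorem le_of_covers_grid {n : ℕ} {y : Fin n → ℝ} (hy : Covers 1 (2 * n) y)
    (π : Equiv.Perm (Fin n)) (hnear : ∀ i, |y i - (2 * (π i : ℕ) + 1)| < 1 / 2) (i : Fin n) :
    y i ≤ 2 * (π i : ℕ) + 1 := by
  obtain ⟨k, hk⟩ : ∃ k : ℕ, k = π i := ⟨_, rfl⟩
  induction k using Nat.strong_induction_on generalizing i with
  | _ k ih =>
    rw [← hk]
    refine le_of_forall_pos_le_add fun ε hε => ?_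
    have hkn : (k : ℝ) + 1 ≤ n := by rw [hk]; exact_mod_cast (π i).2
    have hpos : 0 < min ε 1 := lt_min hε one_pos
    have hmin1 : min ε 1 ≤ 1 := min_le_right _ _
    -- Just behind the left end of cell `k`, sensors of earlier cells no longer reach by induction,
    -- and those of later cells begin too far right. So the sensor of cell `k` itself covers this
    -- point.
    obtain ⟨j, hj1, hj2⟩ := hy (2 * k + min ε 1) ⟨by positivity, by linarith⟩
    rcases lt_trichotomy (π j : ℕ) k with h | h | h
    · have h1 := ih _ h j rfl
      have h2 : ((π j : ℕ) : ℝ) + 1 ≤ k := by exact_mod_cast h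
      linarith
    · have : j = i := π.injective (Fin.ext (h.trans hk))
      subst this
      linarith [min_le_left ε 1]
    · have h1 := (abs_lt.1 (hnear j)).1
      have h2 : (k : ℝ) + 1 ≤ (π j : ℕ) := by exact_mod_cast h
      linarith

/-- The opposite inequality is `le_of_covers_grid` for the mirror image under `p ↦ 2 n - p`, which
reverses the order of the cells. -/
theorem eq_of_covers_grid {n : ℕ} {y : Fin n → ℝ} (hy : Covers 1 (2 * n) y)
    (π : Equiv.Perm (Fin n)) (hnear : ∀ i, |y i - (2 * (π i : ℕ) + 1)| < 1 / 2) (i : Fin n) :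
    y i = 2 * (π i : ℕ) + 1 := by
  refine le_antisymm (le_of_covers_grid hy π hnear i) ?_
  have hrev : ∀ i, (((π.trans Fin.revPerm) i : ℕ) : ℝ) = n - ((π i : ℕ) + 1) := fun i => by
    rw [Equiv.trans_apply, Fin.revPerm_apply, Fin.val_rev, Nat.cast_sub (π i).2]
    push_cast
    ring
  have hcov : Covers 1 (2 * n) fun i => 2 * n - y i := fun p hp => by
    obtain ⟨j, hj1, hj2⟩ := hy (2 * n - p) ⟨by linarith [hp.2], by linarith [hp.1]⟩
    exact ⟨j, by linarith, by linarith⟩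
  have h := le_of_covers_grid hcov (π.trans Fin.revPerm) (fun i => by
    rw [hrev, abs_sub_comm]
    convert hnear i using 2
    ring) i
  rw [hrev] at h
  linarith

theorem covers_grid {n : ℕ} (hn : 0 < n) (π : Equiv.Perm (Fin n)) :
    Covers 1 (2 * n) fun i => 2 * ((π i : ℕ) : ℝ) + 1 := by
  intro p hp
  obtain ⟨k, hk, h1, h2⟩ : ∃ k : ℕ, k < n ∧ 2 * (k : ℝ) ≤ p ∧ p ≤ 2 * k + 2 := by
    rcases lt_or_ge ⌊p / 2⌋₊ n with h | h
    · have h1 := Nat.floor_le (div_nonneg hp.1 two_pos.le)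
      have h2 := Nat.lt_floor_add_one (p / 2)
      exact ⟨_, h, by linarith, by linarith⟩
    · refine ⟨n - 1, by omega, ?_⟩
      have h1 := (Nat.le_floor_iff (div_nonneg hp.1 two_pos.le)).1 h
      rw [Nat.cast_sub hn]
      push_cast
      constructor <;> linarith [hp.2]
  refine ⟨π.symm ⟨k, hk⟩, ?_, ?_⟩ <;> simp only [Equiv.apply_symm_apply] <;> linarith

/-- Near a permuted grid, the grid is the only optimal solution. -/
theorem IsOptimal.eq_grid {n : ℕ} (hn : 0 < n) {x y : Fin n → ℝ} (π : Equiv.Perm (Fin n))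
    (hx : ∀ i, |x i - (2 * (π i : ℕ) + 1)| < 1 / (4 * n)) (hy : IsOptimal x 1 (2 * n) y) :
    y = fun i => 2 * ((π i : ℕ) : ℝ) + 1 := by
  have hnR : (1 : ℝ) ≤ n := by exact_mod_cast hn
  -- Moving to the grid costs at most `n · 1 / (4 n)`, so an optimal sensor moves by at most `1 / 4`
  -- and stays within `1 / 2` of its grid point.
  have hgrid : totalMove x (fun i => 2 * ((π i : ℕ) : ℝ) + 1) ≤ 1 / 4 := by
    refine (Finset.sum_le_sum fun i _ => (hx i).le).trans_eq ?_
    rw [Finset.sum_const, Finset.card_univ, Fintype.card_fin, nsmul_eq_mul]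
    field_simp
  have htot := (hy.2 _ (covers_grid hn π)).trans hgrid
  refine funext fun i => eq_of_covers_grid hy.1 π (fun j => ?_) i
  have h1 : |x j - y j| ≤ totalMove x y :=
    Finset.single_le_sum (f := fun i => |x i - y i|) (fun _ _ => abs_nonneg _) (Finset.mem_univ j)
  have h2 : 1 / (4 * (n : ℝ)) ≤ 1 / 4 := by
    rw [div_le_div_iff₀ (by positivity) (by norm_num)]; linarith
  have h3 := abs_lt.1 (hx j)
  have h4 := abs_le.1 (h1.trans htot)
  rw [abs_lt]
  constructor <;> linarith [h3.1, h3.2, h4.1, h4.2]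

/-! ### Counting the leaves of a decision tree. -/

section Slice

variable {τ υ ι : Type}

/-- Substitution of constants for the variables of the second kind. -/
noncomputable def slice (a : υ → ℝ) (p : MvPolynomial (τ ⊕ υ) ℝ) : MvPolynomial τ ℝ :=
  MvPolynomial.aeval (Sum.elim MvPolynomial.X fun j => MvPolynomial.C (a j)) p

theorem eval_slice (a : υ → ℝ) (p : MvPolynomial (τ ⊕ υ) ℝ) (x : τ → ℝ) :
    MvPolynomial.eval x (slice a p) = MvPolynomial.eval (Sum.elim x a) p := by
  induction p using MvPolynomial.induction_on with
  | C r => simp [slice]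
  | add p q hp hq => simp only [slice, map_add] at hp hq ⊢; rw [hp, hq]
  | mul_X p i hp =>
    simp only [slice, map_mul] at hp ⊢
    rw [hp]
    cases i <;> simp

/-- An open set contains a box, which is a product of infinite sets, and such a product determines a
polynomial. The range and the barrier length are fixed, so `slice` is needed before this can be
applied. -/
theorem eq_of_eqOn_open [Fintype τ] {V : Set (τ → ℝ)} (hV : IsOpen V) (hne : V.Nonempty)
    {p q : MvPolynomial τ ℝ}
    (h : ∀ x ∈ V, MvPolynomial.eval x p = MvPolynomial.eval x q) : p = q := by
  obtain ⟨x, hx⟩ := hne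
  obtain ⟨ε, hε, hball⟩ := Metric.isOpen_iff.1 hV x hx
  refine MvPolynomial.funext_set (fun i => Metric.ball (x i) ε) (fun i => ?_) fun w hw => ?_
  · rw [Real.ball_eq_Ioo]
    exact Set.Ioo_infinite (by linarith)
  · refine h w (hball ?_)
    rw [Metric.mem_ball, dist_pi_lt_iff hε]
    exact fun i => hw i (Set.mem_univ i)

/-- A tree that returns distinct constants without zero entries on each of a number of
nonempty open sets has at least as many leaves as there are sets. -/
theorem card_le_three_pow_height [Fintype τ] {κ : Type} (a : υ → ℝ) {g : κ → ι → ℝ}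
    (hg : g.Injective) (hg0 : ∀ k i, g k i ≠ 0) (T : DecisionTree (τ ⊕ υ) ι) (S : Finset κ)
    (V : κ → Set (τ → ℝ)) (hV : ∀ k ∈ S, IsOpen (V k)) (hne : ∀ k ∈ S, (V k).Nonempty)
    (hT : ∀ k ∈ S, ∀ x ∈ V k, T.eval (Sum.elim x a) = g k) : S.card ≤ 3 ^ T.height := by
  classical
  induction T generalizing S V with
  | leaf num den =>
    rw [DecisionTree.height, pow_zero, Finset.card_le_one]
    have key : ∀ k ∈ S, ∀ x ∈ V k, ∀ i, MvPolynomial.eval x (slice a (den i)) ≠ 0 ∧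
        MvPolynomial.eval x (slice a (num i)) =
          MvPolynomial.eval x (MvPolynomial.C (g k i) * slice a (den i)) := by
      intro k hk x hx i
      have h := congrFun (hT k hk x hx) i
      simp only [DecisionTree.eval] at h
      simp only [map_mul, MvPolynomial.eval_C, eval_slice]
      -- Division by zero gives `0`, so the requirement that no entry of `g k` is zero excludes
      -- vanishing denominators.
      have hd : MvPolynomial.eval (Sum.elim x a) (den i) ≠ 0 := fun h0 => by
        rw [h0, div_zero] at h
        exact hg0 k i h.symm
      exact ⟨hd, (div_eq_iff hd).1 h⟩
    have hpoly : ∀ k ∈ S, ∀ i, slice a (num i) = MvPolynomial.C (g k i) * slice a (den i) :=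
      fun k hk i => eq_of_eqOn_open (hV k hk) (hne k hk) fun x hx => (key k hk x hx i).2
    intro k hk k' hk'
    refine hg (funext fun i => ?_)
    obtain ⟨x, hx⟩ := hne k hk
    have h := congrArg (MvPolynomial.eval x) ((hpoly k hk i).symm.trans (hpoly k' hk' i))
    simp only [map_mul, MvPolynomial.eval_C] at h
    exact mul_right_cancel₀ (key k hk x hx i).1 h
  | branch p neg zero pos ihneg ihzero ihpos =>
    have hcont : Continuous fun x : τ → ℝ => MvPolynomial.eval (Sum.elim x a) p := by
      simp only [← eval_slice]
      exact MvPolynomial.continuous_eval _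
    set N := {x : τ → ℝ | MvPolynomial.eval (Sum.elim x a) p < 0} with hN
    set P := {x : τ → ℝ | 0 < MvPolynomial.eval (Sum.elim x a) p} with hP
    set A := S.filter fun k => (V k ∩ N).Nonempty with hA
    set B := S.filter fun k => (V k ∩ P).Nonempty with hB
    set Z := S.filter fun k => V k ⊆ {x | MvPolynomial.eval (Sum.elim x a) p = 0} with hZ
    have h1 : A.card ≤ 3 ^ neg.height :=
      ihneg A (fun k => V k ∩ N)
        (fun k hk => (hV k (Finset.mem_filter.1 hk).1).inter (isOpen_lt hcont continuous_const))
        (fun k hk => (Finset.mem_filter.1 hk).2)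
        fun k hk x hx => by
          have h := hT k (Finset.mem_filter.1 hk).1 x hx.1
          have h0 : MvPolynomial.eval (Sum.elim x a) p < 0 := hx.2
          rwa [DecisionTree.eval, if_pos h0] at h
    have h2 : Z.card ≤ 3 ^ zero.height :=
      ihzero Z V (fun k hk => hV k (Finset.mem_filter.1 hk).1)
        (fun k hk => hne k (Finset.mem_filter.1 hk).1)
        fun k hk x hx => by
          have h := hT k (Finset.mem_filter.1 hk).1 x hx
          have h0 : MvPolynomial.eval (Sum.elim x a) p = 0 := (Finset.mem_filter.1 hk).2 hx
          rwa [DecisionTree.eval, if_neg h0.not_lt, if_pos h0] at h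
    have h3 : B.card ≤ 3 ^ pos.height :=
      ihpos B (fun k => V k ∩ P)
        (fun k hk => (hV k (Finset.mem_filter.1 hk).1).inter (isOpen_lt continuous_const hcont))
        (fun k hk => (Finset.mem_filter.1 hk).2)
        fun k hk x hx => by
          have h := hT k (Finset.mem_filter.1 hk).1 x hx.1
          have h0 : 0 < MvPolynomial.eval (Sum.elim x a) p := hx.2
          rwa [DecisionTree.eval, if_neg h0.not_gt, if_neg h0.ne'] at h
    -- Each set either meets one of the two open conditions in a nonempty open set or lies entirely
    -- in the zero set, so it remains open and nonempty in at least one subtree.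
    have hS : S ⊆ A ∪ (Z ∪ B) := by
      intro k hk
      simp only [hA, hB, hZ, Finset.mem_union, Finset.mem_filter, hk, true_and]
      by_cases hn : (V k ∩ N).Nonempty
      · exact Or.inl hn
      by_cases hp : (V k ∩ P).Nonempty
      · exact Or.inr (Or.inr hp)
      refine Or.inr (Or.inl fun x hx => le_antisymm ?_ ?_)
      · exact not_lt.1 fun h => hp ⟨x, hx, h⟩
      · exact not_lt.1 fun h => hn ⟨x, hx, h⟩
    set m := max neg.height (max zero.height pos.height) with hm
    have hle : ∀ {c h : ℕ}, c ≤ 3 ^ h → h ≤ m → c ≤ 3 ^ m := fun hc hh =>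
      hc.trans (Nat.pow_le_pow_right (by norm_num) hh)
    have e1 := hle h1 (le_max_left _ _)
    have e2 := hle h2 ((le_max_left _ _).trans (le_max_right _ _))
    have e3 := hle h3 ((le_max_right _ _).trans (le_max_right _ _))
    have hc := (Finset.card_le_card hS).trans
      ((Finset.card_union_le _ _).trans (Nat.add_le_add_left (Finset.card_union_le _ _) _))
    rw [DecisionTree.height, ← hm, pow_succ]
    linarith

end Slice

/-! ### From the number of permutations to `n log n`. -/

theorem pow_self_le_factorial_sq (n : ℕ) : n ^ n ≤ n.factorial ^ 2 := by
  -- Pairing the factors of one factorial with those of the other in reverse order makes each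
  -- product `(i + 1) * (n - i)` at least `n`.
  have h : n.factorial ^ 2 = ∏ i ∈ Finset.range n, (i + 1) * (n - 1 - i + 1) := by
    rw [Finset.prod_mul_distrib, Finset.prod_range_reflect (fun i => i + 1) n,
      Finset.prod_range_add_one_eq_factorial, sq]
  rw [h]
  calc n ^ n = ∏ _i ∈ Finset.range n, n := by simp
    _ ≤ _ := Finset.prod_le_prod' fun i hi => by
      obtain ⟨m, rfl⟩ : ∃ m, n = i + 1 + m := Nat.exists_eq_add_of_le (Finset.mem_range.1 hi)
      rw [show i + 1 + m - 1 - i + 1 = m + 1 by omega]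
      nlinarith

/-- The hard instances have `z = 1`, `β = 2 n` and coordinates near a permuted grid; all of them
belong to the containing case, since the sensors start inside the barrier. -/
theorem factorial_le_three_pow_height {n : ℕ} (hn : 2 ≤ n)
    (T : DecisionTree (Fin n ⊕ Fin 2) (Fin n))
    (hT : ∀ (x : Fin n → ℝ) (z β : ℝ), IsInstance n z β → Containing x z β →
      IsOptimal x z β (T.eval (treeInput x z β))) :
    n.factorial ≤ 3 ^ T.height := by
  have hnR : (2 : ℝ) ≤ n := by exact_mod_cast hn
  have hε : 0 < 1 / (4 * (n : ℝ)) := by positivity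
  have hε1 : 1 / (4 * (n : ℝ)) ≤ 1 := by
    rw [div_le_one (by positivity)]; linarith
  have hcard : (Finset.univ : Finset (Equiv.Perm (Fin n))).card = n.factorial := by
    rw [Finset.card_univ, Fintype.card_perm, Fintype.card_fin]
  rw [← hcard]
  refine card_le_three_pow_height (![1, 2 * (n : ℝ)])
    (g := fun (π : Equiv.Perm (Fin n)) i => 2 * ((π i : ℕ) : ℝ) + 1) ?_
    (fun π i => by positivity) T Finset.univ
    (fun π => {x | ∀ i, |x i - (2 * (π i : ℕ) + 1)| < 1 / (4 * n)}) ?_ ?_ ?_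
  · intro π π' h
    refine Equiv.ext fun i => Fin.ext ?_
    have h1 := congrFun h i
    have h2 : ((π i : ℕ) : ℝ) = (π' i : ℕ) := by simpa using h1
    exact_mod_cast h2
  · intro π _
    simp only [Set.ofPred_forall]
    exact isOpen_iInter_of_finite fun i => isOpen_lt (by fun_prop) continuous_const
  · exact fun π _ => ⟨fun i => 2 * ((π i : ℕ) : ℝ) + 1, fun i => by simpa using hε⟩
  · intro π _ x hx
    refine IsOptimal.eq_grid (by omega) π hx (hT x 1 (2 * n) ⟨one_pos, by linarith, by simp⟩ ?_)
    intro i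
    have h1 := abs_lt.1 (hx i)
    have h2 : ((π i : ℕ) : ℝ) + 1 ≤ n := by exact_mod_cast (π i).2
    have h3 : (0 : ℝ) ≤ (π i : ℕ) := Nat.cast_nonneg _
    exact ⟨x i, ⟨by linarith, by linarith⟩, by linarith [h1.1], by linarith [h1.2]⟩

theorem decisionTree_lower_bound :
    ∃ c : ℝ, 0 < c ∧ ∀ n : ℕ, 2 ≤ n → ∀ T : DecisionTree (Fin n ⊕ Fin 2) (Fin n),
      (∀ (x : Fin n → ℝ) (z β : ℝ), IsInstance n z β → Containing x z β →
        IsOptimal x z β (T.eval (treeInput x z β))) →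
      c * (n * Real.log n) ≤ T.height := by
  have hlog : 0 < Real.log 3 := Real.log_pos (by norm_num)
  refine ⟨1 / (2 * Real.log 3), by positivity, fun n hn T hT => ?_⟩
  have h1 : n ^ n ≤ (3 ^ T.height) ^ 2 := (pow_self_le_factorial_sq n).trans
    (Nat.pow_le_pow_left (factorial_le_three_pow_height hn T hT) 2)
  have h2 : (n : ℝ) ^ n ≤ (3 ^ T.height) ^ 2 := by exact_mod_cast h1
  have h3 := Real.log_le_log (by positivity) h2
  rw [Real.log_pow, Real.log_pow, Real.log_pow] at h3
  rw [div_mul_eq_mul_div, one_mul, div_le_iff₀ (by positivity)]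
  push_cast at h3
  linarith

end BarrierCoverage

theorem mainTheorem1 :
    -- one program finds an optimal solution of every instance in `O(n log n)` steps
    (∃ (P : BarrierCoverage.Program) (C : ℝ),
      ∀ (n : ℕ) (x : Fin n → ℝ) (z β : ℝ), BarrierCoverage.IsInstance n z β →
        ∃ (y : Fin n → ℝ) (t : ℕ),
          P.Run (BarrierCoverage.encodeInput x z β) (BarrierCoverage.encodeOutput y) t ∧
          BarrierCoverage.IsOptimal x z β y ∧
          (t : ℝ) ≤ C * (n * Real.log n)) ∧
    -- `Ω(n log n)` tests are necessary, even if only the containing case has to be solved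
    (∃ c : ℝ, 0 < c ∧
      ∀ (n : ℕ), 2 ≤ n →
        ∀ T : BarrierCoverage.DecisionTree (Fin n ⊕ Fin 2) (Fin n),
          (∀ (x : Fin n → ℝ) (z β : ℝ), BarrierCoverage.IsInstance n z β →
            BarrierCoverage.Containing x z β →
            BarrierCoverage.IsOptimal x z β (T.eval (BarrierCoverage.treeInput x z β))) →
          c * (n * Real.log n) ≤ T.height) :=
  ⟨BarrierCoverage.exists_program, BarrierCoverage.decisionTree_lower_bound⟩
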